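/- Let $R$ be a commutative ring. All modules are $R$-modules and all bidegrees $(p,n)$ range over $\mathbb Z\times\mathbb Z$. **Categories.** For $r\ge 0$, an $r$-bigraded complex is a bigraded module $A=(A^{p,n})$ with a differential $d\colon A^{p,n}\to A^{p-r,n+1-r}$, $d^2=0$; they form the category $r\text{-}\mathsf C$. Translation $\mathcal T\colon r\text{-}\mathsf C\to(r+1)\text{-}\mathsf C$, $(\mathcal TA)^{p,n}=A^{n,2n-p}$ with the same differential, is an isomorphism of categories. An extended spectral sequence $X$ consists of $r$-bigraded complexes $X_r$ ($r\ge0$) and maps of bigraded modules $\varphi_{r+1}\colon X_{r+1}\to H(X_r)$; morphisms are families of morphisms of complexes $X_r\to Y_r$ compatible with the $\varphi$'s. This category is $\mathsf{eSpSe}$. A linear witness book $L$ consists of $r$-bigraded complexes $L_r$ ($r\ge0$) and maps $w_{r+1}\colon L_{r+1}\to L_r$ of bidegree $(0,0)$ and $s_r\colon L_r\to L_{r+1}$ of bidegree $(1,1)$ with $w_{r+1}s_r=0$, $s_rw_{r+1}=0$ and $w_{r+1}d_{r+1}s_r=d_r$; morphisms are families of morphisms of complexes commuting with all $w$ and $s$.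 This category is $\mathsf{LWB}$, and $\mathsf{LWB}_{\ge1}$ is the analogous category with pages $r\ge1$ only. Pagewise translation is an isomorphism $\mathcal T\colon\mathsf{LWB}\to\mathsf{LWB}_{\ge1}$ (raising page numbers by one). **Functors.** * $\mathcal U_{[r]}\colon\mathsf{LWB}\to r\text{-}\mathsf C$, $L\mapsto L_r$, and $\mathcal F_{[r]}$ is its left adjoint; $\mathcal U_{\ge1}\colon\mathsf{LWB}\to\mathsf{LWB}_{\ge1}$ forgets page $0$. * $\mathcal F_{\ge1}\colon\mathsf{LWB}_{\ge1}\to\mathsf{LWB}$, the left adjoint of $\mathcal U_{\ge1}$, adds the page $0$ given by the bigraded module of page $1$, with $d_0=0$, $w_1=1$, $s_0=0$; and $(\mathcal W_{\ge1})_!$ is the left adjoint of $\mathcal F_{\ge1}$. * $Q\colon\mathsf{LWB}\to\mathsf{eSpSe}$: $Q(L)_0=L_0$, $Q(L)_r=L_r/(s_{r-1}L_{r-1}+d_rs_{r-1}L_{r-1})$ for $r\ge1$, with $\varphi_{r+1}[a]=[w_{r+1}a]$. * $N\colon\mathsf{eSpSe}\to\mathsf{LWB}$: call $(x_0,\dots,x_r)$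 with $x_i\in X_i^{p,n}$ compatible if, for each $i<r$, $x_i$ is a cycle with $\varphi_{i+1}(x_{i+1})=[x_i]$. Then $N(X)_r^{p,n}$ is the module of pairs $(x;y)$ of compatible sequences $x=(x_0,\dots,x_r)$ in bidegree $(p,n)$ and $y=(y_0,\dots,y_r)$ in bidegree $(p-r,n+1-r)$ with $d_rx_r=y_r$; and $d(x;y)=(y;0)$, $w(x;y)=((x_0,\dots,x_{r-1});0)$, $s(x;y)=(0;(y_0,\dots,y_r,0))$. * On $\mathsf{eSpSe}$: $\operatorname{Shift}=Q\circ\mathcal F_{\ge1}\circ\mathcal T\circ N$, $\operatorname{Dec}=Q\circ\mathcal T^{-1}\circ\mathcal U_{\ge1}\circ N$, $\operatorname{LDec}=Q\circ\mathcal T^{-1}\circ(\mathcal W_{\ge1})_!\circ N$. **Model structures.** A model category has all small limits and colimits and functorial factorizations; a model structure is determined by its fibrations and weak equivalences. * $r\text{-}\mathsf C$: the fibrations are the bidegreewise surjections and the weak equivalences are the quasi-isomorphisms (the projective model structure). * $\mathsf{LWB}_r$ on $\mathsf{LWB}$ and $\mathsf{eSpSe}_r$ on $\mathsf{eSpSe}$: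 the fibrations are the $f$ such that $f_i$ is bidegreewise surjective for $0\le i\le r$, and the weak equivalences are the $f$ such that $f_r$ is a quasi-isomorphism. **Corollary.** These model structures exist for all $r\ge0$, and for every $r\ge0$ each of the following (left adjoint first) is an adjunction and a Quillen equivalence: 1. $\operatorname{Shift}^r\colon\mathsf{eSpSe}_0\rightleftarrows\mathsf{eSpSe}_r:\operatorname{Dec}^r$ and $\operatorname{LDec}^r\colon\mathsf{eSpSe}_r\rightleftarrows\mathsf{eSpSe}_0:\operatorname{Shift}^r$; 2. $\operatorname{Shift}\colon\mathsf{eSpSe}_r\rightleftarrows\mathsf{eSpSe}_{r+1}:\operatorname{Dec}$ and $\operatorname{LDec}\colon\mathsf{eSpSe}_{r+1}\rightleftarrows\mathsf{eSpSe}_r:\operatorname{Shift}$; 3. $Q\colon\mathsf{LWB}_r\rightleftarrows\mathsf{eSpSe}_r:N$; 4. $\mathcal F_{[r]}\colon r\text{-}\mathsf C\rightleftarrows\mathsf{LWB}_r:\mathcal U_{[r]}$; 5. $(\mathcal F_{\ge1}\mathcal T)^r\colon\mathsf{LWB}_0\rightleftarrows\mathsf{LWB}_r:(\mathcal T^{-1}\mathcal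 U_{\ge1})^r$ and $\mathcal F_{\ge1}\mathcal T\colon\mathsf{LWB}_r\rightleftarrows\mathsf{LWB}_{r+1}:\mathcal T^{-1}\mathcal U_{\ge1}$; 6. $\mathcal T^r\colon 0\text{-}\mathsf C\rightleftarrows r\text{-}\mathsf C:\mathcal T^{-r}$ and $\mathcal T\colon r\text{-}\mathsf C\rightleftarrows(r+1)\text{-}\mathsf C:\mathcal T^{-1}$, where moreover $\mathcal T^r$ and $\mathcal T$ are equivalences of categories. In particular every $\mathsf{eSpSe}_r$ is Quillen equivalent to the projective model structure on $0\text{-}\mathsf C$, through $Q\circ\mathcal F_{[r]}\circ\mathcal T^r\dashv\mathcal T^{-r}\circ\mathcal U_{[r]}\circ N$. -/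

import Mathlib

open CategoryTheory Limits HomotopicalAlgebra

universe u v₁ v₂ u₁ u₂

noncomputable section

namespace SpecSeq

/-! ### Quillen equivalences -/

section Quillen

variable {C : Type u₁} [Category.{v₁} C] {D : Type u₂} [Category.{v₂} D]

/-- `M` is a model structure on `C` whose fibrations are `F` and whose weak equivalences are `W`
(its cofibrations are then determined by lifting), in the strong sense: `C` has all small limits
and colimits and the two factorizations can be chosen functorially. -/
structure IsModelStructure (M : ModelCategory C) (F W : MorphismProperty C) : Prop where
  hasLimits : HasLimits C
  hasColimits : HasColimits C
  functorial_trivialCofibrations_fibrations :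
    MorphismProperty.HasFunctorialFactorization (trivialCofibrations C) (fibrations C)
  functorial_cofibrations_trivialFibrations :
    MorphismProperty.HasFunctorialFactorization (cofibrations C) (trivialFibrations C)
  fibrations_eq : fibrations C = F
  weakEquivalences_eq : weakEquivalences C = W

/-- A Quillen adjunction: the left adjoint preserves cofibrations and trivial cofibrations. -/
structure IsQuillenAdjunction [ModelCategory C] [ModelCategory D] {L : C ⥤ D} {G : D ⥤ C}
    (_adj : L ⊣ G) : Prop where
  map_cofibration : ∀ ⦃X Y : C⦄ (f : X ⟶ Y), cofibrations C f → cofibrations D (L.map f)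
  map_trivialCofibration : ∀ ⦃X Y : C⦄ (f : X ⟶ Y),
    trivialCofibrations C f → trivialCofibrations D (L.map f)

/-- A Quillen equivalence: a Quillen adjunction such that, for `X` cofibrant and `Y` fibrant,
a map `L X ⟶ Y` is a weak equivalence if and only if its adjunct `X ⟶ G Y` is. -/
structure IsQuillenEquivalence [ModelCategory C] [ModelCategory D] {L : C ⥤ D} {G : D ⥤ C}
    (adj : L ⊣ G) : Prop extends IsQuillenAdjunction adj where
  weakEquivalence_iff : ∀ (X : C) (Y : D), IsCofibrant X → IsFibrant Y → ∀ f : L.obj X ⟶ Y,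
    (weakEquivalences D f ↔ weakEquivalences C (adj.homEquiv X Y f))

/-- `L` is left adjoint to `G`, and the adjunction (any choice of it) is a Quillen equivalence
from the model category `(C, M)` to the model category `(D, N)`. -/
def QuillenEquivalencePair (M : ModelCategory C) (N : ModelCategory D) (L : C ⥤ D) (G : D ⥤ C) :
    Prop :=
  Nonempty (L ⊣ G) ∧ ∀ adj : L ⊣ G, IsQuillenEquivalence adj

/-- The iterate `F ∘ F ∘ ⋯ ∘ F` (`n` factors) of an endofunctor. -/
def iter (F : C ⥤ C) : ℕ → C ⥤ C
  | 0 => 𝟭 C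
  | n + 1 => iter F n ⋙ F

end Quillen

/-! ### Bigraded complexes -/

/-- The bidegree `(-r, 1 - r)` of the differential of an `r`-bigraded complex. -/
abbrev δ (r : ℕ) : ℤ × ℤ := (-(r : ℤ), 1 - (r : ℤ))

/-- The shape of `r`-bigraded complexes: differentials go from `(p, n)` to `(p - r, n + 1 - r)`. -/
abbrev shape (r : ℕ) : ComplexShape (ℤ × ℤ) := ComplexShape.up' (δ r)

/-- The category of `r`-bigraded complexes of `R`-modules. -/
abbrev RBC (R : Type u) [CommRing R] (r : ℕ) : Type (u + 1) :=
  HomologicalComplex (ModuleCat.{u} R) (shape r)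

variable {R : Type u} [CommRing R]

/-- Extend differentials `X b ⟶ X c`, given for `b + δ r = c`, by zero. -/
def mkD (r : ℕ) {X : ℤ × ℤ → ModuleCat.{u} R} (d : ∀ b c, b + δ r = c → (X b ⟶ X c))
    (b c : ℤ × ℤ) : X b ⟶ X c :=
  if h : b + δ r = c then d b c h else 0

lemma mkD_pos {r : ℕ} {X : ℤ × ℤ → ModuleCat.{u} R} (d : ∀ b c, b + δ r = c → (X b ⟶ X c))
    {b c : ℤ × ℤ} (h : b + δ r = c) : mkD r d b c = d b c h :=
  dif_pos h

lemma mkD_neg {r : ℕ} {X : ℤ × ℤ → ModuleCat.{u} R} (d : ∀ b c, b + δ r = c → (X b ⟶ X c))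
    {b c : ℤ × ℤ} (h : ¬ b + δ r = c) : mkD r d b c = 0 :=
  dif_neg h

/-- Build an `r`-bigraded complex from its modules and its (possibly nonzero) differentials. -/
@[simps]
def mkRBC (r : ℕ) (X : ℤ × ℤ → ModuleCat.{u} R) (d : ∀ b c, b + δ r = c → (X b ⟶ X c))
    (sq : ∀ a b c h h', d a b h ≫ d b c h' = 0) : RBC R r where
  X := X
  d b c := mkD r d b c
  shape b c h := mkD_neg d h
  d_comp_d' a b c h h' := by
    rw [mkD_pos d h, mkD_pos d h']
    exact sq a b c h h'

lemma δ_succ {r : ℕ} {b c e : ℤ × ℤ} (h : b + (1, 1) = c) : b + δ r = e ↔ c + δ (r + 1) = e := by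
  subst h
  simp only [δ, Prod.ext_iff, Prod.fst_add, Prod.snd_add, Nat.cast_add, Nat.cast_one]
  omega

/-- The reindexing of bidegrees `(p, n) ↦ (n, 2n - p)` of the translation functor. -/
def τ (b : ℤ × ℤ) : ℤ × ℤ := (b.2, 2 * b.2 - b.1)

/-- The inverse reindexing `(p, n) ↦ (2p - n, p)`. -/
def τinv (b : ℤ × ℤ) : ℤ × ℤ := (2 * b.1 - b.2, b.1)

lemma τ_τinv (b : ℤ × ℤ) : τ (τinv b) = b := by ext <;> simp [τ, τinv]

lemma τinv_τ (b : ℤ × ℤ) : τinv (τ b) = b := by ext <;> simp [τ, τinv]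

lemma τ_rel {r : ℕ} {b c : ℤ × ℤ} (h : τ b + δ r = τ c) : b + δ (r + 1) = c := by
  simp only [τ, δ, Prod.ext_iff, Prod.fst_add, Prod.snd_add, Nat.cast_add, Nat.cast_one] at h ⊢
  omega

lemma τinv_rel {r : ℕ} {b c : ℤ × ℤ} (h : τinv b + δ (r + 1) = τinv c) : b + δ r = c := by
  simp only [τinv, δ, Prod.ext_iff, Prod.fst_add, Prod.snd_add, Nat.cast_add, Nat.cast_one] at h ⊢
  omega

lemma τ_diag {b c : ℤ × ℤ} (h : b + (1, 1) = c) : τ b + (1, 1) = τ c := by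
  simp only [τ, Prod.ext_iff, Prod.fst_add, Prod.snd_add] at h ⊢
  omega

lemma τinv_diag {b c : ℤ × ℤ} (h : b + (1, 1) = c) : τinv b + (1, 1) = τinv c := by
  simp only [τinv, Prod.ext_iff, Prod.fst_add, Prod.snd_add] at h ⊢
  omega

/-- The translation functor `𝒯` from `r`-bigraded to `(r+1)`-bigraded complexes,
`(𝒯 A)^{p,n} = A^{n,2n-p}` with the differential of `A`. -/
@[simps]
def trans (R : Type u) [CommRing R] (r : ℕ) : RBC R r ⥤ RBC R (r + 1) where
  obj A :=
    { X := fun b => A.X (τ b)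
      d := fun b c => A.d (τ b) (τ c)
      shape := fun _ _ h => A.shape _ _ (fun h' => h (τ_rel h'))
      d_comp_d' := fun _ _ _ _ _ => A.d_comp_d _ _ _ }
  map f := { f := fun b => f.f (τ b), comm' := fun _ _ _ => f.comm _ _ }

/-- The inverse translation functor `𝒯⁻¹`. -/
@[simps]
def transInv (R : Type u) [CommRing R] (r : ℕ) : RBC R (r + 1) ⥤ RBC R r where
  obj A :=
    { X := fun b => A.X (τinv b)
      d := fun b c => A.d (τinv b) (τinv c)
      shape := fun _ _ h => A.shape _ _ (fun h' => h (τinv_rel h'))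
      d_comp_d' := fun _ _ _ _ _ => A.d_comp_d _ _ _ }
  map f := { f := fun b => f.f (τinv b), comm' := fun _ _ _ => f.comm _ _ }

/-- The iterated translation functor `𝒯ʳ` from `0`-bigraded to `r`-bigraded complexes. -/
def transPow (R : Type u) [CommRing R] : ∀ r : ℕ, RBC R 0 ⥤ RBC R r
  | 0 => 𝟭 _
  | r + 1 => transPow R r ⋙ trans R r

/-- The iterated inverse translation functor `𝒯⁻ʳ`. -/
def transInvPow (R : Type u) [CommRing R] : ∀ r : ℕ, RBC R r ⥤ RBC R 0
  | 0 => 𝟭 _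
  | r + 1 => transInv R r ⋙ transInvPow R r

/-- Bidegreewise surjective morphisms of `r`-bigraded complexes. -/
def surjective (R : Type u) [CommRing R] (r : ℕ) : MorphismProperty (RBC R r) :=
  fun _ _ f => ∀ b, Function.Surjective (f.f b)

/-- Quasi-isomorphisms of `r`-bigraded complexes. -/
def quasiIsos (R : Type u) [CommRing R] (r : ℕ) : MorphismProperty (RBC R r) :=
  fun _ _ f => QuasiIso f

/-! ### Extended spectral sequences -/

/-- An extended spectral sequence: `r`-bigraded complexes `X_r` for `r ≥ 0`, with characteristic
maps `φ_{r+1} : X_{r+1} ⟶ H(X_r)` of bigraded modules. -/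
structure ESpSe (R : Type u) [CommRing R] : Type (u + 1) where
  page : ∀ r : ℕ, RBC R r
  char : ∀ (r : ℕ) (b : ℤ × ℤ), (page (r + 1)).X b ⟶ (page r).homology b

namespace ESpSe

/-- Morphisms of extended spectral sequences: morphisms of pages compatible with the
characteristic maps. -/
@[ext]
structure Hom (X Y : ESpSe R) : Type u where
  f : ∀ r : ℕ, X.page r ⟶ Y.page r
  comm : ∀ (r : ℕ) (b : ℤ × ℤ), (f (r + 1)).f b ≫ Y.char r b =
    X.char r b ≫ HomologicalComplex.homologyMap (f r) b

instance : Category (ESpSe R) where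
  Hom := Hom
  id X := { f := fun r => 𝟙 (X.page r), comm := fun r b => by simp }
  comp f g :=
    { f := fun r => f.f r ≫ g.f r
      comm := fun r b => by
        rw [HomologicalComplex.comp_f, Category.assoc, g.comm, ← Category.assoc, f.comm,
          HomologicalComplex.homologyMap_comp, Category.assoc] }
  id_comp _ := by apply Hom.ext; funext r; exact Category.id_comp _
  comp_id _ := by apply Hom.ext; funext r; exact Category.comp_id _
  assoc _ _ _ := by apply Hom.ext; funext r; exact Category.assoc _ _ _

@[simp] lemma id_f (X : ESpSe R) (r : ℕ) : Hom.f (𝟙 X) r = 𝟙 (X.page r) := rfl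

@[simp] lemma comp_f {X Y Z : ESpSe R} (f : X ⟶ Y) (g : Y ⟶ Z) (r : ℕ) :
    (f ≫ g).f r = f.f r ≫ g.f r := rfl

@[ext]
lemma hom_ext {X Y : ESpSe R} {f g : X ⟶ Y} (h : ∀ r, f.f r = g.f r) : f = g :=
  Hom.ext (funext h)

end ESpSe

/-- The `r`-fibrations of extended spectral sequences: surjective on the pages `0, …, r`. -/
def ESpSe.fib (R : Type u) [CommRing R] (r : ℕ) : MorphismProperty (ESpSe R) :=
  fun _ _ f => ∀ i ≤ r, surjective R i (f.f i)

/-- The `r`-weak equivalences `ℰ_r` of extended spectral sequences: quasi-isomorphisms on the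
page `r`. -/
def ESpSe.weq (R : Type u) [CommRing R] (r : ℕ) : MorphismProperty (ESpSe R) :=
  fun _ _ f => quasiIsos R r (f.f r)

/-! ### Linear witness books -/

/-- A truncated linear witness book with pages `k, k+1, …`: the page number `i + k` is called
`page i`. It is an `(i+k)`-bigraded complex; `w i` is the witness map, of bidegree `(0,0)`, from the
page `i + 1` to the page `i`, and `s i` is the degeneracy map, of bidegree `(1,1)`, from the page `i`
to the page `i + 1`.
For `k = 0` these are the linear witness books. -/
structure LWB (R : Type u) [CommRing R] (k : ℕ) : Type (u + 1) where
  page : ∀ i : ℕ, RBC R (i + k)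
  w : ∀ (i : ℕ) (b : ℤ × ℤ), (page (i + 1)).X b ⟶ (page i).X b
  s : ∀ (i : ℕ) (b c : ℤ × ℤ), b + (1, 1) = c → ((page i).X b ⟶ (page (i + 1)).X c)
  s_w : ∀ (i : ℕ) (b c : ℤ × ℤ) (h : b + (1, 1) = c), s i b c h ≫ w i c = 0
  w_s : ∀ (i : ℕ) (b c : ℤ × ℤ) (h : b + (1, 1) = c), w i b ≫ s i b c h = 0
  s_d_w : ∀ (i : ℕ) (b c e : ℤ × ℤ) (h : b + (1, 1) = c),
    s i b c h ≫ (page (i + 1)).d c e ≫ w i e = (page i).d b e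

namespace LWB

variable {k : ℕ}

/-- Morphisms of (truncated) linear witness books. -/
@[ext]
structure Hom (K L : LWB R k) : Type u where
  f : ∀ i : ℕ, K.page i ⟶ L.page i
  comm_w : ∀ (i : ℕ) (b : ℤ × ℤ), (f (i + 1)).f b ≫ L.w i b = K.w i b ≫ (f i).f b
  comm_s : ∀ (i : ℕ) (b c : ℤ × ℤ) (h : b + (1, 1) = c),
    (f i).f b ≫ L.s i b c h = K.s i b c h ≫ (f (i + 1)).f c

instance : Category (LWB R k) where
  Hom := Hom
  id K := { f := fun i => 𝟙 (K.page i), comm_w := fun r b => by simp, comm_s := by simp }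
  comp f g :=
    { f := fun i => f.f i ≫ g.f i
      comm_w := fun i b => by
        rw [HomologicalComplex.comp_f, Category.assoc, g.comm_w, ← Category.assoc, f.comm_w,
          Category.assoc, HomologicalComplex.comp_f]
      comm_s := fun i b c h => by
        rw [HomologicalComplex.comp_f, Category.assoc, g.comm_s, ← Category.assoc, f.comm_s,
          Category.assoc, HomologicalComplex.comp_f] }
  id_comp _ := by apply Hom.ext; funext r; exact Category.id_comp _
  comp_id _ := by apply Hom.ext; funext r; exact Category.comp_id _
  assoc _ _ _ := by apply Hom.ext; funext r; exact Category.assoc _ _ _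

@[simp] lemma id_f (K : LWB R k) (i : ℕ) : Hom.f (𝟙 K) i = 𝟙 (K.page i) := rfl

@[simp] lemma comp_f {K L M : LWB R k} (f : K ⟶ L) (g : L ⟶ M) (i : ℕ) :
    (f ≫ g).f i = f.f i ≫ g.f i := rfl

@[ext]
lemma hom_ext {K L : LWB R k} {f g : K ⟶ L} (h : ∀ i, f.f i = g.f i) : f = g :=
  Hom.ext (funext h)

lemma w_d (L : LWB R k) (i : ℕ) (b c : ℤ × ℤ) : L.w i b ≫ (L.page i).d b c = 0 := by
  rw [← L.s_d_w i b _ c rfl, ← Category.assoc, L.w_s, zero_comp]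

lemma d_s (L : LWB R k) (i : ℕ) (b c e : ℤ × ℤ) (h : c + (1, 1) = e) :
    (L.page i).d b c ≫ L.s i c e h = 0 := by
  rw [← L.s_d_w i b _ c rfl, Category.assoc, Category.assoc, L.w_s, comp_zero, comp_zero]

end LWB

/-- The `r`-fibrations of linear witness books: surjective on the pages `0, …, r`. -/
def LWB.fib (R : Type u) [CommRing R] (r : ℕ) : MorphismProperty (LWB R 0) :=
  fun _ _ f => ∀ i ≤ r, surjective R i (f.f i)

/-- The `r`-weak equivalences `ℰ_r` of linear witness books: quasi-isomorphisms on the page `r`. -/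
def LWB.weq (R : Type u) [CommRing R] (r : ℕ) : MorphismProperty (LWB R 0) :=
  fun _ _ f => quasiIsos R r (f.f r)

/-- The pagewise translation functor `𝒯` from linear witness books with pages `≥ k` to linear
witness books with pages `≥ k + 1`. -/
@[simps]
def LWB.trans (R : Type u) [CommRing R] (k : ℕ) : LWB R k ⥤ LWB R (k + 1) where
  obj L :=
    { page := fun i => (SpecSeq.trans R (i + k)).obj (L.page i)
      w := fun i b => L.w i (τ b)
      s := fun i b c h => L.s i (τ b) (τ c) (τ_diag h)
      s_w := fun i b c h => L.s_w _ _ _ _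
      w_s := fun i b c h => L.w_s _ _ _ _
      s_d_w := fun i b c e h => L.s_d_w _ _ _ _ _ }
  map f :=
    { f := fun i => (SpecSeq.trans R (i + k)).map (f.f i)
      comm_w := fun i b => f.comm_w _ _
      comm_s := fun i b c h => f.comm_s _ _ _ _ }

/-- The pagewise inverse translation functor `𝒯⁻¹`. -/
@[simps]
def LWB.transInv (R : Type u) [CommRing R] (k : ℕ) : LWB R (k + 1) ⥤ LWB R k where
  obj L :=
    { page := fun i => (SpecSeq.transInv R (i + k)).obj (L.page i)
      w := fun i b => L.w i (τinv b)
      s := fun i b c h => L.s i (τinv b) (τinv c) (τinv_diag h)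
      s_w := fun i b c h => L.s_w _ _ _ _
      w_s := fun i b c h => L.w_s _ _ _ _
      s_d_w := fun i b c e h => L.s_d_w _ _ _ _ _ }
  map f :=
    { f := fun i => (SpecSeq.transInv R (i + k)).map (f.f i)
      comm_w := fun i b => f.comm_w _ _
      comm_s := fun i b c h => f.comm_s _ _ _ _ }

/-- The forgetful functor `𝒰_[r]` sending a linear witness book to its page `r`. -/
@[simps]
def LWB.pageFunctor (R : Type u) [CommRing R] (r : ℕ) : LWB R 0 ⥤ RBC R r where
  obj L := L.page r
  map f := f.f r

/-- The forgetful functor `𝒰_{≥ 1}` removing the page `0`. -/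
@[simps]
def LWB.trunc (R : Type u) [CommRing R] : LWB R 0 ⥤ LWB R 1 where
  obj L :=
    { page := fun i => L.page (i + 1)
      w := fun i b => L.w (i + 1) b
      s := fun i b c h => L.s (i + 1) b c h
      s_w := fun i b c h => L.s_w _ _ _ _
      w_s := fun i b c h => L.w_s _ _ _ _
      s_d_w := fun i b c e h => L.s_d_w _ _ _ _ _ }
  map f :=
    { f := fun i => f.f (i + 1)
      comm_w := fun i b => f.comm_w _ _
      comm_s := fun i b c h => f.comm_s _ _ _ _ }

/-- A bigraded module as an `r`-bigraded complex with zero differential. -/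
def zeroDiff (r : ℕ) (X : ℤ × ℤ → ModuleCat.{u} R) : RBC R r where
  X := X
  d _ _ := 0

/-- The pages of `ℱ_{≥ 1} K`: the bigraded module `K_1` with zero differential on page `0`, and the
pages of `K` from then on. -/
def LWB.extendPage (K : LWB R 1) : ∀ i : ℕ, RBC R (i + 0)
  | 0 => zeroDiff 0 (K.page 0).X
  | i + 1 => K.page i

/-- The functor `ℱ_{≥ 1} = 𝒲_{≥ 1}^*`, given on the new page `0` by `d = 0`, `w = 1`, `s = 0`. -/
def LWB.extend (R : Type u) [CommRing R] : LWB R 1 ⥤ LWB R 0 where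
  obj K :=
    { page := K.extendPage
      w := fun i b => match i with
        | 0 => 𝟙 ((K.page 0).X b)
        | i + 1 => K.w i b
      s := fun i b c h => match i with
        | 0 => 0
        | i + 1 => K.s i b c h
      s_w := fun i b c h => match i with
        | 0 => zero_comp
        | i + 1 => K.s_w i b c h
      w_s := fun i b c h => match i with
        | 0 => comp_zero
        | i + 1 => K.w_s i b c h
      s_d_w := fun i b c e h => match i with
        | 0 => zero_comp
        | i + 1 => K.s_d_w i b c e h }
  map {K L} f :=
    { f := fun i => match i with
        | 0 => { f := fun b => (f.f 0).f b, comm' := fun _ _ _ => comp_zero.trans zero_comp.symm }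
        | i + 1 => f.f i
      comm_w := fun i b => match i with
        | 0 => (Category.comp_id _).trans (Category.id_comp _).symm
        | i + 1 => f.comm_w i b
      comm_s := fun i b c h => match i with
        | 0 => comp_zero.trans zero_comp.symm
        | i + 1 => f.comm_s i b c h }
  map_id K := by
    apply LWB.hom_ext
    rintro (_ | i) <;> rfl
  map_comp f g := by
    apply LWB.hom_ext
    rintro (_ | i) <;> rfl

/-- The functor `ℱ_{≥ 1} ∘ 𝒯` on linear witness books. -/
def LWB.extendTrans (R : Type u) [CommRing R] : LWB R 0 ⥤ LWB R 0 :=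
  LWB.trans R 0 ⋙ LWB.extend R

/-- The functor `𝒯⁻¹ ∘ 𝒰_{≥ 1}` on linear witness books. -/
def LWB.transTrunc (R : Type u) [CommRing R] : LWB R 0 ⥤ LWB R 0 :=
  LWB.trunc R ⋙ LWB.transInv R 0

/-! ### The left adjoints of the page functors -/

/-- Transport of the quotients `A / B(A)` (called `opcycles`) along an equality of bidegrees. -/
def opCast {r : ℕ} (A : RBC R r) {b c : ℤ × ℤ} (h : b = c) : A.opcycles b ⟶ A.opcycles c :=
  eqToHom (by rw [h])

lemma opCast_naturality {r : ℕ} {A A' : RBC R r} (f : A ⟶ A') {b c : ℤ × ℤ} (h : b = c) :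
    HomologicalComplex.opcyclesMap f b ≫ opCast A' h =
      opCast A h ≫ HomologicalComplex.opcyclesMap f c := by
  subst h
  simp [opCast]

lemma opCast_fromOpcycles {r : ℕ} (A : RBC R r) {b c : ℤ × ℤ} (h : b = c) (e : ℤ × ℤ) :
    opCast A h ≫ A.fromOpcycles c e = A.fromOpcycles b e := by
  subst h
  simp [opCast]

lemma opCast_opCast {r : ℕ} (A : RBC R r) {b c e : ℤ × ℤ} (h : b = c) (h' : c = e) :
    opCast A h ≫ opCast A h' = opCast A (h.trans h') := by
  subst h h'
  simp [opCast]

/-- The bidegree `b` of the page `i + 1` of `ℱ_[0] A`, which is `Cone_{i+1}(A / B(A))` in bidegree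
`b - (i+1, i+1)`. -/
abbrev freeX (A : RBC R 0) (i : ℕ) (b : ℤ × ℤ) : ModuleCat.{u} R :=
  A.opcycles (b - ((i : ℤ) + 1, (i : ℤ) + 1)) ⊞ A.opcycles (b + (0, -1))

/-- The differential `(x, y) ↦ (0, x)` of the page `i + 1` of `ℱ_[0] A`. -/
def freeD (A : RBC R 0) (i : ℕ) (b c : ℤ × ℤ) (h : b + δ (i + 1) = c) :
    freeX A i b ⟶ freeX A i c :=
  biprod.fst ≫ opCast A (by subst h; ext <;> simp [δ] <;> omega) ≫ biprod.inr

/-- The pages of `ℱ_[0] A`. -/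
def freePage (A : RBC R 0) : ∀ i : ℕ, RBC R (i + 0)
  | 0 => A
  | i + 1 => mkRBC (i + 1) (freeX A i) (freeD A i) (fun a b c h h' => by simp [freeD])

/-- The witness map `(x, y) ↦ d y` from the page `1` to the page `0` of `ℱ_[0] A`. -/
def freeWZero (A : RBC R 0) (b : ℤ × ℤ) : freeX A 0 b ⟶ A.X b :=
  biprod.snd ≫ A.fromOpcycles (b + (0, -1)) b

/-- The witness map `(x, y) ↦ (0, y)` from the page `i + 2` to the page `i + 1` of `ℱ_[0] A`. -/
def freeW (A : RBC R 0) (i : ℕ) (b : ℤ × ℤ) : freeX A (i + 1) b ⟶ freeX A i b :=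
  biprod.snd ≫ biprod.inr

/-- The degeneracy map `x ↦ (x, 0)` from the page `0` to the page `1` of `ℱ_[0] A`. -/
def freeSZero (A : RBC R 0) (b c : ℤ × ℤ) (h : b + (1, 1) = c) : A.X b ⟶ freeX A 0 c :=
  A.pOpcycles b ≫ opCast A (by subst h; ext <;> simp) ≫ biprod.inl

/-- The degeneracy map `(x, y) ↦ (x, 0)` from the page `i + 1` to the page `i + 2` of `ℱ_[0] A`. -/
def freeS (A : RBC R 0) (i : ℕ) (b c : ℤ × ℤ) (h : b + (1, 1) = c) :
    freeX A i b ⟶ freeX A (i + 1) c :=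
  biprod.fst ≫ opCast A (by subst h; ext <;> simp) ≫ biprod.inl

lemma freeS_d_w_zero (A : RBC R 0) (b c e : ℤ × ℤ) (h : b + (1, 1) = c) :
    freeSZero A b c h ≫ mkD 1 (freeD A 0) c e ≫ freeWZero A e = A.d b e := by
  by_cases h' : b + δ 0 = e
  · rw [mkD_pos _ ((δ_succ h).1 h')]
    simp only [freeSZero, freeD, freeWZero, Category.assoc, biprod.inl_fst_assoc,
      biprod.inr_snd_assoc, opCast_fromOpcycles, HomologicalComplex.p_fromOpcycles]
  · rw [mkD_neg _ (fun h'' => h' ((δ_succ h).2 h'')), A.shape _ _ h', zero_comp, comp_zero]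

lemma freeS_d_w (A : RBC R 0) (i : ℕ) (b c e : ℤ × ℤ) (h : b + (1, 1) = c) :
    freeS A i b c h ≫ mkD (i + 1 + 1) (freeD A (i + 1)) c e ≫ freeW A i e =
      mkD (i + 1) (freeD A i) b e := by
  by_cases h' : b + δ (i + 1) = e
  · rw [mkD_pos _ ((δ_succ h).1 h'), mkD_pos _ h']
    simp only [freeS, freeD, freeW, Category.assoc, biprod.inl_fst_assoc,
      biprod.inr_snd_assoc, reassoc_of% (@opCast_opCast)]
  · rw [mkD_neg _ (fun h'' => h' ((δ_succ h).2 h'')), mkD_neg _ h', zero_comp, comp_zero]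

/-- The morphism of the pages `i + 1` of `ℱ_[0] A` and `ℱ_[0] A'` induced by `f : A ⟶ A'`. -/
abbrev freeXMap {A A' : RBC R 0} (f : A ⟶ A') (i : ℕ) (b : ℤ × ℤ) : freeX A i b ⟶ freeX A' i b :=
  biprod.map (HomologicalComplex.opcyclesMap f _) (HomologicalComplex.opcyclesMap f _)

lemma freeXMap_d {A A' : RBC R 0} (f : A ⟶ A') (i : ℕ) (b c : ℤ × ℤ) :
    freeXMap f i b ≫ mkD (i + 1) (freeD A' i) b c =
      mkD (i + 1) (freeD A i) b c ≫ freeXMap f i c := by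
  by_cases h : b + δ (i + 1) = c
  · rw [mkD_pos _ h, mkD_pos _ h]
    simp [freeD, reassoc_of% (@opCast_naturality)]
  · rw [mkD_neg _ h, mkD_neg _ h, zero_comp, comp_zero]

lemma freeW_freeS_zero (A : RBC R 0) (b c : ℤ × ℤ) (h : b + (1, 1) = c) :
    freeWZero A b ≫ freeSZero A b c h = 0 := by
  have : A.fromOpcycles (b + (0, -1)) b ≫ A.pOpcycles b = 0 := by
    rw [← cancel_epi (A.pOpcycles _), HomologicalComplex.p_fromOpcycles_assoc,
      HomologicalComplex.d_pOpcycles, comp_zero]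
  simp only [freeSZero, freeWZero, Category.assoc, reassoc_of% this, zero_comp, comp_zero]

lemma freeXMap_wZero {A A' : RBC R 0} (f : A ⟶ A') (b : ℤ × ℤ) :
    freeXMap f 0 b ≫ freeWZero A' b = freeWZero A b ≫ f.f b := by
  have : HomologicalComplex.opcyclesMap f (b + (0, -1)) ≫ A'.fromOpcycles (b + (0, -1)) b =
      A.fromOpcycles (b + (0, -1)) b ≫ f.f b := by
    rw [← cancel_epi (A.pOpcycles _)]
    simp
  rw [freeXMap, freeWZero, freeWZero, biprod.map_snd_assoc, this, Category.assoc]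

/-- The morphism of pages of `ℱ_[0] A` and `ℱ_[0] A'` induced by `f : A ⟶ A'`. -/
def freePageMap {A A' : RBC R 0} (f : A ⟶ A') : ∀ i : ℕ, freePage A i ⟶ freePage A' i
  | 0 => f
  | i + 1 => { f := freeXMap f i, comm' := fun b c _ => freeXMap_d f i b c }

/-- The left adjoint `ℱ_[0]` of the functor `𝒰_[0]` from linear witness books to `0`-bigraded
complexes. -/
def freeZero (R : Type u) [CommRing R] : RBC R 0 ⥤ LWB R 0 where
  obj A :=
    { page := freePage A
      w := fun i b => match i with
        | 0 => freeWZero A b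
        | i + 1 => freeW A i b
      s := fun i b c h => match i with
        | 0 => freeSZero A b c h
        | i + 1 => freeS A i b c h
      s_w := fun i b c h => match i with
        | 0 => show freeSZero A b c h ≫ freeWZero A c = 0 by simp [freeSZero, freeWZero]
        | i + 1 => show freeS A i b c h ≫ freeW A i c = 0 by simp [freeS, freeW]
      w_s := fun i b c h => match i with
        | 0 => freeW_freeS_zero A b c h
        | i + 1 => show freeW A i b ≫ freeS A i b c h = 0 by simp [freeS, freeW]
      s_d_w := fun i b c e h => match i with
        | 0 => freeS_d_w_zero A b c e h
        | i + 1 => freeS_d_w A i b c e h }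
  map {A A'} f :=
    { f := freePageMap f
      comm_w := fun i b => match i with
        | 0 => freeXMap_wZero f b
        | i + 1 => show freeXMap f (i + 1) b ≫ freeW A' i b = freeW A i b ≫ freeXMap f i b by
            rw [freeXMap, freeXMap, freeW, freeW, biprod.map_snd_assoc, Category.assoc,
              biprod.inr_map]
      comm_s := fun i b c h => match i with
        | 0 => show f.f b ≫ freeSZero A' b c h = freeSZero A b c h ≫ freeXMap f 0 c by
            simp [freeSZero, ← reassoc_of% (@opCast_naturality)]
        | i + 1 => show freeXMap f i b ≫ freeS A' i b c h = freeS A i b c h ≫ freeXMap f (i + 1) c by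
            simp [freeS, reassoc_of% (@opCast_naturality)] }
  map_id A := by
    apply LWB.hom_ext
    rintro (_ | i)
    · rfl
    · ext b : 1
      change freeXMap (𝟙 A) i b = 𝟙 (freeX A i b)
      apply biprod.hom_ext <;> simp
  map_comp {A A' A''} f g := by
    apply LWB.hom_ext
    rintro (_ | i)
    · rfl
    · ext b : 1
      change freeXMap (f ≫ g) i b = freeXMap f i b ≫ freeXMap g i b
      apply biprod.hom_ext <;> simp [HomologicalComplex.opcyclesMap_comp]

/-- The left adjoint `ℱ_[r]` of the functor `𝒰_[r]` from linear witness books to `r`-bigraded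
complexes. Left Kan extension along `{r} ⊂ {≥ 1} ⊂ {≥ 0}` (and translation) gives
`ℱ_[r] = ℱ_{≥ 1} ∘ 𝒯 ∘ ℱ_[r-1] ∘ 𝒯⁻¹`, hence `ℱ_[r] = (ℱ_{≥ 1} ∘ 𝒯)ʳ ∘ ℱ_[0] ∘ 𝒯⁻ʳ`: explicitly
`ℱ_[r] A` is `A` with zero differential on the pages below `r`, it is `A` on the page `r`, and it is
`Cone_i(A / B(A))^{p+r-i,n+r-i}` on the pages `i > r`. -/
def free (R : Type u) [CommRing R] (r : ℕ) : RBC R r ⥤ LWB R 0 :=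
  transInvPow R r ⋙ freeZero R ⋙ iter (LWB.extendTrans R) r

/-! ### The left adjoint of `ℱ_{≥ 1}` -/

lemma XIsoOfEq_naturality {r : ℕ} {A A' : RBC R r} (f : A ⟶ A') {b c : ℤ × ℤ} (h : b = c) :
    f.f b ≫ (A'.XIsoOfEq h).hom = (A.XIsoOfEq h).hom ≫ f.f c := by
  subst h
  simp

namespace LWB

variable (L : LWB R 0)

/-- The iterated degeneracy map `sʲ` from the page `1` to the page `j + 1`. -/
def sPow : ∀ (j : ℕ) (b c : ℤ × ℤ), b + ((j : ℤ), (j : ℤ)) = c →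
    ((L.page 1).X b ⟶ (L.page (j + 1)).X c)
  | 0, b, c, h => ((L.page 1).XIsoOfEq (by rw [← h]; ext <;> simp)).hom
  | j + 1, b, c, h => sPow j b (b + ((j : ℤ), (j : ℤ))) rfl ≫
      L.s (j + 1) (b + ((j : ℤ), (j : ℤ))) c (by subst h; ext <;> simp <;> ring)

lemma sPow_s (j : ℕ) (b c e : ℤ × ℤ) (h : b + ((j : ℤ), (j : ℤ)) = c) (h' : c + (1, 1) = e)
    (h'' : b + (((j + 1 : ℕ) : ℤ), ((j + 1 : ℕ) : ℤ)) = e) :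
    L.sPow j b c h ≫ L.s (j + 1) c e h' = L.sPow (j + 1) b e h'' := by
  subst h
  rfl

lemma cast_sPow (j : ℕ) (b b' c : ℤ × ℤ) (hb : b = b') (h : b' + ((j : ℤ), (j : ℤ)) = c) :
    ((L.page 1).XIsoOfEq hb).hom ≫ L.sPow j b' c h = L.sPow j b c (by rw [hb, h]) := by
  subst hb
  simp

lemma sPow_w (j : ℕ) (b c : ℤ × ℤ) (h : b + (((j + 1 : ℕ) : ℤ), ((j + 1 : ℕ) : ℤ)) = c) :
    L.sPow (j + 1) b c h ≫ L.w (j + 1) c = 0 := by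
  rw [← L.sPow_s j b _ c rfl (by subst h; ext <;> simp <;> ring) h, Category.assoc, L.s_w,
    comp_zero]

lemma sPow_naturality {L L' : LWB R 0} (f : L ⟶ L') (j : ℕ) (b c : ℤ × ℤ)
    (h : b + ((j : ℤ), (j : ℤ)) = c) :
    L.sPow j b c h ≫ (f.f (j + 1)).f c = (f.f 1).f b ≫ L'.sPow j b c h := by
  induction j generalizing c with
  | zero =>
    have h' : b = c := by rw [← h]; ext <;> simp
    subst h'
    simp [sPow]
  | succ j ih =>
    rw [sPow, sPow, Category.assoc, ← f.comm_s, ← Category.assoc, ih, Category.assoc]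

lemma w_cast (i : ℕ) {b c : ℤ × ℤ} (h : b = c) :
    L.w i b ≫ ((L.page i).XIsoOfEq h).hom = ((L.page (i + 1)).XIsoOfEq h).hom ≫ L.w i c := by
  subst h
  simp

lemma sPow_d (j : ℕ) {b b' c c' : ℤ × ℤ} (e : ℤ × ℤ) (hb : b = b')
    (h : b + ((j : ℤ), (j : ℤ)) = c) (h' : b' + ((j : ℤ), (j : ℤ)) = c') :
    L.sPow j b c h ≫ (L.page (j + 1)).d c e =
      ((L.page 1).XIsoOfEq hb).hom ≫ L.sPow j b' c' h' ≫ (L.page (j + 1)).d c' e := by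
  subst hb h h'
  simp

/-- The generators `L_0^{p-j,n-j} ⊕ L_0^{p+1,n} ⊕ L_{j+1}^{p,n}` of the page `j + 1` of
`(𝒲_{≥ 1})_! L` in bidegree `(p, n)`. -/
abbrev leftGen (j : ℕ) (b : ℤ × ℤ) : ModuleCat.{u} R :=
  ((L.page 0).X (b - ((j : ℤ), (j : ℤ))) ⊞ (L.page 0).X (b + (1, 0))) ⊞ (L.page (j + 1)).X b

/-- The relations: `(w x, w y, 0) = (0, 0, sʲ x + d sʲ y)` for `x` and `y` in `L_1`. -/
def leftRel (j : ℕ) (b : ℤ × ℤ) :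
    ((L.page 1).X (b - ((j : ℤ), (j : ℤ))) ⊞ (L.page 1).X (b + (1, 0))) ⟶ L.leftGen j b :=
  biprod.lift (biprod.map (L.w 0 _) (L.w 0 _))
    (-biprod.desc (L.sPow j _ b (sub_add_cancel _ _))
      (L.sPow j (b + (1, 0)) (b + (1, 0) + ((j : ℤ), (j : ℤ))) rfl ≫ (L.page (j + 1)).d _ b))

/-- The bidegree `b` of the page `j + 1` of `(𝒲_{≥ 1})_! L`. -/
abbrev leftX (j : ℕ) (b : ℤ × ℤ) : ModuleCat.{u} R := cokernel (L.leftRel j b)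

/-- The map `(a, a', x) ↦ (0, a, d x)` inducing the differential. -/
def leftGenD (j : ℕ) (b c : ℤ × ℤ) (h : b + δ (j + 1) = c) : L.leftGen j b ⟶ L.leftGen j c :=
  biprod.map (biprod.fst ≫ ((L.page 0).XIsoOfEq (by subst h; ext <;> simp [δ] <;> ring)).hom ≫
    biprod.inr) ((L.page (j + 1)).d b c)

/-- The map `(a, a', x) ↦ (0, a', w x)` inducing the witness maps. -/
def leftGenW (j : ℕ) (b : ℤ × ℤ) : L.leftGen (j + 1) b ⟶ L.leftGen j b :=
  biprod.map (biprod.snd ≫ biprod.inr) (L.w (j + 1) b)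

/-- The map `(a, a', x) ↦ (a, 0, s x)` inducing the degeneracy maps. -/
def leftGenS (j : ℕ) (b c : ℤ × ℤ) (h : b + (1, 1) = c) : L.leftGen j b ⟶ L.leftGen (j + 1) c :=
  biprod.map (biprod.fst ≫ ((L.page 0).XIsoOfEq (by subst h; ext <;> simp)).hom ≫
    biprod.inl) (L.s (j + 1) b c h)

lemma leftGenD_rel (j : ℕ) (b c : ℤ × ℤ) (h : b + δ (j + 1) = c) :
    L.leftRel j b ≫ L.leftGenD j b c h =
      (biprod.fst ≫ ((L.page 1).XIsoOfEq (by subst h; ext <;> simp [δ] <;> ring)).hom ≫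
        biprod.inr) ≫ L.leftRel j c := by
  apply biprod.hom_ext' <;> apply biprod.hom_ext
  · simp [leftRel, leftGenD, reassoc_of% (@w_cast)]
  · simp [leftRel, leftGenD]
    exact L.sPow_d j c _ _ _
  · simp [leftRel, leftGenD]
  · simp [leftRel, leftGenD]

lemma leftGenW_rel (j : ℕ) (b : ℤ × ℤ) :
    L.leftRel (j + 1) b ≫ L.leftGenW j b = (biprod.snd ≫ biprod.inr) ≫ L.leftRel j b := by
  apply biprod.hom_ext' <;> apply biprod.hom_ext
  · simp [leftRel, leftGenW]
  · simp [leftRel, leftGenW]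
    exact L.sPow_w _ _ _ _
  · simp [leftRel, leftGenW]
  · simp [leftRel, leftGenW]
    rw [← L.sPow_s j (b + (1, 0)) (b + (1, 0) + ((j : ℤ), (j : ℤ)))
      (b + (1, 0) + ((j : ℤ) + 1, (j : ℤ) + 1)) rfl (by ext <;> simp <;> ring) (by simp),
      Category.assoc, L.s_d_w]

lemma leftGenS_rel (j : ℕ) (b c : ℤ × ℤ) (h : b + (1, 1) = c) :
    L.leftRel j b ≫ L.leftGenS j b c h =
      (biprod.fst ≫ ((L.page 1).XIsoOfEq (by subst h; ext <;> simp)).hom ≫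
        biprod.inl) ≫ L.leftRel (j + 1) c := by
  apply biprod.hom_ext' <;> apply biprod.hom_ext
  · simp [leftRel, leftGenS, reassoc_of% (@w_cast)]
  · simp [leftRel, leftGenS]
    rw [cast_sPow]
    exact L.sPow_s _ _ _ _ _ _ _
  · simp [leftRel, leftGenS]
  · simp [leftRel, leftGenS]
    rw [L.d_s, comp_zero]

/-- The differential of the page `j + 1` of `(𝒲_{≥ 1})_! L`. -/
def leftD (j : ℕ) (b c : ℤ × ℤ) (h : b + δ (j + 1) = c) : L.leftX j b ⟶ L.leftX j c :=
  cokernel.map _ _ _ _ (L.leftGenD_rel j b c h)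

/-- The witness maps of `(𝒲_{≥ 1})_! L`. -/
def leftW (j : ℕ) (b : ℤ × ℤ) : L.leftX (j + 1) b ⟶ L.leftX j b :=
  cokernel.map _ _ _ _ (L.leftGenW_rel j b)

/-- The degeneracy maps of `(𝒲_{≥ 1})_! L`. -/
def leftS (j : ℕ) (b c : ℤ × ℤ) (h : b + (1, 1) = c) : L.leftX j b ⟶ L.leftX (j + 1) c :=
  cokernel.map _ _ _ _ (L.leftGenS_rel j b c h)

variable {L}

/-- The map of generators induced by a morphism. -/
def leftGenMap {L' : LWB R 0} (f : L ⟶ L') (j : ℕ) (b : ℤ × ℤ) : L.leftGen j b ⟶ L'.leftGen j b :=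
  biprod.map (biprod.map ((f.f 0).f _) ((f.f 0).f _)) ((f.f (j + 1)).f b)

lemma leftGenMap_rel {L' : LWB R 0} (f : L ⟶ L') (j : ℕ) (b : ℤ × ℤ) :
    L.leftRel j b ≫ leftGenMap f j b =
      biprod.map ((f.f 1).f _) ((f.f 1).f _) ≫ L'.leftRel j b := by
  apply biprod.hom_ext' <;> apply biprod.hom_ext
  · simp [leftRel, leftGenMap, reassoc_of% (f.comm_w)]
  · simp [leftRel, leftGenMap, sPow_naturality]
  · simp [leftRel, leftGenMap, reassoc_of% (f.comm_w)]
  · simp [leftRel, leftGenMap]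
    rw [← f.f (j + 1) |>.comm, reassoc_of% (sPow_naturality f)]

/-- The map of pages induced by a morphism. -/
def leftMap {L' : LWB R 0} (f : L ⟶ L') (j : ℕ) (b : ℤ × ℤ) : L.leftX j b ⟶ L'.leftX j b :=
  cokernel.map _ _ _ _ (leftGenMap_rel f j b)

variable (L)

@[simp]
lemma π_leftD (j : ℕ) (b c : ℤ × ℤ) (h : b + δ (j + 1) = c) :
    cokernel.π (L.leftRel j b) ≫ L.leftD j b c h = L.leftGenD j b c h ≫ cokernel.π _ :=
  cokernel.π_desc _ _ _

@[simp]
lemma π_leftW (j : ℕ) (b : ℤ × ℤ) :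
    cokernel.π (L.leftRel (j + 1) b) ≫ L.leftW j b = L.leftGenW j b ≫ cokernel.π _ :=
  cokernel.π_desc _ _ _

@[simp]
lemma π_leftS (j : ℕ) (b c : ℤ × ℤ) (h : b + (1, 1) = c) :
    cokernel.π (L.leftRel j b) ≫ L.leftS j b c h = L.leftGenS j b c h ≫ cokernel.π _ :=
  cokernel.π_desc _ _ _

@[simp]
lemma π_leftMap {L L' : LWB R 0} (f : L ⟶ L') (j : ℕ) (b : ℤ × ℤ) :
    cokernel.π (L.leftRel j b) ≫ leftMap f j b = leftGenMap f j b ≫ cokernel.π _ :=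
  cokernel.π_desc _ _ _

lemma leftD_leftD (j : ℕ) (a b c : ℤ × ℤ) (h : a + δ (j + 1) = b) (h' : b + δ (j + 1) = c) :
    L.leftD j a b h ≫ L.leftD j b c h' = 0 := by
  have : L.leftGenD j a b h ≫ L.leftGenD j b c h' = 0 := by
    apply biprod.hom_ext' <;> simp [leftGenD]
  rw [← cancel_epi (cokernel.π _), reassoc_of% (@π_leftD), π_leftD, reassoc_of% this, zero_comp, comp_zero]

lemma leftS_leftW (j : ℕ) (b c : ℤ × ℤ) (h : b + (1, 1) = c) :
    L.leftS j b c h ≫ L.leftW j c = 0 := by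
  have : L.leftGenS j b c h ≫ L.leftGenW j c = 0 := by
    apply biprod.hom_ext' <;> simp [leftGenS, leftGenW, reassoc_of% (L.s_w)]
  rw [← cancel_epi (cokernel.π _), reassoc_of% (@π_leftS), π_leftW, reassoc_of% this, zero_comp, comp_zero]

lemma leftW_leftS (j : ℕ) (b c : ℤ × ℤ) (h : b + (1, 1) = c) :
    L.leftW j b ≫ L.leftS j b c h = 0 := by
  have : L.leftGenW j b ≫ L.leftGenS j b c h = 0 := by
    apply biprod.hom_ext' <;> simp [leftGenS, leftGenW, reassoc_of% (L.w_s)]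
  rw [← cancel_epi (cokernel.π _), reassoc_of% (@π_leftW), π_leftS, reassoc_of% this, zero_comp, comp_zero]

lemma leftS_leftD_leftW (j : ℕ) (b c e : ℤ × ℤ) (h : b + (1, 1) = c) :
    L.leftS j b c h ≫ mkD (j + 1 + 1) (L.leftD (j + 1)) c e ≫ L.leftW j e =
      mkD (j + 1) (L.leftD j) b e := by
  by_cases h' : b + δ (j + 1) = e
  · have : L.leftGenS j b c h ≫ L.leftGenD (j + 1) c e ((δ_succ h).1 h') ≫ L.leftGenW j e =
        L.leftGenD j b e h' := by
      apply biprod.hom_ext' <;> simp [leftGenS, leftGenD, leftGenW, reassoc_of% (L.s_d_w)]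
    rw [mkD_pos _ ((δ_succ h).1 h'), mkD_pos _ h', ← cancel_epi (cokernel.π _), reassoc_of% (@π_leftS),
      reassoc_of% (@π_leftD), π_leftW, π_leftD, ← this, Category.assoc, Category.assoc]
  · rw [mkD_neg _ (fun h'' => h' ((δ_succ h).2 h'')), mkD_neg _ h', zero_comp, comp_zero]

lemma leftMap_leftD {L L' : LWB R 0} (f : L ⟶ L') (j : ℕ) (b c : ℤ × ℤ) :
    leftMap f j b ≫ mkD (j + 1) (L'.leftD j) b c =
      mkD (j + 1) (L.leftD j) b c ≫ leftMap f j c := by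
  by_cases h : b + δ (j + 1) = c
  · have : leftGenMap f j b ≫ L'.leftGenD j b c h = L.leftGenD j b c h ≫ leftGenMap f j c := by
      apply biprod.hom_ext'
      · apply biprod.hom_ext' <;> simp [leftGenD, leftGenMap, reassoc_of% (@XIsoOfEq_naturality)]
      · simp [leftGenD, leftGenMap]
    rw [mkD_pos _ h, mkD_pos _ h, ← cancel_epi (cokernel.π _), reassoc_of% (@π_leftMap), π_leftD,
      reassoc_of% (@π_leftD), π_leftMap, reassoc_of% this]
  · rw [mkD_neg _ h, mkD_neg _ h, zero_comp, comp_zero]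

lemma leftMap_leftW {L L' : LWB R 0} (f : L ⟶ L') (j : ℕ) (b : ℤ × ℤ) :
    leftMap f (j + 1) b ≫ L'.leftW j b = L.leftW j b ≫ leftMap f j b := by
  have : leftGenMap f (j + 1) b ≫ L'.leftGenW j b = L.leftGenW j b ≫ leftGenMap f j b := by
    apply biprod.hom_ext'
    · apply biprod.hom_ext' <;> simp [leftGenW, leftGenMap]
    · simp [leftGenW, leftGenMap, reassoc_of% (f.comm_w)]
  rw [← cancel_epi (cokernel.π _), reassoc_of% (@π_leftMap), π_leftW, reassoc_of% (@π_leftW), π_leftMap,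
    reassoc_of% this]

lemma leftMap_leftS {L L' : LWB R 0} (f : L ⟶ L') (j : ℕ) (b c : ℤ × ℤ) (h : b + (1, 1) = c) :
    leftMap f j b ≫ L'.leftS j b c h = L.leftS j b c h ≫ leftMap f (j + 1) c := by
  have : leftGenMap f j b ≫ L'.leftGenS j b c h = L.leftGenS j b c h ≫ leftGenMap f (j + 1) c := by
    apply biprod.hom_ext'
    · apply biprod.hom_ext' <;> simp [leftGenS, leftGenMap, reassoc_of% (@XIsoOfEq_naturality)]
    · simp [leftGenS, leftGenMap, reassoc_of% (f.comm_s)]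
  rw [← cancel_epi (cokernel.π _), reassoc_of% (@π_leftMap), π_leftS, reassoc_of% (@π_leftS), π_leftMap,
    reassoc_of% this]

end LWB

/-- The left adjoint `(𝒲_{≥ 1})_!` of the functor `ℱ_{≥ 1}`, from linear witness books to linear
witness books with pages `≥ 1`. -/
def LWB.left (R : Type u) [CommRing R] : LWB R 0 ⥤ LWB R 1 where
  obj L :=
    { page := fun j => mkRBC (j + 1) (L.leftX j) (L.leftD j) (L.leftD_leftD j)
      w := L.leftW
      s := L.leftS
      s_w := L.leftS_leftW
      w_s := L.leftW_leftS
      s_d_w := L.leftS_leftD_leftW }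
  map f :=
    { f := fun j => { f := LWB.leftMap f j, comm' := fun b c _ => LWB.leftMap_leftD f j b c }
      comm_w := LWB.leftMap_leftW f
      comm_s := LWB.leftMap_leftS f }
  map_id L := by
    apply LWB.hom_ext
    intro j
    ext b : 1
    change LWB.leftMap (𝟙 L) j b = 𝟙 (L.leftX j b)
    have : LWB.leftGenMap (𝟙 L) j b = 𝟙 (L.leftGen j b) := by
      apply biprod.hom_ext'
      · apply biprod.hom_ext' <;> simp [LWB.leftGenMap]
      · simp [LWB.leftGenMap]
    rw [← cancel_epi (cokernel.π _), LWB.π_leftMap, this, Category.id_comp, Category.comp_id]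
  map_comp {L L' L''} f g := by
    apply LWB.hom_ext
    intro j
    ext b : 1
    change LWB.leftMap (f ≫ g) j b = LWB.leftMap f j b ≫ LWB.leftMap g j b
    have : LWB.leftGenMap (f ≫ g) j b = LWB.leftGenMap f j b ≫ LWB.leftGenMap g j b := by
      apply biprod.hom_ext'
      · apply biprod.hom_ext' <;> simp [LWB.leftGenMap]
      · simp [LWB.leftGenMap]
    rw [← cancel_epi (cokernel.π _), LWB.π_leftMap, reassoc_of% (@LWB.π_leftMap), LWB.π_leftMap, this,
      Category.assoc]

/-! ### The adjunction between linear witness books and extended spectral sequences -/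

namespace LWB

variable (L : LWB R 0)

/-- The submodules `S_r = s L_{r-1} + d s L_{r-1}` of `L_r` (and `S_0 = 0`), in bidegree `b`. -/
def degen : ∀ (r : ℕ) (b : ℤ × ℤ), Submodule R ((L.page r).X b)
  | 0, _ => ⊥
  | r + 1, b =>
      (⨆ (a : ℤ × ℤ) (h : a + (1, 1) = b), LinearMap.range (L.s r a b h).hom) ⊔
      (⨆ (a : ℤ × ℤ) (c : ℤ × ℤ) (h : a + (1, 1) = c),
        LinearMap.range (L.s r a c h ≫ (L.page (r + 1)).d c b).hom)

lemma degen_le_comap_d (r : ℕ) (b c : ℤ × ℤ) :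
    L.degen r b ≤ (L.degen r c).comap ((L.page r).d b c).hom := by
  cases r with
  | zero => exact bot_le
  | succ r =>
    refine sup_le (iSup_le fun a => iSup_le fun h => ?_)
      (iSup_le fun a => iSup_le fun e => iSup_le fun h => ?_)
    · rintro _ ⟨x, rfl⟩
      refine Submodule.mem_sup_right ?_
      refine Submodule.mem_iSup_of_mem a (Submodule.mem_iSup_of_mem b
        (Submodule.mem_iSup_of_mem h ⟨x, ?_⟩))
      simp
    · rintro _ ⟨x, rfl⟩
      have : (L.s r a e h ≫ (L.page (r + 1)).d e b) ≫ (L.page (r + 1)).d b c = 0 := by simp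
      have h' := congrArg (fun φ => φ.hom x) this
      change ((L.page (r + 1)).d b c).hom ((L.s r a e h ≫ (L.page (r + 1)).d e b).hom x) = 0 at h'
      rw [Submodule.mem_comap, h']
      exact zero_mem _

/-- The page `Q(L)_r = L_r / S_r`, with the induced differential. -/
@[simps]
def quotPage (r : ℕ) : RBC R r where
  X b := ModuleCat.of R ((L.page r).X b ⧸ L.degen r b)
  d b c := ModuleCat.ofHom ((L.degen r b).mapQ (L.degen r c) ((L.page r).d b c).hom
    (L.degen_le_comap_d r b c))
  shape b c h := by
    ext x
    simp [(L.page r).shape b c h]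
  d_comp_d' a b c _ _ := by
    ext x
    have h' := congrArg (fun φ => φ.hom x) ((L.page r).d_comp_d a b c)
    change ((L.page r).d b c).hom (((L.page r).d a b).hom x) = 0 at h'
    simp [h']

/-- The projection from `L_r` to `Q(L)_r`. -/
@[simps]
def quotπ (r : ℕ) : L.page r ⟶ L.quotPage r where
  f b := ModuleCat.ofHom (L.degen r b).mkQ
  comm' b c _ := by
    ext x
    rfl

lemma w_quotπ_d (r : ℕ) (b c : ℤ × ℤ) :
    (L.w r b ≫ (L.quotπ r).f b) ≫ (L.quotPage r).d b c = 0 := by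
  rw [Category.assoc, (L.quotπ r).comm, reassoc_of% (L.w_d), zero_comp]

/-- The map from `L_{r+1}` to `H(Q(L)_r)` sending `a` to the homology class of the class of
`w a`. -/
def preChar (r : ℕ) (b : ℤ × ℤ) : (L.page (r + 1)).X b ⟶ (L.quotPage r).homology b :=
  (L.quotPage r).liftCycles (L.w r b ≫ (L.quotπ r).f b) _ rfl (L.w_quotπ_d r b _) ≫
    (L.quotPage r).homologyπ b

lemma degen_le_ker_preChar (r : ℕ) (b : ℤ × ℤ) :
    L.degen (r + 1) b ≤ LinearMap.ker (L.preChar r b).hom := by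
  refine sup_le (iSup_le fun a => iSup_le fun h => ?_)
    (iSup_le fun a => iSup_le fun e => iSup_le fun h => ?_)
  · rintro _ ⟨x, rfl⟩
    have : L.s r a b h ≫ L.preChar r b = 0 := by
      rw [preChar, HomologicalComplex.comp_liftCycles_assoc]
      rw [HomologicalComplex.liftCycles_homologyπ_eq_zero_of_boundary _ _ _ _
        (0 : (L.page r).X a ⟶ (L.quotPage r).X b) (by rw [reassoc_of% (L.s_w), zero_comp, zero_comp])]
    exact congrArg (fun φ => φ.hom x) this
  · rintro _ ⟨x, rfl⟩
    have : (L.s r a e h ≫ (L.page (r + 1)).d e b) ≫ L.preChar r b = 0 := by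
      rw [preChar, HomologicalComplex.comp_liftCycles_assoc]
      rw [HomologicalComplex.liftCycles_homologyπ_eq_zero_of_boundary _ _ _ _
        ((L.quotπ r).f a) (by
          rw [(L.quotπ r).comm, Category.assoc, reassoc_of% (L.s_d_w)])]
    exact congrArg (fun φ => φ.hom x) this

/-- The characteristic map of `Q(L)`, sending the class of `a` in `Q(L)_{r+1}` to the homology class
of the class of `w a` in `Q(L)_r`. -/
def quotChar (r : ℕ) (b : ℤ × ℤ) : (L.quotPage (r + 1)).X b ⟶ (L.quotPage r).homology b :=
  ModuleCat.ofHom ((L.degen (r + 1) b).liftQ (L.preChar r b).hom (L.degen_le_ker_preChar r b))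

lemma quotπ_quotChar (r : ℕ) (b : ℤ × ℤ) :
    (L.quotπ (r + 1)).f b ≫ L.quotChar r b = L.preChar r b := by
  ext x
  rfl

instance epi_quotπ (r : ℕ) (b : ℤ × ℤ) : Epi ((L.quotπ r).f b) :=
  (ModuleCat.epi_iff_surjective _).2 (Submodule.mkQ_surjective _)

variable {L}

lemma degen_le_comap {L' : LWB R 0} (f : L ⟶ L') (r : ℕ) (b : ℤ × ℤ) :
    L.degen r b ≤ (L'.degen r b).comap ((f.f r).f b).hom := by
  cases r with
  | zero =>
    intro x hx
    have hx' : x = 0 := hx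
    rw [hx', Submodule.mem_comap, map_zero]
    exact zero_mem _
  | succ r =>
    refine sup_le (iSup_le fun a => iSup_le fun h => ?_)
      (iSup_le fun a => iSup_le fun e => iSup_le fun h => ?_)
    · rintro _ ⟨x, rfl⟩
      refine Submodule.mem_sup_left ?_
      refine Submodule.mem_iSup_of_mem a (Submodule.mem_iSup_of_mem h ⟨((f.f r).f a).hom x, ?_⟩)
      exact congrArg (fun φ => φ.hom x) (f.comm_s r a b h)
    · rintro _ ⟨x, rfl⟩
      refine Submodule.mem_sup_right ?_
      refine Submodule.mem_iSup_of_mem a (Submodule.mem_iSup_of_mem e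
        (Submodule.mem_iSup_of_mem h ⟨((f.f r).f a).hom x, ?_⟩))
      have : (f.f r).f a ≫ (L'.s r a e h ≫ (L'.page (r + 1)).d e b) =
          (L.s r a e h ≫ (L.page (r + 1)).d e b) ≫ (f.f (r + 1)).f b := by
        rw [reassoc_of% (f.comm_s), (f.f (r + 1)).comm, Category.assoc]
      exact congrArg (fun φ => φ.hom x) this

/-- The morphism of pages `Q(L)_r ⟶ Q(L')_r` induced by a morphism. -/
@[simps]
def quotMap {L' : LWB R 0} (f : L ⟶ L') (r : ℕ) : L.quotPage r ⟶ L'.quotPage r where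
  f b := ModuleCat.ofHom ((L.degen r b).mapQ (L'.degen r b) ((f.f r).f b).hom
    (degen_le_comap f r b))
  comm' b c _ := by
    rw [← cancel_epi ((L.quotπ r).f b)]
    ext x
    have h := congrArg (fun φ => φ.hom x) ((f.f r).comm b c)
    exact congrArg (L'.degen r c).mkQ h

lemma quotπ_quotMap {L' : LWB R 0} (f : L ⟶ L') (r : ℕ) :
    L.quotπ r ≫ quotMap f r = f.f r ≫ L'.quotπ r := by
  ext b x
  rfl

lemma preChar_naturality {L' : LWB R 0} (f : L ⟶ L') (r : ℕ) (b : ℤ × ℤ) :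
    (f.f (r + 1)).f b ≫ L'.preChar r b =
      L.preChar r b ≫ HomologicalComplex.homologyMap (quotMap f r) b := by
  rw [preChar, preChar, Category.assoc, HomologicalComplex.homologyπ_naturality,
    ← Category.assoc, ← Category.assoc, HomologicalComplex.comp_liftCycles,
    HomologicalComplex.liftCycles_comp_cyclesMap]
  congr 2
  rw [reassoc_of% (f.comm_w), Category.assoc]
  rfl

end LWB

/-- The functor `Q`, with `Q(L)_r = L_r / S_r` and the characteristic map sending the class of `a`
to the homology class of the class of `w a`. -/
def Q (R : Type u) [CommRing R] : LWB R 0 ⥤ ESpSe R where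
  obj L := { page := L.quotPage, char := L.quotChar }
  map {L L'} f :=
    { f := LWB.quotMap f
      comm := fun r b => by
        have h := congrArg (fun φ => φ.f b) (LWB.quotπ_quotMap f (r + 1))
        dsimp only [HomologicalComplex.comp_f] at h
        rw [← cancel_epi ((L.quotπ (r + 1)).f b), reassoc_of% (@LWB.quotπ_quotChar), reassoc_of% h,
          LWB.quotπ_quotChar, LWB.preChar_naturality] }
  map_id L := by
    apply ESpSe.hom_ext
    intro r
    ext b : 1
    change (LWB.quotMap (𝟙 L) r).f b = 𝟙 ((L.quotPage r).X b)
    rw [← cancel_epi ((L.quotπ r).f b)]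
    ext x
    rfl
  map_comp {L L' L''} f g := by
    apply ESpSe.hom_ext
    intro r
    ext b : 1
    change (LWB.quotMap (f ≫ g) r).f b = (LWB.quotMap f r).f b ≫ (LWB.quotMap g r).f b
    rw [← cancel_epi ((L.quotπ r).f b)]
    ext x
    rfl

namespace ESpSe

variable (X : ESpSe R)

/-- The compatible sequences `(x_0, …, x_r)` in bidegree `b`: each `x_i` with `i < r` is a cycle, and
the characteristic map sends `x_{i+1}` to the homology class of `x_i`. The sequence is extended by
`x_i = 0` for `i > r`. -/
def compatible (r : ℕ) (b : ℤ × ℤ) : Submodule R (∀ i : ℕ, (X.page i).X b) where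
  carrier := {x | (∀ i < r, ∃ z : (X.page i).cycles b, (X.page i).iCycles b z = x i ∧
    (X.page i).homologyπ b z = X.char i b (x (i + 1))) ∧ ∀ i, r < i → x i = 0}
  add_mem' := by
    rintro x y ⟨hx, hx'⟩ ⟨hy, hy'⟩
    refine ⟨fun i hi => ?_, fun i hi => by simp [hx' i hi, hy' i hi]⟩
    obtain ⟨z, hz, hz'⟩ := hx i hi
    obtain ⟨t, ht, ht'⟩ := hy i hi
    exact ⟨z + t, by simp [hz, ht], by simp [hz', ht']⟩
  zero_mem' := ⟨fun i _ => ⟨0, by simp, by simp⟩, fun i _ => rfl⟩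
  smul_mem' := by
    rintro a x ⟨hx, hx'⟩
    refine ⟨fun i hi => ?_, fun i hi => by simp [hx' i hi]⟩
    obtain ⟨z, hz, hz'⟩ := hx i hi
    exact ⟨a • z, by simp [hz], by simp [hz']⟩

/-- The module `N(X)_r` in bidegree `b`: the pairs of compatible sequences
`((x_0, …, x_r); (y_0, …, y_r))` in bidegrees `b` and `b + (-r, 1-r)` with `d x_r = y_r`. -/
def nerveX (r : ℕ) (b : ℤ × ℤ) :
    Submodule R ((∀ i : ℕ, (X.page i).X b) × (∀ i : ℕ, (X.page i).X (b + δ r))) where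
  carrier := {x | x.1 ∈ X.compatible r b ∧ x.2 ∈ X.compatible r (b + δ r) ∧
    (X.page r).d b (b + δ r) (x.1 r) = x.2 r}
  add_mem' := by
    rintro x y ⟨hx, hx', hx''⟩ ⟨hy, hy', hy''⟩
    exact ⟨add_mem hx hy, add_mem hx' hy', by simp [hx'', hy'']⟩
  zero_mem' := ⟨zero_mem _, zero_mem _, by simp⟩
  smul_mem' := by
    rintro a x ⟨hx, hx', hx''⟩
    exact ⟨Submodule.smul_mem _ a hx, Submodule.smul_mem _ a hx', by simp [hx'']⟩

/-- Transport of sequences along an equality of bidegrees. -/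
def castSeq {b c : ℤ × ℤ} (h : b = c) :
    (∀ i : ℕ, (X.page i).X b) →ₗ[R] (∀ i : ℕ, (X.page i).X c) :=
  LinearMap.pi fun i => ((X.page i).XIsoOfEq h).hom.hom ∘ₗ LinearMap.proj i

lemma castSeq_rfl (b : ℤ × ℤ) : X.castSeq (rfl : b = b) = LinearMap.id := by
  ext x i
  simp [castSeq]

lemma castSeq_castSeq {b c : ℤ × ℤ} (h : b = c) (h' : c = b) (x : ∀ i : ℕ, (X.page i).X b) :
    X.castSeq h' (X.castSeq h x) = x := by
  subst h
  rw [castSeq_rfl, LinearMap.id_apply, LinearMap.id_apply]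

/-- Truncation `(x_0, x_1, …) ↦ (x_0, …, x_r)` of sequences. -/
def truncSeq (r : ℕ) (b : ℤ × ℤ) :
    (∀ i : ℕ, (X.page i).X b) →ₗ[R] (∀ i : ℕ, (X.page i).X b) :=
  LinearMap.pi fun i => if i ≤ r then LinearMap.proj i else 0

variable {X} in
lemma castSeq_mem {r : ℕ} {b c : ℤ × ℤ} (h : b = c) {x : ∀ i : ℕ, (X.page i).X b}
    (hx : x ∈ X.compatible r b) : X.castSeq h x ∈ X.compatible r c := by
  subst h
  rwa [castSeq_rfl]

variable {X} in
lemma compatible_succ {r : ℕ} {b c : ℤ × ℤ} {y : ∀ i : ℕ, (X.page i).X c}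
    (hy : y ∈ X.compatible r c) (x : (X.page r).X b) (hx : (X.page r).d b c x = y r) :
    y ∈ X.compatible (r + 1) c := by
  refine ⟨fun i hi => ?_, fun i hi => hy.2 i (by omega)⟩
  rcases Nat.lt_succ_iff_lt_or_eq.1 hi with hi | rfl
  · exact hy.1 i hi
  · refine ⟨(X.page i).toCycles b c x, ?_, ?_⟩
    · rw [← hx, ← (X.page i).toCycles_i b c]
      rfl
    · rw [hy.2 (i + 1) (by omega), map_zero]
      exact congrArg (fun φ => φ.hom x) ((X.page i).toCycles_comp_homologyπ b c)

variable {X} in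
lemma d_eq_zero {r : ℕ} {b : ℤ × ℤ} {x : ∀ i : ℕ, (X.page i).X b}
    (hx : x ∈ X.compatible (r + 1) b) (c : ℤ × ℤ) : (X.page r).d b c (x r) = 0 := by
  obtain ⟨z, hz, -⟩ := hx.1 r (by omega)
  rw [← hz]
  exact congrArg (fun φ => φ.hom z) ((X.page r).iCycles_d b c)

variable {X} in
lemma truncSeq_mem {r : ℕ} {b : ℤ × ℤ} {x : ∀ i : ℕ, (X.page i).X b}
    (hx : x ∈ X.compatible (r + 1) b) : X.truncSeq r b x ∈ X.compatible r b := by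
  refine ⟨fun i hi => ?_, fun i hi => by simp [truncSeq, not_le.2 hi]⟩
  obtain ⟨z, hz, hz'⟩ := hx.1 i (by omega)
  have h₁ : i ≤ r := hi.le
  have h₂ : i + 1 ≤ r := hi
  exact ⟨z, by simp [truncSeq, h₁, hz], by simp [truncSeq, h₂, hz']⟩

/-- The differential `(x; y) ↦ (y; 0)`. -/
def nerveD (r : ℕ) (b c : ℤ × ℤ) (h : b + δ r = c) : X.nerveX r b →ₗ[R] X.nerveX r c :=
  LinearMap.restrict (LinearMap.prod (X.castSeq h ∘ₗ LinearMap.snd R _ _) 0) (by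
    rintro x ⟨hx, hx', hx''⟩
    refine ⟨castSeq_mem h hx', zero_mem _, ?_⟩
    subst h
    change (X.page r).d _ _ (X.castSeq rfl x.2 r) = 0
    rw [castSeq_rfl, LinearMap.id_apply, ← hx'']
    exact congrArg (fun φ => φ.hom (x.1 r)) ((X.page r).d_comp_d b (b + δ r) (b + δ r + δ r)))

/-- The witness map `((x_0, …, x_{r+1}); y) ↦ ((x_0, …, x_r); 0)`. -/
def nerveW (r : ℕ) (b : ℤ × ℤ) : X.nerveX (r + 1) b →ₗ[R] X.nerveX r b :=
  LinearMap.restrict (LinearMap.prod (X.truncSeq r b ∘ₗ LinearMap.fst R _ _) 0) (by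
    rintro x ⟨hx, -, -⟩
    refine ⟨truncSeq_mem hx, zero_mem _, ?_⟩
    change (X.page r).d _ _ (X.truncSeq r b x.1 r) = 0
    have : X.truncSeq r b x.1 r = x.1 r := by simp [truncSeq]
    rw [this]
    exact d_eq_zero hx _)

/-- The degeneracy map `(x; (y_0, …, y_r)) ↦ (0; (y_0, …, y_r, 0))`. -/
def nerveS (r : ℕ) (b c : ℤ × ℤ) (h : b + (1, 1) = c) : X.nerveX r b →ₗ[R] X.nerveX (r + 1) c :=
  LinearMap.restrict (LinearMap.prod 0
      (X.castSeq ((δ_succ h).1 rfl).symm ∘ₗ LinearMap.snd R _ _)) (by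
    rintro x ⟨-, hx', hx''⟩
    refine ⟨zero_mem _, castSeq_mem _ (compatible_succ hx' _ hx''), ?_⟩
    change (X.page (r + 1)).d _ _ 0 = ((X.page (r + 1)).XIsoOfEq _).hom.hom (x.2 (r + 1))
    rw [hx'.2 (r + 1) (by omega), map_zero]
    simp)

lemma nerve_ext {r : ℕ} {b : ℤ × ℤ} {x y : X.nerveX r b} (h₁ : ∀ i, x.1.1 i = y.1.1 i)
    (h₂ : ∀ i, x.1.2 i = y.1.2 i) : x = y :=
  Subtype.ext (Prod.ext (funext h₁) (funext h₂))

lemma nerveD_nerveD (r : ℕ) (a b c : ℤ × ℤ) (h : a + δ r = b) (h' : b + δ r = c) :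
    ModuleCat.ofHom (X.nerveD r a b h) ≫ ModuleCat.ofHom (X.nerveD r b c h') = 0 := by
  refine ModuleCat.hom_ext (LinearMap.ext fun x => Subtype.ext ?_)
  change (X.castSeq h' 0, (0 : ∀ i : ℕ, (X.page i).X (c + δ r))) = 0
  rw [map_zero]
  rfl

lemma nerveS_nerveW (r : ℕ) (b c : ℤ × ℤ) (h : b + (1, 1) = c) :
    ModuleCat.ofHom (X.nerveS r b c h) ≫ ModuleCat.ofHom (X.nerveW r c) = 0 := by
  refine ModuleCat.hom_ext (LinearMap.ext fun x => Subtype.ext ?_)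
  change (X.truncSeq r c 0, (0 : ∀ i : ℕ, (X.page i).X (c + δ r))) = 0
  rw [map_zero]
  rfl

lemma nerveW_nerveS (r : ℕ) (b c : ℤ × ℤ) (h : b + (1, 1) = c) :
    ModuleCat.ofHom (X.nerveW r b) ≫ ModuleCat.ofHom (X.nerveS r b c h) = 0 := by
  refine ModuleCat.hom_ext (LinearMap.ext fun x => Subtype.ext ?_)
  change ((0 : ∀ i : ℕ, (X.page i).X c), X.castSeq _ 0) = 0
  rw [map_zero]
  rfl

lemma nerveS_nerveD_nerveW (r : ℕ) (b c e : ℤ × ℤ) (h : b + (1, 1) = c) :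
    ModuleCat.ofHom (X.nerveS r b c h) ≫
      mkD (X := fun b => ModuleCat.of R (X.nerveX (r + 1) b)) (r + 1)
        (fun b c h => ModuleCat.ofHom (X.nerveD (r + 1) b c h)) c e ≫
      ModuleCat.ofHom (X.nerveW r e) =
    mkD (X := fun b => ModuleCat.of R (X.nerveX r b)) r
      (fun b c h => ModuleCat.ofHom (X.nerveD r b c h)) b e := by
  by_cases h' : b + δ r = e
  · rw [mkD_pos _ ((δ_succ h).1 h'), mkD_pos _ h']
    refine ModuleCat.hom_ext (LinearMap.ext fun x => Subtype.ext ?_)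
    change (X.truncSeq r e (X.castSeq _ (X.castSeq _ x.1.2)), _) = (X.castSeq _ x.1.2, _)
    subst h'
    refine Prod.ext (funext fun i => ?_) rfl
    obtain ⟨x, -, hx, -⟩ := x
    rw [castSeq_castSeq, castSeq_rfl, LinearMap.id_apply]
    by_cases hi : i ≤ r
    · simp [truncSeq, hi]
    · simp [truncSeq, hi, hx.2 i (by omega)]
  · rw [mkD_neg _ (fun h'' => h' ((δ_succ h).2 h'')), mkD_neg _ h', zero_comp, comp_zero]

variable {X}

/-- The map of sequences induced by a morphism. -/
def mapSeq {Y : ESpSe R} (f : X ⟶ Y) (b : ℤ × ℤ) :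
    (∀ i : ℕ, (X.page i).X b) →ₗ[R] (∀ i : ℕ, (Y.page i).X b) :=
  LinearMap.pi fun i => ((f.f i).f b).hom ∘ₗ LinearMap.proj i

lemma mapSeq_mem {Y : ESpSe R} (f : X ⟶ Y) {r : ℕ} {b : ℤ × ℤ} {x : ∀ i : ℕ, (X.page i).X b}
    (hx : x ∈ X.compatible r b) : mapSeq f b x ∈ Y.compatible r b := by
  refine ⟨fun i hi => ?_, fun i hi => by simp [mapSeq, hx.2 i hi]⟩
  obtain ⟨z, hz, hz'⟩ := hx.1 i hi
  refine ⟨HomologicalComplex.cyclesMap (f.f i) b z, ?_, ?_⟩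
  · have h := congrArg (fun φ => φ.hom z) (HomologicalComplex.cyclesMap_i (f.f i) b)
    exact h.trans (congrArg ((f.f i).f b).hom hz)
  · have h := congrArg (fun φ => φ.hom z) (HomologicalComplex.homologyπ_naturality (f.f i) b)
    have h' := congrArg (fun φ => φ.hom (x (i + 1))) (f.comm i b)
    exact h.symm.trans ((congrArg (HomologicalComplex.homologyMap (f.f i) b).hom hz').trans h'.symm)

/-- The map `N(X)_r ⟶ N(Y)_r` induced by a morphism. -/
def nerveMap {Y : ESpSe R} (f : X ⟶ Y) (r : ℕ) (b : ℤ × ℤ) : X.nerveX r b →ₗ[R] Y.nerveX r b :=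
  LinearMap.restrict (LinearMap.prodMap (mapSeq f b) (mapSeq f (b + δ r))) (by
    rintro x ⟨hx, hx', hx''⟩
    refine ⟨mapSeq_mem f hx, mapSeq_mem f hx', ?_⟩
    have h := congrArg (fun φ => φ.hom (x.1 r)) ((f.f r).comm b (b + δ r))
    exact h.trans (congrArg ((f.f r).f (b + δ r)).hom hx''))

lemma mapSeq_castSeq {Y : ESpSe R} (f : X ⟶ Y) {b c : ℤ × ℤ} (h : b = c)
    (x : ∀ i : ℕ, (X.page i).X b) :
    Y.castSeq h (mapSeq f b x) = mapSeq f c (X.castSeq h x) := by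
  subst h
  simp [castSeq_rfl]

lemma mapSeq_truncSeq {Y : ESpSe R} (f : X ⟶ Y) (r : ℕ) {b : ℤ × ℤ}
    (x : ∀ i : ℕ, (X.page i).X b) :
    Y.truncSeq r b (mapSeq f b x) = mapSeq f b (X.truncSeq r b x) := by
  funext i
  by_cases hi : i ≤ r <;> simp [truncSeq, mapSeq, hi]

lemma nerveMap_nerveD {Y : ESpSe R} (f : X ⟶ Y) (r : ℕ) (b c : ℤ × ℤ) :
    ModuleCat.ofHom (nerveMap f r b) ≫
      mkD (X := fun b => ModuleCat.of R (Y.nerveX r b)) r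
        (fun b c h => ModuleCat.ofHom (Y.nerveD r b c h)) b c =
    mkD (X := fun b => ModuleCat.of R (X.nerveX r b)) r
      (fun b c h => ModuleCat.ofHom (X.nerveD r b c h)) b c ≫ ModuleCat.ofHom (nerveMap f r c) := by
  by_cases h : b + δ r = c
  · rw [mkD_pos _ h, mkD_pos _ h]
    refine ModuleCat.hom_ext (LinearMap.ext fun x => Subtype.ext ?_)
    exact Prod.ext (mapSeq_castSeq f h x.1.2) (map_zero (mapSeq f (c + δ r))).symm
  · rw [mkD_neg _ h, mkD_neg _ h, zero_comp, comp_zero]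

end ESpSe

/-- The functor `N` (the nerve), right adjoint to `Q`, with
`d (x; y) = (y; 0)`, `w (x; y) = ((x_0, …, x_{r-1}); 0)` and `s (x; y) = (0; (y_0, …, y_r, 0))`. -/
def N (R : Type u) [CommRing R] : ESpSe R ⥤ LWB R 0 where
  obj X :=
    { page := fun r => mkRBC r (fun b => ModuleCat.of R (X.nerveX r b))
        (fun b c h => ModuleCat.ofHom (X.nerveD r b c h)) (X.nerveD_nerveD r)
      w := fun r b => ModuleCat.ofHom (X.nerveW r b)
      s := fun r b c h => ModuleCat.ofHom (X.nerveS r b c h)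
      s_w := X.nerveS_nerveW
      w_s := X.nerveW_nerveS
      s_d_w := X.nerveS_nerveD_nerveW }
  map {X Y} f :=
    { f := fun r =>
        { f := fun b => ModuleCat.ofHom (ESpSe.nerveMap f r b)
          comm' := fun b c _ => ESpSe.nerveMap_nerveD f r b c }
      comm_w := fun r b => by
        refine ModuleCat.hom_ext (LinearMap.ext fun x => Subtype.ext ?_)
        exact Prod.ext (ESpSe.mapSeq_truncSeq f r x.1.1) (map_zero (ESpSe.mapSeq f (b + δ r))).symm
      comm_s := fun r b c h => by
        refine ModuleCat.hom_ext (LinearMap.ext fun x => Subtype.ext ?_)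
        exact Prod.ext (map_zero (ESpSe.mapSeq f c)).symm (ESpSe.mapSeq_castSeq f _ x.1.2) }
  map_id X := by
    apply LWB.hom_ext
    intro r
    ext b x
    rfl
  map_comp f g := by
    apply LWB.hom_ext
    intro r
    ext b x
    rfl

/-! ### Shift and décalage -/

/-- The functor `Shift = Q ∘ ℱ_{≥ 1} ∘ N_{≥ 1} ∘ 𝒯`. Here and below, `N_{≥ 1}` and `Q_{≥ 1}` are the
conjugates of `N` and `Q` by the translation, so that `N_{≥ 1} ∘ 𝒯 = 𝒯 ∘ N` and
`𝒯⁻¹ ∘ Q_{≥ 1} = Q ∘ 𝒯⁻¹`. -/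
def Shift (R : Type u) [CommRing R] : ESpSe R ⥤ ESpSe R :=
  N R ⋙ LWB.extendTrans R ⋙ Q R

/-- The functor `Dec = 𝒯⁻¹ ∘ Q_{≥ 1} ∘ 𝒰_{≥ 1} ∘ N`. -/
def Dec (R : Type u) [CommRing R] : ESpSe R ⥤ ESpSe R :=
  N R ⋙ LWB.transTrunc R ⋙ Q R

/-- The functor `LDec = 𝒯⁻¹ ∘ Q_{≥ 1} ∘ (𝒲_{≥ 1})_! ∘ N`. -/
def LDec (R : Type u) [CommRing R] : ESpSe R ⥤ ESpSe R :=
  N R ⋙ LWB.left R ⋙ LWB.transInv R 0 ⋙ Q R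

end SpecSeq

end

noncomputable section

universe v₃ u₃

namespace SpecSeq

/-! ### Quillen adjunctions and criteria for Quillen equivalences. -/

section

variable {C : Type u₁} [Category.{v₁} C] {D : Type u₂} [Category.{v₂} D]
  {B : Type u₃} [Category.{v₃} B]

section

variable [ModelCategory C]

/-! Everything is reduced to `r`-bigraded complexes by means of the page functors and the nerve `N`.

Model structures. `exists_isModelStructure_of_adjunctions` handles the three kinds of categories at
once. There are right adjoints `V i` with values in complexes; fibrations are detected by all of
them and weak equivalences by a single one, `V i₀`. By adjunction, generating sets are the images
under the left adjoints `Φ i` of `0 ⟶ disk` for all `i`, and of `sphere ⟶ disk` for `i₀`. The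
delicate axiom is that a map `j : X ⟶ Y` lifting against all fibrations is a weak equivalence. No
cell complexes are needed: in `quasiIsos_of_llp`, let `K` be the sum of the objects `Φ i (cover (V i
Y))`. Since `K ⟶ Y` is a fibration, so is `X ⊞ K ⟶ Y`, and lifting against it makes `j` a retract of
`X ⟶ X ⊞ K`; the latter is a weak equivalence as soon as `V i₀ K` is acyclic. This comes down to the
pages `r ≥ i` of `ℱ_[i] A` (page `i` is `A`, the later ones are contractible cones) and of `Q (ℱ_[i]
A)` (page `i` is `A`, the later ones are zero).

The nerve. The projection `ESpSe.top` from `N(X)_r` to `X_r` is a surjective quasi-isomorphism with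
kernel exactly `S_r`. Hence `N` creates weak equivalences and `Q N X ≅ X`, so that extended spectral
sequences form a reflective subcategory of linear witness books. Its image consists of the books
whose degeneracy maps vanish on cycles (`LWB.IsNerve`). This condition passes to filtered colimits,
which makes `N` accessible, and it is preserved by `ℱ_{≥ 1} 𝒯` and `𝒯⁻¹ 𝒰_{≥ 1}`, so that the
adjunctions `Shift ⊣ Dec` and `LDec ⊣ Shift` are restrictions of adjunctions for linear witness
books.

Quillen equivalences. All the right adjoints preserve fibrations and create weak equivalences, so it
suffices that the unit is a weak equivalence on cofibrant objects. It is invertible when the left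
adjoint is fully faithful, which covers `ℱ_[r]`, `ℱ_{≥ 1} 𝒯`, `𝒯` and `Shift`. For `LDec ⊣ Shift`
and `Q ⊣ N` the unit is a weak equivalence on the image of `Shift`, respectively on the free books;
every object receives a weak equivalence from one of these, and `IsQuillenAdjunction.weq_unit`
carries the property over to cofibrant objects. -/

lemma weq_of_isIso {X Y : C} (f : X ⟶ Y) [IsIso f] : weakEquivalences C f :=
  MorphismProperty.of_isIso _ f

lemma weq_comp_left_iff {X Y Z : C} (f : X ⟶ Y) (g : Y ⟶ Z) (hf : weakEquivalences C f) :
    weakEquivalences C (f ≫ g) ↔ weakEquivalences C g :=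
  ⟨fun h => (weakEquivalences C).of_precomp f g hf h, fun h => (weakEquivalences C).comp_mem f g hf h⟩

lemma weq_comp_right_iff {X Y Z : C} (f : X ⟶ Y) (g : Y ⟶ Z) (hg : weakEquivalences C g) :
    weakEquivalences C (f ≫ g) ↔ weakEquivalences C f :=
  ⟨fun h => (weakEquivalences C).of_postcomp f g hg h,
    fun h => (weakEquivalences C).comp_mem f g h hg⟩

/-- A trivial fibration onto a cofibrant object has a section. -/
lemma exists_section {X Y : C} (p : X ⟶ Y) (hp : trivialFibrations C p) (hY : IsCofibrant Y) :
    ∃ s : Y ⟶ X, s ≫ p = 𝟙 Y := by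
  have := MorphismProperty.hasLiftingProperty_of_wfs (W₁ := cofibrations C) (initial.to Y) p
    ((cofibration_iff _).1 hY) hp
  have sq : CommSq (initial.to X) (initial.to Y) p (𝟙 Y) := ⟨by simp⟩
  exact ⟨sq.lift, sq.fac_right⟩

end

section

variable [ModelCategory C] [ModelCategory D]

/-- A right adjoint preserving fibrations and trivial fibrations is right Quillen. -/
lemma IsQuillenAdjunction.of_right {L : C ⥤ D} {G : D ⥤ C} (adj : L ⊣ G)
    (hfib : fibrations D ≤ (fibrations C).inverseImage G)
    (hweq : trivialFibrations D ≤ (trivialFibrations C).inverseImage G) :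
    IsQuillenAdjunction adj where
  map_cofibration X Y f hf := by
    rw [← MorphismProperty.llp_eq_of_wfs (cofibrations D) (trivialFibrations D)]
    intro A B p hp
    rw [adj.hasLiftingProperty_iff]
    exact MorphismProperty.hasLiftingProperty_of_wfs _ _ hf (hweq _ hp)
  map_trivialCofibration X Y f hf := by
    rw [← MorphismProperty.llp_eq_of_wfs (trivialCofibrations D) (fibrations D)]
    intro A B p hp
    rw [adj.hasLiftingProperty_iff]
    exact MorphismProperty.hasLiftingProperty_of_wfs _ _ hf (hfib _ hp)

lemma IsQuillenAdjunction.right_fibrations {L : C ⥤ D} {G : D ⥤ C} {adj : L ⊣ G}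
    (h : IsQuillenAdjunction adj) : fibrations D ≤ (fibrations C).inverseImage G := by
  intro X Y p hp
  rw [MorphismProperty.inverseImage_iff,
    ← MorphismProperty.rlp_eq_of_wfs (trivialCofibrations C) (fibrations C)]
  intro A B i hi
  rw [← adj.hasLiftingProperty_iff]
  exact MorphismProperty.hasLiftingProperty_of_wfs _ _ (h.map_trivialCofibration _ hi) hp

lemma IsQuillenAdjunction.map_isCofibrant {L : C ⥤ D} {G : D ⥤ C} {adj : L ⊣ G}
    (h : IsQuillenAdjunction adj) {X : C} (hX : IsCofibrant X) : IsCofibrant (L.obj X) := by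
  have := adj.leftAdjoint_preservesColimits
  rw [isCofibrant_iff_of_isInitial (L.map (initial.to X))
    (IsInitial.isInitialObj L _ initialIsInitial), cofibration_iff]
  exact h.map_cofibration _ ((cofibration_iff _).1 hX)

lemma IsQuillenAdjunction.map_isFibrant {L : C ⥤ D} {G : D ⥤ C} {adj : L ⊣ G}
    (h : IsQuillenAdjunction adj) {X : D} (hX : IsFibrant X) : IsFibrant (G.obj X) := by
  have := adj.rightAdjoint_preservesLimits
  rw [isFibrant_iff_of_isTerminal (G.map (terminal.from X))
    (IsTerminal.isTerminalObj G _ terminalIsTerminal), fibration_iff]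
  exact h.right_fibrations _ ((fibration_iff _).1 hX)

/-- Two adjunctions between the same functors differ by an automorphism of `G`, so the two adjuncts
of `f` differ by an isomorphism. Checking one adjunction is therefore enough for
`QuillenEquivalencePair`. -/
lemma IsQuillenEquivalence.of_adj {L : C ⥤ D} {G : D ⥤ C} {adj : L ⊣ G}
    (h : IsQuillenEquivalence adj) (adj' : L ⊣ G) : IsQuillenEquivalence adj' where
  map_cofibration := h.map_cofibration
  map_trivialCofibration := h.map_trivialCofibration
  weakEquivalence_iff X Y hX hY f := by
    have e : adj'.homEquiv X Y f =
        adj.homEquiv X Y f ≫ (adj.rightAdjointUniq adj').hom.app Y := by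
      rw [adj.homEquiv_unit, adj'.homEquiv_unit, Category.assoc,
        (adj.rightAdjointUniq adj').hom.naturality f,
        ← adj.unit_rightAdjointUniq_hom_app adj' X, Category.assoc]
    rw [e, weq_comp_right_iff _ _ (weq_of_isIso _)]
    exact h.weakEquivalence_iff X Y hX hY f

/-- If the right adjoint of a Quillen adjunction preserves and reflects weak equivalences, it is
enough to check that the unit is a weak equivalence on cofibrant objects. -/
lemma IsQuillenEquivalence.of_unit {L : C ⥤ D} {G : D ⥤ C} {adj : L ⊣ G}
    (h : IsQuillenAdjunction adj)
    (hweq : (weakEquivalences C).inverseImage G = weakEquivalences D)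
    (hunit : ∀ X, IsCofibrant X → weakEquivalences C (adj.unit.app X)) :
    IsQuillenEquivalence adj where
  toIsQuillenAdjunction := h
  weakEquivalence_iff X Y hX _ f := by
    rw [adj.homEquiv_unit, weq_comp_left_iff _ _ (hunit X hX), ← hweq]
    rfl

end

/-- A functor `G` creating the weak equivalences and preserving the fibrations of a model
structure. -/
structure IsCreating [ModelCategory C] [ModelCategory D] (G : D ⥤ C) : Prop where
  fibrations_le : fibrations D ≤ (fibrations C).inverseImage G
  weakEquivalences_eq : (weakEquivalences C).inverseImage G = weakEquivalences D

lemma IsCreating.isQuillenAdjunction [ModelCategory C] [ModelCategory D] {L : C ⥤ D} {G : D ⥤ C}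
    (hG : IsCreating G) (adj : L ⊣ G) : IsQuillenAdjunction adj :=
  .of_right adj hG.fibrations_le fun _ _ f hf =>
    ⟨hG.fibrations_le _ hf.1, by
      have := hf.2; rw [← hG.weakEquivalences_eq] at this; exact this⟩

variable (MC : ModelCategory C) (MD : ModelCategory D) (MB : ModelCategory B)

variable {MC MD} in
lemma QuillenEquivalencePair.of_adj {L : C ⥤ D} {G : D ⥤ C} (adj : L ⊣ G)
    (h : IsQuillenEquivalence adj) : QuillenEquivalencePair MC MD L G :=
  ⟨⟨adj⟩, fun adj' => h.of_adj adj'⟩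

variable {MC MD MB} in
-- The adjunct for the composite adjunction is an adjunct taken twice; the two equivalences can be
-- chained because left Quillen functors keep objects cofibrant and right Quillen functors keep them
-- fibrant.
lemma QuillenEquivalencePair.comp {L : C ⥤ D} {G : D ⥤ C} {L' : D ⥤ B} {G' : B ⥤ D}
    (h : QuillenEquivalencePair MC MD L G) (h' : QuillenEquivalencePair MD MB L' G') :
    QuillenEquivalencePair MC MB (L ⋙ L') (G' ⋙ G) := by
  obtain ⟨⟨adj⟩, h⟩ := h
  obtain ⟨⟨adj'⟩, h'⟩ := h'
  replace h := h adj
  replace h' := h' adj'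
  refine .of_adj (adj.comp adj')
    { map_cofibration := fun _ _ f hf => h'.map_cofibration _ (h.map_cofibration _ hf)
      map_trivialCofibration := fun _ _ f hf =>
        h'.map_trivialCofibration _ (h.map_trivialCofibration _ hf)
      weakEquivalence_iff := fun X Y hX hY f => ?_ }
  have e : (adj.comp adj').homEquiv X Y f = adj.homEquiv _ _ (adj'.homEquiv _ _ f) := by
    simp [Adjunction.homEquiv_unit]
  rw [e, ← h.weakEquivalence_iff _ _ hX (h'.map_isFibrant hY)]
  exact h'.weakEquivalence_iff _ _ (h.map_isCofibrant hX) hY f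

lemma QuillenEquivalencePair.refl : QuillenEquivalencePair MC MC (𝟭 C) (𝟭 C) := by
  refine .of_adj .id
    { map_cofibration := fun _ _ _ h => h
      map_trivialCofibration := fun _ _ _ h => h
      weakEquivalence_iff := fun X Y _ _ f => ?_ }
  rw [Adjunction.homEquiv_unit]
  exact iff_of_eq (congrArg _ (Category.id_comp f).symm)

variable {MC MD} in
/-- An adjunction whose left adjoint is fully faithful and whose right adjoint creates weak
equivalences and preserves fibrations is a Quillen equivalence. -/
lemma QuillenEquivalencePair.of_iso {L : C ⥤ D} {G : D ⥤ C} (adj : L ⊣ G) (e : L ⋙ G ≅ 𝟭 C)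
    (hG : IsCreating G) : QuillenEquivalencePair MC MD L G := by
  have := adj.isIso_unit_of_iso e
  exact .of_adj adj (.of_unit (hG.isQuillenAdjunction adj) hG.weakEquivalences_eq
    fun X _ => weq_of_isIso _)

/-- By the triangle identity, `G` sends the counit to an inverse of the invertible unit at `G X`,
and `G` reflects weak equivalences. -/
lemma weq_counit [ModelCategory C] [ModelCategory D] {L : C ⥤ D} {G : D ⥤ C} (adj : L ⊣ G)
    [IsIso adj.unit] (hG : (weakEquivalences C).inverseImage G = weakEquivalences D) (X : D) :
    weakEquivalences D (adj.counit.app X) := by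
  rw [← hG]
  refine (weq_comp_left_iff (adj.unit.app (G.obj X)) _ (weq_of_isIso _)).1 ?_
  rw [adj.right_triangle_components]
  exact weq_of_isIso (𝟙 (G.obj X))

/-- If `c : Z ⟶ X` is a weak equivalence to a cofibrant object and the unit of a Quillen adjunction
is a weak equivalence at `Z`, then it is one at `X`, provided that the right adjoint preserves weak
equivalences. -/
lemma IsQuillenAdjunction.weq_unit [ModelCategory C] [ModelCategory D] {L : C ⥤ D} {G : D ⥤ C}
    {adj : L ⊣ G} (h : IsQuillenAdjunction adj)
    (hG : weakEquivalences D ≤ (weakEquivalences C).inverseImage G) {Z X : C} (c : Z ⟶ X)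
    (hc : weakEquivalences C c) (hZ : weakEquivalences C (adj.unit.app Z)) (hX : IsCofibrant X) :
    weakEquivalences C (adj.unit.app X) := by
  -- As `Z` need not be cofibrant, nothing is known about `L.map c`. The map `c` is therefore
  -- factored: the unit is carried along `φ.i` because `L` preserves trivial cofibrations, and along
  -- `φ.p` because a trivial fibration onto a cofibrant object splits.
  let φ := MorphismProperty.factorizationData (trivialCofibrations C) (fibrations C) c
  have hp : trivialFibrations C φ.p :=
    ⟨φ.hp, (weq_comp_left_iff φ.i φ.p φ.hi.2).1 (by rwa [φ.fac])⟩
  obtain ⟨s, hs⟩ := exists_section φ.p hp hX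
  have nat {A B : C} (f : A ⟶ B) : f ≫ adj.unit.app B = adj.unit.app A ≫ G.map (L.map f) :=
    adj.unit.naturality f
  -- Two out of three in the naturality square of the unit at `φ.i`.
  have hφ : weakEquivalences C (adj.unit.app φ.Z) := by
    rw [← weq_comp_left_iff φ.i _ φ.hi.2, nat]
    exact (weakEquivalences C).comp_mem _ _ hZ (hG _ (h.map_trivialCofibration _ φ.hi).2)
  refine (weakEquivalences C).of_retract
    { i := Arrow.homMk s (G.map (L.map s)) (nat s)
      r := Arrow.homMk φ.p (G.map (L.map φ.p)) (nat φ.p)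
      retract := ?_ } hφ
  ext
  · exact hs
  · change G.map (L.map s) ≫ G.map (L.map φ.p) = 𝟙 _
    rw [← G.map_comp, ← L.map_comp, hs, L.map_id, G.map_id]

variable {MC MD} in
/-- In an adjoint triple `L ⊣ S ⊣ T` with `S` fully faithful, whose functors `S` and `T` create weak
equivalences and preserve fibrations, also the adjunction `L ⊣ S` is a Quillen equivalence. -/
lemma QuillenEquivalencePair.of_triple {L : D ⥤ C} {S : C ⥤ D} {T : D ⥤ C} (adj : L ⊣ S)
    (adj' : S ⊣ T) (e : S ⋙ T ≅ 𝟭 C) (hS : IsCreating S) (hT : IsCreating T) :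
    QuillenEquivalencePair MD MC L S := by
  have hL := hS.isQuillenAdjunction adj
  have i₁ := adj'.isIso_unit_of_iso e
  have hff := adj'.fullyFaithfulLOfIsIsoUnit
  have := hff.full
  have := hff.faithful
  refine .of_adj adj (.of_unit hL hS.weakEquivalences_eq fun X hX =>
    hL.weq_unit hS.weakEquivalences_eq.ge _ (weq_counit adj' hT.weakEquivalences_eq X) ?_ hX)
  -- Since `S` is fully faithful, the unit of `L ⊣ S` is invertible on the image of `S`; the object
  -- `S (T X)` maps to `X` by the counit of `S ⊣ T`, a weak equivalence.
  exact weq_of_isIso (adj.unit.app (S.obj (T.obj X)))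

variable {MC MD MB} in
/-- Two out of three for Quillen equivalences, when weak equivalences are created by the right
adjoints and the first unit is invertible. -/
lemma QuillenEquivalencePair.of_comp {L : C ⥤ D} {G : D ⥤ C} {L' : D ⥤ B} {G' : B ⥤ D}
    (adj : L ⊣ G) (e : L ⋙ G ≅ 𝟭 C) (hG : IsCreating G) (adj' : L' ⊣ G') (hG' : IsCreating G')
    (h : ∀ X, weakEquivalences D (adj'.unit.app (L.obj X))) :
    QuillenEquivalencePair MD MB L' G' := by
  have hL' := hG'.isQuillenAdjunction adj'
  have i₁ := adj.isIso_unit_of_iso e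
  exact .of_adj adj' (.of_unit hL' hG'.weakEquivalences_eq fun X hX =>
    hL'.weq_unit hG'.weakEquivalences_eq.ge _ (weq_counit adj hG.weakEquivalences_eq X) (h _) hX)

end

end SpecSeq

namespace SpecSeq
variable {R : Type u} [CommRing R]

/-! ### Elements of complexes -/

section Elements

variable {r : ℕ}

lemma d_apply_zero (A : RBC R r) {b c e : ℤ × ℤ} (x : A.X b) : A.d c e (A.d b c x) = 0 :=
  congrArg (fun φ => φ.hom x) (A.d_comp_d b c e)

lemma comm_apply {A B : RBC R r} (f : A ⟶ B) (b c : ℤ × ℤ) (x : A.X b) :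
    f.f c (A.d b c x) = B.d b c (f.f b x) :=
  (congrArg (fun φ => φ.hom x) (f.comm b c)).symm

/-- An element is a map from `R`, so the universal property of the cycles applies; the result is
evaluated at `1`. -/
lemma exists_iCycles_eq (A : RBC R r) {b : ℤ × ℤ} (x : A.X b) (hx : A.d b (b + δ r) x = 0) :
    ∃ z : A.cycles b, A.iCycles b z = x := by
  have h : ModuleCat.ofHom (LinearMap.toSpanSingleton R (A.X b) x) ≫ A.d b (b + δ r) = 0 := by
    ext
    simpa using hx
  refine ⟨A.liftCycles (ModuleCat.ofHom (LinearMap.toSpanSingleton R (A.X b) x)) (b + δ r)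
    ((shape r).next_eq' rfl) h (1 : R), ?_⟩
  have := congrArg (fun φ => φ.hom (1 : R)) (A.liftCycles_i _ _ ((shape r).next_eq' rfl) h)
  refine this.trans ?_
  simp

lemma d_iCycles_apply (A : RBC R r) {b : ℤ × ℤ} (c : ℤ × ℤ) (z : A.cycles b) :
    A.d b c (A.iCycles b z) = 0 :=
  congrArg (fun φ => φ.hom z) (A.iCycles_d b c)

lemma iCycles_injective (A : RBC R r) (b : ℤ × ℤ) : Function.Injective (A.iCycles b) :=
  (ModuleCat.mono_iff_injective _).1 inferInstance

lemma homologyπ_surjective (A : RBC R r) (b : ℤ × ℤ) : Function.Surjective (A.homologyπ b) :=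
  (ModuleCat.epi_iff_surjective _).1 inferInstance

lemma homologyπ_eq_zero_iff (A : RBC R r) {b c : ℤ × ℤ} (h : b + δ r = c) (z : A.cycles c) :
    A.homologyπ c z = 0 ↔ ∃ y : A.X b, A.d b c y = A.iCycles c z := by
  have ex : (ShortComplex.mk _ _ (A.toCycles_comp_homologyπ b c)).Exact :=
    ShortComplex.exact_of_g_is_cokernel _ (A.homologyIsCokernel b c ((shape r).prev_eq' h))
  rw [ShortComplex.moduleCat_exact_iff] at ex
  have e (y : A.X b) : A.iCycles c (A.toCycles b c y) = A.d b c y :=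
    congrArg (fun φ => φ.hom y) (A.toCycles_i b c)
  constructor
  · intro hz
    obtain ⟨y, hy⟩ := ex z hz
    exact ⟨y, (e y).symm.trans (congrArg _ hy)⟩
  · rintro ⟨y, hy⟩
    rw [← e] at hy
    rw [← iCycles_injective A c hy]
    exact congrArg (fun φ => φ.hom y) (A.toCycles_comp_homologyπ b c)

lemma homologyMap_homologyπ_apply {A B : RBC R r} (f : A ⟶ B) {b : ℤ × ℤ} (z : A.cycles b) :
    HomologicalComplex.homologyMap f b (A.homologyπ b z) =
      B.homologyπ b (HomologicalComplex.cyclesMap f b z) :=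
  congrArg (fun φ => φ.hom z) (HomologicalComplex.homologyπ_naturality f b)

lemma iCycles_cyclesMap_apply {A B : RBC R r} (f : A ⟶ B) {b : ℤ × ℤ} (z : A.cycles b) :
    B.iCycles b (HomologicalComplex.cyclesMap f b z) = f.f b (A.iCycles b z) :=
  congrArg (fun φ => φ.hom z) (HomologicalComplex.cyclesMap_i f b)

/-- A description of quasi-isomorphisms in terms of elements. -/
lemma quasiIsos_iff {A B : RBC R r} (f : A ⟶ B) :
    quasiIsos R r f ↔
      (∀ b c, b + δ r = c → ∀ (x : A.X c) (y : B.X b), A.d c (c + δ r) x = 0 →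
        f.f c x = B.d b c y → ∃ z : A.X b, A.d b c z = x) ∧
      (∀ b c, b + δ r = c → ∀ y : B.X c, B.d c (c + δ r) y = 0 →
        ∃ (x : A.X c) (z : B.X b), A.d c (c + δ r) x = 0 ∧ f.f c x = y + B.d b c z) := by
  have e : quasiIsos R r f ↔
      ∀ c, Function.Bijective (HomologicalComplex.homologyMap f c) := by
    refine ⟨fun h c => ?_, fun h => ⟨fun c => ?_⟩⟩
    · have : QuasiIso f := h
      exact ConcreteCategory.bijective_of_isIso _
    · rw [quasiIsoAt_iff_isIso_homologyMap]
      exact (ConcreteCategory.isIso_iff_bijective _).2 (h c)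
  rw [e]
  constructor
  · refine fun H => ⟨fun b c h x y hx hxy => ?_, fun b c h y hy => ?_⟩
    · obtain ⟨z, rfl⟩ := exists_iCycles_eq A x hx
      rw [← homologyπ_eq_zero_iff A h]
      apply (H c).1
      rw [map_zero, homologyMap_homologyπ_apply, homologyπ_eq_zero_iff B h]
      exact ⟨y, by rw [iCycles_cyclesMap_apply, hxy]⟩
    · obtain ⟨z, rfl⟩ := exists_iCycles_eq B y hy
      obtain ⟨w, hw⟩ := (H c).2 (B.homologyπ c z)
      obtain ⟨t, rfl⟩ := homologyπ_surjective A c w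
      rw [homologyMap_homologyπ_apply, ← sub_eq_zero, ← map_sub, homologyπ_eq_zero_iff B h] at hw
      obtain ⟨y, hy⟩ := hw
      refine ⟨A.iCycles c t, y, d_iCycles_apply _ _ _, ?_⟩
      rw [hy, map_sub, iCycles_cyclesMap_apply]
      abel
  · refine fun H c => ⟨(injective_iff_map_eq_zero _).2 fun w hw => ?_, fun w => ?_⟩
    · obtain ⟨z, rfl⟩ := homologyπ_surjective A c w
      rw [homologyMap_homologyπ_apply, homologyπ_eq_zero_iff B (sub_add_cancel c (δ r))] at hw
      obtain ⟨y, hy⟩ := hw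
      rw [homologyπ_eq_zero_iff A (sub_add_cancel c (δ r))]
      exact H.1 _ c (sub_add_cancel c (δ r)) _ y (d_iCycles_apply _ _ _)
        (by rw [hy, iCycles_cyclesMap_apply])
    · obtain ⟨z, rfl⟩ := homologyπ_surjective B c w
      obtain ⟨x, t, hx, hxt⟩ := H.2 _ c (sub_add_cancel c (δ r)) _ (d_iCycles_apply _ _ z)
      obtain ⟨x, rfl⟩ := exists_iCycles_eq A x hx
      refine ⟨A.homologyπ c x, ?_⟩
      rw [homologyMap_homologyπ_apply, ← sub_eq_zero, ← map_sub,
        homologyπ_eq_zero_iff B (sub_add_cancel c (δ r))]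
      exact ⟨t, by rw [map_sub, iCycles_cyclesMap_apply, hxt]; abel⟩

/-- A complex is acyclic if all its cycles are boundaries. -/
def IsAcyclic (A : RBC R r) : Prop :=
  ∀ b c, b + δ r = c → ∀ x : A.X c, A.d c (c + δ r) x = 0 → ∃ y : A.X b, A.d b c y = x

lemma isAcyclic_iff_homology (A : RBC R r) : IsAcyclic A ↔ ∀ c, IsZero (A.homology c) := by
  constructor
  · intro h c
    rw [ModuleCat.isZero_iff_subsingleton]
    refine ⟨fun w w' => ?_⟩
    suffices ∀ w : A.homology c, w = 0 by rw [this w, this w']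
    intro w
    obtain ⟨z, rfl⟩ := homologyπ_surjective A c w
    rw [homologyπ_eq_zero_iff A (sub_add_cancel c (δ r))]
    exact h _ _ (sub_add_cancel c (δ r)) _ (d_iCycles_apply _ _ _)
  · intro h b c hbc x hx
    obtain ⟨z, rfl⟩ := exists_iCycles_eq A x hx
    rw [← homologyπ_eq_zero_iff A hbc]
    have := ModuleCat.isZero_iff_subsingleton.1 (h c)
    exact Subsingleton.elim _ _

lemma IsAcyclic.of_quasiIsos {A B : RBC R r} (f : A ⟶ B) (hf : quasiIsos R r f)
    (hB : IsAcyclic B) : IsAcyclic A := by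
  intro b c h x hx
  obtain ⟨y, hy⟩ := hB b c h (f.f c x) (by rw [← comm_apply, hx, map_zero])
  exact ((quasiIsos_iff f).1 hf).1 b c h x y hx hy.symm

lemma IsAcyclic.of_quasiIsos' {A B : RBC R r} (f : A ⟶ B)
    (hA : IsAcyclic A) (hf : quasiIsos R r f) : IsAcyclic B := by
  intro b c h y hy
  obtain ⟨x, z, hx, hxz⟩ := ((quasiIsos_iff f).1 hf).2 b c h y hy
  obtain ⟨x', rfl⟩ := hA b c h x hx
  refine ⟨f.f b x' - z, ?_⟩
  rw [map_sub, ← comm_apply, hxz]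
  abel

lemma quasiIsos_of_isIso {A B : RBC R r} (f : A ⟶ B) [IsIso f] : quasiIsos R r f :=
  show QuasiIso f from inferInstance

lemma quasiIsos_eq : quasiIsos R r = HomologicalComplex.quasiIso (ModuleCat.{u} R) (shape r) := by
  ext A B f
  rfl

instance : (quasiIsos R r).HasTwoOutOfThreeProperty := by
  rw [quasiIsos_eq]
  infer_instance

/-- A surjection with acyclic kernel is a quasi-isomorphism. -/
lemma quasiIsos_of_surjective {A B : RBC R r} (f : A ⟶ B) (hf : surjective R r f)
    (h : ∀ b c, b + δ r = c → ∀ x : A.X c, f.f c x = 0 → A.d c (c + δ r) x = 0 →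
      ∃ y : A.X b, f.f b y = 0 ∧ A.d b c y = x) : quasiIsos R r f := by
  rw [quasiIsos_iff]
  refine ⟨fun b c hbc x y hx hxy => ?_, fun b c hbc y hy => ?_⟩
  · obtain ⟨y, rfl⟩ := hf b y
    obtain ⟨z, -, hz⟩ := h b c hbc (x - A.d b c y) (by rw [map_sub, hxy, comm_apply, sub_self])
      (by rw [map_sub, hx, d_apply_zero, sub_zero])
    exact ⟨z + y, by rw [map_add, hz, sub_add_cancel]⟩
  · obtain ⟨x, rfl⟩ := hf c y
    -- The lift `x` of the cycle need not be a cycle, but `d x` is a cycle of the kernel; it bounds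
    -- some `z` there, and `x - z` is a cycle with the same image.
    obtain ⟨z, hz, hz'⟩ := h c _ rfl (A.d c (c + δ r) x) (by rw [comm_apply, hy])
      (d_apply_zero _ _)
    exact ⟨x - z, 0, by rw [map_sub, hz', sub_self], by rw [map_sub, hz, map_zero]; abel⟩

/-- Trivial fibrations of complexes by a lifting property for elements. -/
lemma surjective_quasiIsos_iff {A B : RBC R r} (f : A ⟶ B) :
    (surjective R r f ∧ quasiIsos R r f) ↔
      ∀ b (x : A.X (b + δ r)) (y : B.X b), A.d _ (b + δ r + δ r) x = 0 →
        f.f _ x = B.d _ _ y → ∃ z : A.X b, A.d _ _ z = x ∧ f.f b z = y := by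
  rw [quasiIsos_iff]
  constructor
  · rintro ⟨h₁, h₂, h₃⟩ b x y hx hxy
    obtain ⟨z, rfl⟩ := h₂ b _ rfl x y hx hxy
    -- The element `z` bounds `x` but `f z` may differ from `y` by a cycle. That cycle is, up to a
    -- boundary `d t`, the image of a cycle `x'`, and `t` lifts by surjectivity; hence the
    -- correction `z + x' - d t`.
    obtain ⟨x', t, hx', ht⟩ := h₃ _ b (sub_add_cancel b (δ r)) (y - f.f b z)
      (by rw [map_sub, ← hxy, ← comm_apply, sub_self])
    obtain ⟨t, rfl⟩ := h₁ _ t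
    refine ⟨z + x' - A.d _ _ t, ?_, ?_⟩
    · rw [map_sub, map_add, hx', d_apply_zero, add_zero, sub_zero]
    · rw [map_sub, map_add, ht, comm_apply]
      abel
  · intro h
    -- The hypothesis with `x = 0`: cycles lift to cycles. Surjectivity then follows by first
    -- lifting the cycle `d y` and only afterwards `y`.
    have cyc : ∀ b (y : B.X b), B.d _ (b + δ r) y = 0 → ∃ z : A.X b, A.d _ (b + δ r) z = 0 ∧
        f.f b z = y := fun b y hy => by
      obtain ⟨z, hz, hz'⟩ := h b 0 y (map_zero _) (by rw [hy, map_zero])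
      exact ⟨z, hz, hz'⟩
    refine ⟨fun b y => ?_, fun b c hbc x y hx hxy => ?_, fun b c hbc y hy => ?_⟩
    · obtain ⟨x, hx, hx'⟩ := cyc _ (B.d b (b + δ r) y) (d_apply_zero _ _)
      obtain ⟨z, -, hz⟩ := h b x y hx hx'
      exact ⟨z, hz⟩
    · subst hbc
      obtain ⟨z, hz, -⟩ := h b x y hx hxy
      exact ⟨z, hz⟩
    · obtain ⟨z, hz, hz'⟩ := cyc c y hy
      exact ⟨z, 0, hz, by rw [hz', map_zero, add_zero]⟩

end Elements

/-! ### Spheres and disks -/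

section Disks

variable (R) (r : ℕ)

/-- The two coordinates `-r` and `1 - r` of the shift cannot both vanish. The double complex on
these two bidegrees corepresents the evaluation at `b` only if they are distinct. -/
lemma δ_ne (b : ℤ × ℤ) : b ≠ b + δ r := by
  intro h
  simp only [δ, Prod.ext_iff, Prod.fst_add, Prod.snd_add] at h
  omega

/-- The free complex on a cycle in bidegree `b`. -/
def sphere (b : ℤ × ℤ) : RBC R r :=
  (HomologicalComplex.single _ (shape r) b).obj (ModuleCat.of R R)

/-- The generator of the sphere. -/
def sphereGen (b : ℤ × ℤ) : (sphere R r b).X b :=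
  (HomologicalComplex.singleObjXSelf (shape r) b (ModuleCat.of R R)).inv (1 : R)

/-- The free complex on an element in bidegree `b`. -/
def disk (b : ℤ × ℤ) : RBC R r :=
  HomologicalComplex.double (𝟙 (ModuleCat.of R R)) (show (shape r).Rel b (b + δ r) from rfl)

/-- The generator of the disk. -/
def diskGen (b : ℤ × ℤ) : (disk R r b).X b :=
  (HomologicalComplex.doubleXIso₀ (𝟙 (ModuleCat.of R R))
    (show (shape r).Rel b (b + δ r) from rfl)).inv (1 : R)

variable {R r}

lemma exists_sphere_hom (A : RBC R r) {b : ℤ × ℤ} (x : A.X b) (hx : A.d b (b + δ r) x = 0) :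
    ∃ f : sphere R r b ⟶ A, f.f b (sphereGen R r b) = x := by
  refine ⟨HomologicalComplex.mkHomFromSingle
    (ModuleCat.ofHom (LinearMap.toSpanSingleton R (A.X b) x)) fun k hk => ?_, ?_⟩
  · obtain rfl : b + δ r = k := hk
    ext
    simpa using hx
  · have := congrArg (fun φ => φ.hom (sphereGen R r b)) (HomologicalComplex.mkHomFromSingle_f
      (c := shape r) (ModuleCat.ofHom (LinearMap.toSpanSingleton R (A.X b) x)) fun k hk => by
        obtain rfl : b + δ r = k := hk
        ext
        simpa using hx)
    refine this.trans ?_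
    simp [sphereGen]

lemma sphere_hom_ext {A : RBC R r} {b : ℤ × ℤ} {f g : sphere R r b ⟶ A}
    (h : f.f b (sphereGen R r b) = g.f b (sphereGen R r b)) : f = g := by
  apply HomologicalComplex.from_single_hom_ext
  rw [← cancel_epi (HomologicalComplex.singleObjXSelf (shape r) b (ModuleCat.of R R)).inv]
  ext
  exact h

lemma d_sphereGen (b c : ℤ × ℤ) : (sphere R r b).d b c (sphereGen R r b) = 0 := by
  have : (sphere R r b).d b c = 0 := HomologicalComplex.single_obj_d _ _ _ _ _
  rw [this]
  rfl

lemma exists_disk_hom (A : RBC R r) {b : ℤ × ℤ} (x : A.X b) :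
    ∃ f : disk R r b ⟶ A, f.f b (diskGen R r b) = x := by
  let e := HomologicalComplex.evalCompCoyonedaCorepresentableByDoubleId
    (show (shape r).Rel b (b + δ r) from rfl) (δ_ne r b) (ModuleCat.of R R)
  refine ⟨e.homEquiv.symm (ModuleCat.ofHom (LinearMap.toSpanSingleton R (A.X b) x)), ?_⟩
  have := congrArg (fun φ => φ.hom (1 : R))
    (e.homEquiv.apply_symm_apply (ModuleCat.ofHom (LinearMap.toSpanSingleton R (A.X b) x)))
  exact Eq.trans this (one_smul R x)

lemma disk_hom_ext {A : RBC R r} {b : ℤ × ℤ} {f g : disk R r b ⟶ A}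
    (h : f.f b (diskGen R r b) = g.f b (diskGen R r b)) : f = g := by
  let e := HomologicalComplex.evalCompCoyonedaCorepresentableByDoubleId
    (show (shape r).Rel b (b + δ r) from rfl) (δ_ne r b) (ModuleCat.of R R)
  apply e.homEquiv.injective
  refine ModuleCat.hom_ext (LinearMap.ext_ring ?_)
  exact h

/-- The inclusion of the sphere into the disk whose generator it bounds. -/
def sphereToDisk (R : Type u) [CommRing R] (r : ℕ) (b : ℤ × ℤ) :
    sphere R r (b + δ r) ⟶ disk R r b :=
  (exists_sphere_hom (disk R r b) ((disk R r b).d b (b + δ r) (diskGen R r b))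
    (d_apply_zero _ _)).choose

lemma sphereToDisk_gen (b : ℤ × ℤ) :
    (sphereToDisk R r b).f _ (sphereGen R r (b + δ r)) =
      (disk R r b).d b (b + δ r) (diskGen R r b) :=
  (exists_sphere_hom (disk R r b) ((disk R r b).d b (b + δ r) (diskGen R r b))
    (d_apply_zero _ _)).choose_spec

open ZeroObject

/-- Maps out of the disk are elements of bidegree `b`, so a lift is a preimage of an element. -/
lemma hasLiftingProperty_disk_iff {A B : RBC R r} (f : A ⟶ B) :
    (∀ b, HasLiftingProperty (0 : (0 : RBC R r) ⟶ disk R r b) f) ↔ surjective R r f := by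
  constructor
  · intro h b y
    obtain ⟨g, hg⟩ := exists_disk_hom B y
    have sq : CommSq 0 (0 : (0 : RBC R r) ⟶ disk R r b) f g := ⟨by simp⟩
    have := h b
    refine ⟨sq.lift.f b (diskGen R r b), ?_⟩
    rw [← hg]
    exact congrArg (fun φ => (φ.f b).hom (diskGen R r b)) sq.fac_right
  · refine fun h b => ⟨fun {g k} sq => ?_⟩
    obtain ⟨x, hx⟩ := h b (k.f b (diskGen R r b))
    obtain ⟨l, hl⟩ := exists_disk_hom A x
    exact ⟨⟨⟨l, (isZero_zero _).eq_of_src _ _,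
      disk_hom_ext ((congrArg (f.f b) hl).trans hx)⟩⟩⟩

/-- A square is a cycle `x` of `A` together with an element `y` of `B` such that `f x = d y`, and a
lift is an element `z` with `d z = x` and `f z = y`: this is the criterion
`surjective_quasiIsos_iff`. -/
lemma hasLiftingProperty_sphereToDisk_iff {A B : RBC R r} (f : A ⟶ B) :
    (∀ b, HasLiftingProperty (sphereToDisk R r b) f) ↔
      (surjective R r f ∧ quasiIsos R r f) := by
  rw [surjective_quasiIsos_iff]
  constructor
  · intro h b x y hx hxy
    obtain ⟨g, hg⟩ := exists_sphere_hom A x hx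
    obtain ⟨k, hk⟩ := exists_disk_hom B y
    have sq : CommSq g (sphereToDisk R r b) f k := ⟨sphere_hom_ext (by
      refine (congrArg (f.f _) hg).trans (hxy.trans ?_)
      rw [← hk, ← comm_apply, ← sphereToDisk_gen]
      rfl)⟩
    have := h b
    refine ⟨sq.lift.f b (diskGen R r b), ?_, ?_⟩
    · rw [← comm_apply, ← sphereToDisk_gen, ← hg]
      exact congrArg (fun φ => (φ.f _).hom (sphereGen R r _)) sq.fac_left
    · rw [← hk]
      exact congrArg (fun φ => (φ.f b).hom (diskGen R r b)) sq.fac_right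
  · refine fun h b => ⟨fun {g k} sq => ?_⟩
    obtain ⟨z, hz, hz'⟩ := h b (g.f _ (sphereGen R r _)) (k.f b (diskGen R r b))
      (by rw [← comm_apply, d_sphereGen, map_zero]) (by
        rw [← comm_apply, ← sphereToDisk_gen]
        exact congrArg (fun φ => (φ.f _).hom (sphereGen R r _)) sq.w)
    obtain ⟨l, hl⟩ := exists_disk_hom A z
    refine ⟨⟨⟨l, sphere_hom_ext ?_, disk_hom_ext ?_⟩⟩⟩
    · refine Eq.trans ?_ hz
      rw [← hl, ← comm_apply, ← sphereToDisk_gen]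
      rfl
    · refine Eq.trans ?_ hz'
      exact congrArg (f.f b) hl

end Disks

/-! ### Cones -/

section Cover

variable {r : ℕ} (A : RBC R r)

/-- The cone over the bigraded module underlying `A`: in bidegree `b`, the pairs of elements of `A` of
bidegrees `b` and `b - δ r`, with differential `(x, y) ↦ (0, x)`. -/
def cover : RBC R r :=
  mkRBC r (fun b => ModuleCat.of R (A.X b × A.X (b - δ r)))
    (fun b c h => ModuleCat.ofHom ((LinearMap.inr R _ _) ∘ₗ
      (A.XIsoOfEq (by rw [← h, add_sub_cancel_right] : b = c - δ r)).hom.hom ∘ₗ LinearMap.fst R _ _))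
    (fun a b c h h' => ModuleCat.hom_ext (LinearMap.ext fun x => Prod.ext rfl
      (map_zero (A.XIsoOfEq (by rw [← h', add_sub_cancel_right] : b = c - δ r)).hom.hom)))

/-- The map `(x, y) ↦ x + d y`. -/
def coverπ : cover A ⟶ A where
  f b := ModuleCat.ofHom (LinearMap.coprod LinearMap.id (A.d (b - δ r) b).hom)
  comm' b c h := by
    simp only [cover, mkRBC_d]
    rw [mkD_pos _ h]
    refine ModuleCat.hom_ext (LinearMap.ext fun x => ?_)
    have := congrArg (fun φ => φ.hom x.1)
      (A.XIsoOfEq_hom_comp_d (by rw [← show b + δ r = c from h, add_sub_cancel_right] : b = c - δ r) c)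
    have h₂ : A.d b c (A.d (b - δ r) b x.2) = 0 := d_apply_zero _ _
    change A.d b c (x.1 + A.d (b - δ r) b x.2) = _ + A.d (c - δ r) c _
    rw [map_add, h₂, add_zero]
    exact this.symm.trans (zero_add _).symm

lemma surjective_coverπ : surjective R r (coverπ A) := fun b x =>
  ⟨(x, 0), by
    change x + A.d _ _ 0 = x
    rw [map_zero, add_zero]⟩

/-- The cycles are the pairs `(0, y)`, and `(0, y)` is the differential of `(y, 0)`. No freeness of
`A` is involved: `quasiIsos_of_llp` only needs an acyclic complex surjecting onto `A`. -/
lemma isAcyclic_cover : IsAcyclic (cover A) := by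
  intro b c h x hx
  simp only [cover, mkRBC_d] at hx ⊢
  rw [mkD_pos _ rfl] at hx
  rw [mkD_pos _ h]
  have e₁ := h
  have e : b = c - δ r := by rw [← h, add_sub_cancel_right]
  have h₁ : x.1 = 0 := by
    have h₂ := congrArg Prod.snd hx
    have inj := ((ConcreteCategory.isIso_iff_bijective
      (A.XIsoOfEq (by rw [add_sub_cancel_right] : c = c + δ r - δ r)).hom).1 inferInstance).1
    apply inj
    rw [map_zero]
    exact h₂
  obtain ⟨y, hy⟩ := ((ConcreteCategory.isIso_iff_bijective (A.XIsoOfEq e).hom).1 inferInstance).2 x.2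
  exact ⟨(y, 0), Prod.ext h₁.symm hy⟩

end Cover

end SpecSeq

namespace SpecSeq
variable {R : Type u} [CommRing R]

/-! ### Existence of model structures -/

section Existence

attribute [local instance] Cardinal.fact_isRegular_aleph0 Cardinal.orderBotAleph0OrdToType

lemma isFiltered_of_aleph0 (J : Type u) [SmallCategory J]
    [IsCardinalFiltered J Cardinal.aleph0.{u}] : IsFiltered J :=
  isFiltered_of_isCardinalFiltered J Cardinal.aleph0.{u}

/-- Elements of filtered colimits of complexes. -/
lemma exists_rep_of_isColimit {r : ℕ} {J : Type u} [SmallCategory J] [IsFiltered J]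
    {K : J ⥤ RBC R r} {c : Cocone K} (hc : IsColimit c) (b : ℤ × ℤ) (x : c.pt.X b) :
    ∃ (j : J) (y : (K.obj j).X b), (c.ι.app j).f b y = x :=
  Concrete.isColimit_exists_rep (K ⋙ HomologicalComplex.eval _ _ b)
    (isColimitOfPreserves (HomologicalComplex.eval _ _ b) hc) x

lemma exists_map_eq_of_isColimit {r : ℕ} {J : Type u} [SmallCategory J] [IsFiltered J]
    {K : J ⥤ RBC R r} {c : Cocone K} (hc : IsColimit c) (b : ℤ × ℤ) {j : J}
    (y : (K.obj j).X b) (h : (c.ι.app j).f b y = 0) :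
    ∃ (k : J) (f : j ⟶ k), (K.map f).f b y = 0 := by
  obtain ⟨k, f, g, h⟩ := Concrete.isColimit_exists_of_rep_eq.{u}
    (K ⋙ HomologicalComplex.eval _ _ b)
    (isColimitOfPreserves (HomologicalComplex.eval _ _ b) hc) y (0 : (K.obj j).X b)
    (h.trans (map_zero ((c.ι.app j).f b).hom).symm)
  exact ⟨k, f, h.trans (map_zero ((K.map g).f b).hom)⟩

/-- A map out of the sphere is a cycle. A cycle of a filtered colimit is represented by an element
whose differential dies at a later stage, so it comes from a cycle of that stage. -/
instance isFinitelyPresentable_sphere (r : ℕ) (b : ℤ × ℤ) :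
    IsCardinalPresentable (sphere R r b) Cardinal.aleph0.{u} where
  preservesColimitOfShape J _ _ := ⟨fun {K} => ⟨fun {c} hc => by
    have := isFiltered_of_aleph0 J
    refine ⟨Types.FilteredColimit.isColimitOf' _ _ (fun (f : sphere R r b ⟶ c.pt) => ?_)
      (fun j (f : sphere R r b ⟶ K.obj j) (g : sphere R r b ⟶ K.obj j)
        (h : f ≫ c.ι.app j = g ≫ c.ι.app j) => ?_)⟩
    · obtain ⟨j, y, hy⟩ := exists_rep_of_isColimit hc b (f.f b (sphereGen R r b))
      obtain ⟨k, φ, hφ⟩ := exists_map_eq_of_isColimit hc (b + δ r) ((K.obj j).d b (b + δ r) y)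
        (by rw [comm_apply, hy, ← comm_apply, d_sphereGen, map_zero])
      obtain ⟨g, hg⟩ := exists_sphere_hom (K.obj k) ((K.map φ).f b y) (by rw [← comm_apply, hφ])
      refine ⟨k, g, sphere_hom_ext ?_⟩
      change f.f b _ = (c.ι.app k).f b (g.f b _)
      rw [hg, ← hy]
      exact congrArg (fun φ => (φ.f b).hom y) (c.w φ).symm
    · obtain ⟨k, φ, hφ⟩ := exists_map_eq_of_isColimit hc b
        (f.f b (sphereGen R r b) - g.f b (sphereGen R r b)) (by
          rw [map_sub, sub_eq_zero]
          exact congrArg (fun φ => (φ.f b).hom (sphereGen R r b)) h)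
      rw [map_sub, sub_eq_zero] at hφ
      exact ⟨k, φ, sphere_hom_ext hφ⟩⟩⟩

/-- There is only one map to produce, and a filtered category has an object at which to produce it.
-/
lemma isFinitelyPresentable_of_isZero {C : Type u₁} [Category.{u} C] {X : C} (hX : IsZero X) :
    IsCardinalPresentable X Cardinal.aleph0.{u} where
  preservesColimitOfShape J _ _ := ⟨fun {K} => ⟨fun {c} _ => by
    have := isFiltered_of_aleph0 J
    exact ⟨Types.FilteredColimit.isColimitOf' _ _
      (fun _ => ⟨IsFiltered.nonempty.some, hX.to_ _, hX.eq_of_src _ _⟩)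
      (fun j _ _ _ => ⟨j, 𝟙 j, hX.eq_of_src _ _⟩)⟩⟩⟩

/-- A model structure from its fibrations, its weak equivalences and generating sets `I` and `J`. -/
theorem exists_isModelStructure {C : Type u₁} [Category.{v₁} C] [HasLimits C] [HasColimits C]
    (F W : MorphismProperty C) [W.HasTwoOutOfThreeProperty] (I J : MorphismProperty C)
    [MorphismProperty.HasSmallObjectArgument.{v₁} I]
    [MorphismProperty.HasSmallObjectArgument.{v₁} J]
    (hI : I.rlp = F ⊓ W) (hJ : J.rlp = F) (hW : F.llp ≤ W) :
    ∃ M : ModelCategory C, IsModelStructure M F W := by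
  let _ : CategoryWithFibrations C := ⟨F⟩
  let _ : CategoryWithCofibrations C := ⟨(F ⊓ W).llp⟩
  let _ : CategoryWithWeakEquivalences C := ⟨W⟩
  have e₁ : trivialFibrations C = I.rlp := hI.symm
  have e₂ : cofibrations C = I.rlp.llp := congrArg MorphismProperty.llp e₁
  have e₃ : fibrations C = J.rlp := hJ.symm
  have hJ' : J.rlp.llp ≤ F.llp := (congrArg MorphismProperty.llp hJ).le
  -- Retract argument: a trivial cofibration factors as a map in `J.rlp.llp` followed by a
  -- fibration, which is a weak equivalence by two out of three; lifting against it exhibits the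
  -- trivial cofibration as a retract of the first factor.
  have e₄ : trivialCofibrations C = J.rlp.llp := by
    apply le_antisymm
    · rintro X Y i ⟨hi, hi'⟩
      let φ := MorphismProperty.factorizationData J.rlp.llp J.rlp i
      have hp : (F ⊓ W) φ.p := by
        refine ⟨hJ.le _ φ.hp, W.of_precomp φ.i φ.p (hW _ (hJ' _ φ.hi)) ?_⟩
        rw [φ.fac]
        exact hi'
      have : HasLiftingProperty i φ.p := hi _ hp
      exact MorphismProperty.of_retract (RetractArrow.ofLeftLiftingProperty φ.fac) φ.hi
    · rw [hJ]
      exact fun X Y i hi => ⟨fun A B p hp => hi _ hp.1, hW _ hi⟩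
  have f₁ : MorphismProperty.HasFunctorialFactorization (trivialCofibrations C) (fibrations C) := by
    rw [e₄, e₃]; infer_instance
  have f₂ : MorphismProperty.HasFunctorialFactorization (cofibrations C) (trivialFibrations C) := by
    rw [e₂, e₁]; infer_instance
  have w₁ : MorphismProperty.IsWeakFactorizationSystem (cofibrations C) (trivialFibrations C) :=
    { rlp := by rw [e₂, e₁, MorphismProperty.rlp_llp_rlp]
      llp := by rw [e₂, e₁] }
  have w₂ : MorphismProperty.IsWeakFactorizationSystem (trivialCofibrations C) (fibrations C) :=
    { rlp := by rw [e₄, e₃, MorphismProperty.rlp_llp_rlp]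
      llp := by rw [e₄, e₃] }
  have : (weakEquivalences C).HasTwoOutOfThreeProperty := ‹_›
  exact ⟨ModelCategory.mk' C, inferInstance, inferInstance, f₁, f₂, rfl, rfl⟩

open ZeroObject

lemma hasSmallObjectArgument {C : Type u₁} [Category.{u} C] [HasColimits C]
    {I : MorphismProperty C} [MorphismProperty.IsSmall.{u} I]
    (h : ∀ ⦃X Y : C⦄ (i : X ⟶ Y), I i → IsCardinalPresentable X Cardinal.aleph0.{u}) :
    MorphismProperty.HasSmallObjectArgument.{u} I := by
  have : MorphismProperty.IsCardinalForSmallObjectArgument I Cardinal.aleph0.{u} :=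
    { preservesColimit := fun i hi f hf => by
        have := h i hi
        infer_instance }
  exact ⟨.aleph0, inferInstance, inferInstance, inferInstance⟩

/-- If `j` has the left lifting property with respect to the maps `p` such that all `V i p` are
surjective, then `V i₀ j` is a quasi-isomorphism. -/
lemma quasiIsos_of_llp {C : Type u₁} [Category.{u} C] [Preadditive C] [HasLimits C]
    {ι : Type} [Finite ι] {rr : ι → ℕ} {V : ∀ i, C ⥤ RBC R (rr i)} {Φ : ∀ i, RBC R (rr i) ⥤ C}
    (adj : ∀ i, Φ i ⊣ V i) (i₀ : ι)
    (hV : ∀ i A, IsAcyclic ((V i₀).obj ((Φ i).obj (cover A)))) {X Y : C} (j : X ⟶ Y)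
    (hj : ∀ ⦃A B : C⦄ (p : A ⟶ B), (∀ i, surjective R _ ((V i).map p)) → HasLiftingProperty j p) :
    quasiIsos R _ ((V i₀).map j) := by
  have : Fintype ι := Fintype.ofFinite ι
  have : HasFiniteBiproducts C := HasFiniteBiproducts.of_hasFiniteProducts
  have : HasBinaryBiproducts C := hasBinaryBiproducts_of_finite_biproducts C
  have : (V i₀).IsRightAdjoint := (adj i₀).isRightAdjoint
  have : (V i₀).Additive := Functor.additive_of_preserves_binary_products _
  -- The covers of the complexes `V i Y` are carried to `C`. Each `coverπ` factors through `V i p`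
  -- by adjunction, so `V i p` is surjective for every `i`.
  let Z (i : ι) : C := (Φ i).obj (cover ((V i).obj Y))
  let K : C := ⨁ Z
  let p : K ⟶ Y := biproduct.desc fun i => ((adj i).homEquiv _ _).symm (coverπ _)
  have hp (i) : surjective R _ ((V i).map p) := by
    have : (adj i).unit.app _ ≫ (V i).map (biproduct.ι Z i) ≫ (V i).map p =
        coverπ ((V i).obj Y) := by
      rw [← (V i).map_comp, biproduct.ι_desc]
      exact ((adj i).homEquiv_unit _ _ _).symm.trans (Equiv.apply_symm_apply _ _)
    intro b y
    obtain ⟨x, hx⟩ := surjective_coverπ ((V i).obj Y) b y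
    rw [← this] at hx
    exact ⟨_, hx⟩
  have hq (i) : surjective R _ ((V i).map (biprod.desc j p)) := by
    intro b y
    obtain ⟨x, rfl⟩ := hp i b y
    refine ⟨((V i).map (biprod.inr : K ⟶ X ⊞ K)).f b x, ?_⟩
    have : (V i).map (biprod.inr : K ⟶ X ⊞ K) ≫ (V i).map (biprod.desc j p) = (V i).map p := by
      rw [← (V i).map_comp, biprod.inr_desc]
    exact congrArg (fun φ => (φ.f b).hom x) this
  -- A lift of `j` against `X ⊞ K ⟶ Y` is a section of that map extending `biprod.inl` along `j`,
  -- which makes `j` a retract of `biprod.inl`.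
  have := hj _ hq
  have hr : RetractArrow j (biprod.inl : X ⟶ X ⊞ K) :=
    .ofLeftLiftingProperty (biprod.inl_desc j p)
  -- Homology of `V i₀` is an additive functor, and it vanishes on each summand; the identity of `K`
  -- is a sum of maps factoring through the summands.
  have hK : ∀ c, IsZero ((V i₀ ⋙ HomologicalComplex.homologyFunctor _ _ c).obj K) := by
    intro c
    rw [IsZero.iff_id_eq_zero, ← CategoryTheory.Functor.map_id _ K, ← biproduct.total, Functor.map_sum]
    refine Finset.sum_eq_zero fun i _ => ?_
    rw [Functor.map_comp]
    have h₀ : IsZero ((V i₀ ⋙ HomologicalComplex.homologyFunctor _ _ c).obj (Z i)) :=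
      (isAcyclic_iff_homology _).1 (hV i _) c
    rw [h₀.eq_of_tgt (CategoryTheory.Functor.map _ (biproduct.π Z i)) 0, zero_comp]
  have hinl : quasiIsos R _ ((V i₀).map (biprod.inl : X ⟶ X ⊞ K)) := by
    refine ⟨fun c => ?_⟩
    rw [quasiIsoAt_iff_isIso_homologyMap]
    let H := V i₀ ⋙ HomologicalComplex.homologyFunctor _ _ c
    change IsIso (H.map (biprod.inl : X ⟶ X ⊞ K))
    refine ⟨H.map biprod.fst, by rw [← H.map_comp, biprod.inl_fst, H.map_id], ?_⟩
    have e : (biprod.fst ≫ biprod.inl : X ⊞ K ⟶ X ⊞ K) = 𝟙 _ - biprod.snd ≫ biprod.inr := by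
      rw [← biprod.total, add_sub_cancel_right]
    rw [← H.map_comp, e, H.map_sub, H.map_id, H.map_comp, (hK c).eq_of_tgt (H.map biprod.snd) 0,
      zero_comp, sub_zero]
  rw [quasiIsos_eq] at hinl ⊢
  exact MorphismProperty.of_retract (hr.map (V i₀)) hinl

/-- The model structure on `C` whose fibrations are the maps sent by all the right adjoints
`V i : C ⥤ (rr i)-𝒞` to surjections, and whose weak equivalences are the maps sent by `V i₀` to
quasi-isomorphisms. -/
theorem exists_isModelStructure_of_adjunctions
    {C : Type u₁} [Category.{u} C] [Preadditive C] [HasLimits C] [HasColimits C]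
    {ι : Type} [Finite ι] {rr : ι → ℕ} {V : ∀ i, C ⥤ RBC R (rr i)} {Φ : ∀ i, RBC R (rr i) ⥤ C}
    (adj : ∀ i, Φ i ⊣ V i) (i₀ : ι) [(V i₀).IsCardinalAccessible Cardinal.aleph0.{u}]
    (hV : ∀ i A, IsAcyclic ((V i₀).obj ((Φ i).obj (cover A))))
    (F W : MorphismProperty C)
    (hF : ∀ ⦃X Y : C⦄ (f : X ⟶ Y), F f ↔ ∀ i, surjective R _ ((V i).map f))
    (hW : ∀ ⦃X Y : C⦄ (f : X ⟶ Y), W f ↔ quasiIsos R _ ((V i₀).map f)) :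
    ∃ M : ModelCategory C, IsModelStructure M F W := by
  obtain rfl : W = (quasiIsos R _).inverseImage (V i₀) := by
    ext X Y f
    exact hW f
  -- Lifting against `J` is surjectivity of all the `V i p`. Weak equivalences are tested by `V i₀`
  -- alone, so `S` only needs the index `i₀`.
  let J : MorphismProperty C := .ofHoms fun x : ι × ℤ × ℤ =>
    (Φ x.1).map (0 : 0 ⟶ disk R (rr x.1) x.2)
  let S : MorphismProperty C := .ofHoms fun b : ℤ × ℤ => (Φ i₀).map (sphereToDisk R (rr i₀) b)
  -- The union of `J` and `S`, written as an indexed supremum so that `isSmall_iSup` applies.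
  let I : MorphismProperty C := ⨆ b : Bool, if b then J else S
  have hI_mem {X Y : C} (f : X ⟶ Y) : I f ↔ J f ∨ S f := by
    simp [I, MorphismProperty.iSup_iff, or_comm]
  have zero_pres (i : ι) :
      IsCardinalPresentable ((Φ i).obj (0 : RBC R (rr i))) Cardinal.aleph0.{u} := by
    have : (Φ i).IsLeftAdjoint := (adj i).isLeftAdjoint
    exact isFinitelyPresentable_of_isZero ((Φ i).map_isZero (isZero_zero _))
  have hJpres : ∀ ⦃X Y : C⦄ (i : X ⟶ Y), J i → IsCardinalPresentable X Cardinal.aleph0.{u} := by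
    rintro _ _ _ ⟨i, b⟩
    exact zero_pres i
  have hSpres : ∀ ⦃X Y : C⦄ (i : X ⟶ Y), S i → IsCardinalPresentable X Cardinal.aleph0.{u} := by
    rintro _ _ _ ⟨b⟩
    exact (adj i₀).isCardinalPresentable_leftAdjoint_obj _ _
  have : MorphismProperty.IsSmall.{u} J := MorphismProperty.isSmall_ofHoms _
  have : MorphismProperty.IsSmall.{u} S := MorphismProperty.isSmall_ofHoms _
  have : MorphismProperty.IsSmall.{u} I := by
    have : ∀ b : Bool, MorphismProperty.IsSmall.{u} (if b then J else S) := by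
      rintro (_ | _) <;> assumption
    exact MorphismProperty.isSmall_iSup _
  have hJ : J.rlp = F := by
    ext X Y p
    rw [hF]
    simp_rw [← hasLiftingProperty_disk_iff, ← (adj _).hasLiftingProperty_iff]
    exact ⟨fun h i b => h _ ⟨(i, b)⟩, by rintro h _ _ _ ⟨i, b⟩; exact h i b⟩
  have hS {X Y : C} (p : X ⟶ Y) : S.rlp p ↔
      surjective R _ ((V i₀).map p) ∧ quasiIsos R _ ((V i₀).map p) := by
    rw [← hasLiftingProperty_sphereToDisk_iff]
    simp_rw [← (adj _).hasLiftingProperty_iff]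
    exact ⟨fun h b => h _ ⟨b⟩, by rintro h _ _ _ ⟨b⟩; exact h b⟩
  have hI : I.rlp = F ⊓ (quasiIsos R _).inverseImage (V i₀) := by
    ext X Y p
    have : I.rlp p ↔ J.rlp p ∧ S.rlp p :=
      ⟨fun h => ⟨fun _ _ i hi => h i ((hI_mem i).2 (.inl hi)),
        fun _ _ i hi => h i ((hI_mem i).2 (.inr hi))⟩,
        fun h _ _ i hi => ((hI_mem i).1 hi).elim (h.1 i) (h.2 i)⟩
    rw [this, hJ, hS]
    exact ⟨fun h => ⟨h.1, h.2.2⟩, fun h => ⟨h.1, (hF p).1 h.1 i₀, h.2⟩⟩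
  have := hasSmallObjectArgument hJpres
  have : MorphismProperty.HasSmallObjectArgument.{u} I :=
    hasSmallObjectArgument fun X Y i hi => ((hI_mem i).1 hi).elim (hJpres i) (hSpres i)
  refine exists_isModelStructure F _ I J hI hJ fun X Y j hj => ?_
  exact quasiIsos_of_llp adj i₀ hV j fun A B p hp => hj p ((hF p).2 hp)

end Existence

end SpecSeq

namespace SpecSeq
variable {R : Type u} [CommRing R]

/-- With `α` one of the families of maps `d`, `w` or `s` along a diagram, this is the compatibility
of the pagewise map out of a colimit with the structure maps; the next lemma is its dual for limits.
-/
lemma desc_comp_eq_colimMap_comp_desc {J : Type u₁} [Category.{v₁} J] {C : Type u₂}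
    [Category.{v₂} C] [HasColimitsOfShape J C] {F G : J ⥤ C} (α : F ⟶ G) (s : Cocone F)
    (t : Cocone G) (φ : s.pt ⟶ t.pt) (h : ∀ j, s.ι.app j ≫ φ = α.app j ≫ t.ι.app j) :
    colimit.desc F s ≫ φ = colimMap α ≫ colimit.desc G t :=
  colimit.hom_ext fun j => by
    rw [colimit.ι_desc_assoc, ι_colimMap_assoc, colimit.ι_desc, h]

lemma lift_comp_limMap_eq_comp_lift {J : Type u₁} [Category.{v₁} J] {C : Type u₂}
    [Category.{v₂} C] [HasLimitsOfShape J C] {F G : J ⥤ C} (α : F ⟶ G) (s : Cone F)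
    (t : Cone G) (φ : s.pt ⟶ t.pt) (h : ∀ j, s.π.app j ≫ α.app j = φ ≫ t.π.app j) :
    limit.lift F s ≫ limMap α = φ ≫ limit.lift G t :=
  limit.hom_ext fun j => by
    rw [Category.assoc, Category.assoc, limMap_π, limit.lift_π, limit.lift_π_assoc, h]

namespace LWB

/-! ### Limits and colimits of linear witness books -/

section LimitsColimits

variable {k : ℕ}

variable (R k) in
/-- Evaluation of linear witness books at a page and a bidegree. -/
@[simps]
def ev (i : ℕ) (b : ℤ × ℤ) : LWB R k ⥤ ModuleCat.{u} R where
  obj L := (L.page i).X b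
  map f := (f.f i).f b

variable (R k) in
/-- The differentials as natural transformations. -/
@[simps]
def dNat (i : ℕ) (b c : ℤ × ℤ) : ev R k i b ⟶ ev R k i c where
  app L := (L.page i).d b c
  naturality _ _ f := (f.f i).comm b c

variable (R k) in
/-- The witness maps as natural transformations. -/
@[simps]
def wNat (i : ℕ) (b : ℤ × ℤ) : ev R k (i + 1) b ⟶ ev R k i b where
  app L := L.w i b
  naturality _ _ f := f.comm_w i b

variable (R k) in
/-- The degeneracy maps as natural transformations. -/
@[simps]
def sNat (i : ℕ) (b c : ℤ × ℤ) (h : b + (1, 1) = c) : ev R k i b ⟶ ev R k (i + 1) c where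
  app L := L.s i b c h
  naturality _ _ f := f.comm_s i b c h

variable {J : Type u₁} [Category.{v₁} J]

/-- The image of a diagram of linear witness books under a functor preserving zero morphisms, applied
in all bidegrees of all pages. -/
@[simps]
def mapDiagram (H : (J ⥤ ModuleCat.{u} R) ⥤ ModuleCat.{u} R)
    (hH : ∀ (F G : J ⥤ ModuleCat.{u} R), H.map (0 : F ⟶ G) = 0) (F : J ⥤ LWB R k) : LWB R k where
  page i :=
    { X b := H.obj (F ⋙ ev R k i b)
      d b c := H.map (Functor.whiskerLeft F (dNat R k i b c))
      shape b c h := by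
        rw [← hH]
        congr 1
        ext j : 2
        exact ((F.obj j).page i).shape b c h
      d_comp_d' b c e _ _ := by
        rw [← H.map_comp, ← hH]
        congr 1
        ext j : 2
        exact ((F.obj j).page i).d_comp_d b c e }
  w i b := H.map (Functor.whiskerLeft F (wNat R k i b))
  s i b c h := H.map (Functor.whiskerLeft F (sNat R k i b c h))
  s_w i b c h := by
    rw [← H.map_comp, ← hH]
    congr 1
    ext j : 2
    exact (F.obj j).s_w i b c h
  w_s i b c h := by
    rw [← H.map_comp, ← hH]
    congr 1
    ext j : 2
    exact (F.obj j).w_s i b c h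
  s_d_w i b c e h := by
    dsimp only
    rw [← H.map_comp, ← H.map_comp]
    congr 1
    ext j : 2
    exact (F.obj j).s_d_w i b c e h

section Colimits

variable [HasColimitsOfShape J (ModuleCat.{u} R)] (F : J ⥤ LWB R k)

/-- The pagewise colimit. -/
@[simps]
def colimitCocone : Cocone F where
  pt := mapDiagram colim (fun _ _ => colimit.hom_ext fun j => by
    rw [comp_zero, colim_map, ι_colimMap, NatTrans.app_zero, zero_comp]) F
  ι :=
    { app j :=
        { f i :=
            { f b := colimit.ι (F ⋙ ev R k i b) j
              comm' b c _ := colimit.ι_map (Functor.whiskerLeft F (dNat R k i b c)) j }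
          comm_w i b := colimit.ι_map (Functor.whiskerLeft F (wNat R k i b)) j
          comm_s i b c h := colimit.ι_map (Functor.whiskerLeft F (sNat R k i b c h)) j }
      naturality j j' f := by
        ext i b : 2
        exact (colimit.w (F ⋙ ev R k i b) f).trans (Category.comp_id _).symm }

/-- The pagewise colimit is a colimit. -/
def isColimitColimitCocone : IsColimit (colimitCocone F) where
  desc s :=
    { f i :=
        { f b := colimit.desc (F ⋙ ev R k i b) ((ev R k i b).mapCocone s)
          comm' b c _ := desc_comp_eq_colimMap_comp_desc
            (Functor.whiskerLeft F (dNat R k i b c)) ((ev R k i b).mapCocone s)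
            ((ev R k i c).mapCocone s) ((s.pt.page i).d b c) fun j => ((s.ι.app j).f i).comm b c }
      comm_w i b := desc_comp_eq_colimMap_comp_desc
            (Functor.whiskerLeft F (wNat R k i b)) ((ev R k (i + 1) b).mapCocone s)
            ((ev R k i b).mapCocone s) (s.pt.w i b) fun j => (s.ι.app j).comm_w i b
      comm_s i b c h := desc_comp_eq_colimMap_comp_desc
            (Functor.whiskerLeft F (sNat R k i b c h)) ((ev R k i b).mapCocone s)
            ((ev R k (i + 1) c).mapCocone s) (s.pt.s i b c h) fun j => (s.ι.app j).comm_s i b c h }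
  fac s j := by
    ext i b : 2
    exact colimit.ι_desc ((ev R k i b).mapCocone s) j
  uniq s m hm := by
    ext i b : 2
    refine colimit.hom_ext fun j => ?_
    refine Eq.trans ?_ (colimit.ι_desc ((ev R k i b).mapCocone s) j).symm
    exact congrArg (fun φ => (φ.f i).f b) (hm j)

instance : HasColimitsOfShape J (LWB R k) := ⟨fun F => ⟨⟨_, isColimitColimitCocone F⟩⟩⟩

instance (r : ℕ) :
    PreservesColimitsOfShape J (pageFunctor R r) :=
  ⟨fun {F} => preservesColimit_of_preserves_colimit_cocone (isColimitColimitCocone F)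
    (HomologicalComplex.isColimitOfEval _ _ fun b => colimit.isColimit (F ⋙ ev R 0 r b))⟩

end Colimits

section Limits

variable [HasLimitsOfShape J (ModuleCat.{u} R)] (F : J ⥤ LWB R k)

/-- The pagewise limit. -/
@[simps]
def limitCone : Cone F where
  pt := mapDiagram lim (fun _ _ => limit.hom_ext fun j => by
    rw [zero_comp, lim_map, limMap_π, NatTrans.app_zero, comp_zero]) F
  π :=
    { app j :=
        { f i :=
            { f b := limit.π (F ⋙ ev R k i b) j
              comm' b c _ := (limMap_π (Functor.whiskerLeft F (dNat R k i b c)) j).symm }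
          comm_w i b := (limMap_π (Functor.whiskerLeft F (wNat R k i b)) j).symm
          comm_s i b c h := (limMap_π (Functor.whiskerLeft F (sNat R k i b c h)) j).symm }
      naturality j j' f := by
        ext i b : 2
        exact (Category.id_comp _).trans (limit.w (F ⋙ ev R k i b) f).symm }

/-- The pagewise limit is a limit. -/
def isLimitLimitCone : IsLimit (limitCone F) where
  lift s :=
    { f i :=
        { f b := limit.lift (F ⋙ ev R k i b) ((ev R k i b).mapCone s)
          comm' b c _ := lift_comp_limMap_eq_comp_lift
            (Functor.whiskerLeft F (dNat R k i b c)) ((ev R k i b).mapCone s)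
            ((ev R k i c).mapCone s) ((s.pt.page i).d b c) fun j => ((s.π.app j).f i).comm b c }
      comm_w i b := lift_comp_limMap_eq_comp_lift
            (Functor.whiskerLeft F (wNat R k i b)) ((ev R k (i + 1) b).mapCone s)
            ((ev R k i b).mapCone s) (s.pt.w i b) fun j => (s.π.app j).comm_w i b
      comm_s i b c h := lift_comp_limMap_eq_comp_lift
            (Functor.whiskerLeft F (sNat R k i b c h)) ((ev R k i b).mapCone s)
            ((ev R k (i + 1) c).mapCone s) (s.pt.s i b c h) fun j => (s.π.app j).comm_s i b c h }
  fac s j := by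
    ext i b : 2
    exact limit.lift_π ((ev R k i b).mapCone s) j
  uniq s m hm := by
    ext i b : 2
    refine limit.hom_ext fun j => ?_
    refine Eq.trans ?_ (limit.lift_π ((ev R k i b).mapCone s) j).symm
    exact congrArg (fun φ => (φ.f i).f b) (hm j)

instance : HasLimitsOfShape J (LWB R k) := ⟨fun F => ⟨⟨_, isLimitLimitCone F⟩⟩⟩

end Limits

instance : HasLimits (LWB R k) := ⟨fun _ _ => inferInstance⟩

instance : HasColimits (LWB R k) := ⟨fun _ _ => inferInstance⟩

end LimitsColimits

/-! ### The additive structure -/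

section Additive

variable {k : ℕ} {K L : LWB R k}

instance : Zero (K ⟶ L) := ⟨{ f := fun _ => 0, comm_w := by simp, comm_s := by simp }⟩

instance : Add (K ⟶ L) := ⟨fun f g =>
  { f := fun i => f.f i + g.f i
    comm_w := fun i b => by simp [f.comm_w, g.comm_w]
    comm_s := fun i b c h => by simp [f.comm_s, g.comm_s] }⟩

instance : Neg (K ⟶ L) := ⟨fun f =>
  { f := fun i => -f.f i
    comm_w := fun i b => by simp [f.comm_w]
    comm_s := fun i b c h => by simp [f.comm_s] }⟩

instance : Sub (K ⟶ L) := ⟨fun f g =>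
  { f := fun i => f.f i - g.f i
    comm_w := fun i b => by simp [f.comm_w, g.comm_w]
    comm_s := fun i b c h => by simp [f.comm_s, g.comm_s] }⟩

instance : SMul ℕ (K ⟶ L) := ⟨fun n f =>
  { f := fun i => n • f.f i
    comm_w := fun i b => by simp [f.comm_w]
    comm_s := fun i b c h => by simp [f.comm_s] }⟩

instance : SMul ℤ (K ⟶ L) := ⟨fun n f =>
  { f := fun i => n • f.f i
    comm_w := fun i b => by simp [f.comm_w]
    comm_s := fun i b c h => by simp [f.comm_s] }⟩

instance : AddCommGroup (K ⟶ L) :=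
  Function.Injective.addCommGroup (fun f : K ⟶ L => f.f) (fun _ _ h => Hom.ext h) rfl
    (fun _ _ => rfl) (fun _ => rfl) (fun _ _ => rfl) (fun _ _ => rfl) (fun _ _ => rfl)

instance : Preadditive (LWB R k) where
  homGroup _ _ := inferInstance
  add_comp _ _ _ _ _ _ := by ext i : 1; exact Preadditive.add_comp _ _ _ _ _ _
  comp_add _ _ _ _ _ _ := by ext i : 1; exact Preadditive.comp_add _ _ _ _ _ _

/-- A morphism of linear witness books which is bijective in all bidegrees of all pages is an
isomorphism. -/
lemma isIso_of_bijective (f : K ⟶ L) (h : ∀ i b, Function.Bijective ((f.f i).f b)) : IsIso f := by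
  have h₁ (i : ℕ) (b : ℤ × ℤ) : IsIso ((f.f i).f b) :=
    (ConcreteCategory.isIso_iff_bijective _).2 (h i b)
  have h₂ (i : ℕ) : IsIso (f.f i) := HomologicalComplex.Hom.isIso_of_components _
  have e (i : ℕ) (b : ℤ × ℤ) : (inv (f.f i)).f b = inv ((f.f i).f b) := by
    rw [← cancel_epi ((f.f i).f b), IsIso.hom_inv_id, ← HomologicalComplex.comp_f,
      IsIso.hom_inv_id, HomologicalComplex.id_f]
  refine ⟨{ f := fun i => inv (f.f i), comm_w := fun i b => ?_, comm_s := fun i b c h => ?_ }, ?_, ?_⟩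
  · rw [e, e, IsIso.inv_comp_eq, ← Category.assoc, IsIso.eq_comp_inv, f.comm_w]
  · rw [e, e, IsIso.inv_comp_eq, ← Category.assoc, IsIso.eq_comp_inv, f.comm_s]
  · ext i : 1
    exact IsIso.hom_inv_id (f.f i)
  · ext i : 1
    exact IsIso.inv_hom_id (f.f i)

end Additive

end LWB

/-- A morphism of extended spectral sequences which is bijective in all bidegrees of all pages is an
isomorphism. -/
lemma ESpSe.isIso_of_bijective {X Y : ESpSe R} (f : X ⟶ Y)
    (h : ∀ i b, Function.Bijective ((f.f i).f b)) : IsIso f := by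
  have h₁ (i : ℕ) (b : ℤ × ℤ) : IsIso ((f.f i).f b) :=
    (ConcreteCategory.isIso_iff_bijective _).2 (h i b)
  have h₂ (i : ℕ) : IsIso (f.f i) := HomologicalComplex.Hom.isIso_of_components _
  refine ⟨{ f := fun i => inv (f.f i), comm := fun i b => ?_ }, ?_, ?_⟩
  · rw [← cancel_epi ((f.f (i + 1)).f b), ← Category.assoc, ← HomologicalComplex.comp_f,
      IsIso.hom_inv_id, HomologicalComplex.id_f, Category.id_comp, ← Category.assoc, f.comm,
      Category.assoc, ← HomologicalComplex.homologyMap_comp, IsIso.hom_inv_id,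
      HomologicalComplex.homologyMap_id, Category.comp_id]
  · ext i : 1
    exact IsIso.hom_inv_id (f.f i)
  · ext i : 1
    exact IsIso.inv_hom_id (f.f i)

end SpecSeq

namespace SpecSeq
variable {R : Type u} [CommRing R]

/-! ### Translation is an isomorphism of categories -/

lemma XIsoOfEq_d {r : ℕ} (A : RBC R r) {b b' c c' : ℤ × ℤ} (hb : b = b') (hc : c = c') :
    (A.XIsoOfEq hb).hom ≫ A.d b' c' = A.d b c ≫ (A.XIsoOfEq hc).hom := by
  subst hb hc
  simp

variable (R) in
/-- The unit of the equivalence given by the translation functor. -/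
def transUnitIso (r : ℕ) : 𝟭 (RBC R r) ≅ trans R r ⋙ transInv R r :=
  NatIso.ofComponents (fun A => HomologicalComplex.Hom.isoOfComponents
      (fun b => A.XIsoOfEq (τ_τinv b).symm)
      (fun b c _ => XIsoOfEq_d A (τ_τinv b).symm (τ_τinv c).symm))
    (fun f => by ext b : 1; exact XIsoOfEq_naturality f (τ_τinv b).symm)

variable (R) in
/-- The counit of the equivalence given by the translation functor. -/
def transCounitIso (r : ℕ) : transInv R r ⋙ trans R r ≅ 𝟭 (RBC R (r + 1)) :=
  NatIso.ofComponents (fun A => HomologicalComplex.Hom.isoOfComponents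
      (fun b => A.XIsoOfEq (τinv_τ b))
      (fun b c _ => XIsoOfEq_d A (τinv_τ b) (τinv_τ c)))
    (fun f => by ext b : 1; exact XIsoOfEq_naturality f (τinv_τ b))

variable (R) in
/-- The equivalence of categories given by the translation functor. -/
def transEquivalence (r : ℕ) : RBC R r ≌ RBC R (r + 1) :=
  CategoryTheory.Equivalence.mk (trans R r) (transInv R r) (transUnitIso R r) (transCounitIso R r)

instance (r : ℕ) : (trans R r).IsEquivalence := (transEquivalence R r).isEquivalence_functor

instance isEquivalence_transPow (r : ℕ) : (transPow R r).IsEquivalence := by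
  induction r with
  | zero => exact inferInstanceAs (𝟭 (RBC R 0)).IsEquivalence
  | succ r ih => exact inferInstanceAs (transPow R r ⋙ trans R r).IsEquivalence

namespace LWB

lemma XIsoOfEq_w {k : ℕ} (L : LWB R k) (i : ℕ) {b c : ℤ × ℤ} (h : b = c) :
    ((L.page (i + 1)).XIsoOfEq h).hom ≫ L.w i c = L.w i b ≫ ((L.page i).XIsoOfEq h).hom := by
  subst h
  simp

lemma XIsoOfEq_s {k : ℕ} (L : LWB R k) (i : ℕ) {b b' c c' : ℤ × ℤ} (hb : b = b') (hc : c = c')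
    (h : b + (1, 1) = c) (h' : b' + (1, 1) = c') :
    ((L.page i).XIsoOfEq hb).hom ≫ L.s i b' c' h' =
      L.s i b c h ≫ ((L.page (i + 1)).XIsoOfEq hc).hom := by
  subst hb hc
  simp

variable (R) in
/-- The equivalence of categories given by pagewise translation. -/
def transEquivalence (k : ℕ) : LWB R k ≌ LWB R (k + 1) := by
  let η : 𝟭 (LWB R k) ⟶ LWB.trans R k ⋙ LWB.transInv R k :=
    { app L :=
        { f i := (SpecSeq.transUnitIso R (i + k)).hom.app (L.page i)
          comm_w i b := L.XIsoOfEq_w i (τ_τinv b).symm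
          comm_s i b c h := L.XIsoOfEq_s i (τ_τinv b).symm (τ_τinv c).symm _ _ }
      naturality L L' f := by
        ext i : 1
        exact (SpecSeq.transUnitIso R (i + k)).hom.naturality (f.f i) }
  let ε : LWB.transInv R k ⋙ LWB.trans R k ⟶ 𝟭 (LWB R (k + 1)) :=
    { app L :=
        { f i := (SpecSeq.transCounitIso R (i + k)).hom.app (L.page i)
          comm_w i b := L.XIsoOfEq_w i (τinv_τ b)
          comm_s i b c h := L.XIsoOfEq_s i (τinv_τ b) (τinv_τ c) _ _ }
      naturality L L' f := by
        ext i : 1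
        exact (SpecSeq.transCounitIso R (i + k)).hom.naturality (f.f i) }
  have hη (L) : IsIso (η.app L) := isIso_of_bijective _ fun i b =>
    (ConcreteCategory.isIso_iff_bijective _).1
      (inferInstanceAs (IsIso ((L.page i).XIsoOfEq (τ_τinv b).symm).hom))
  have hε (L) : IsIso (ε.app L) := isIso_of_bijective _ fun i b =>
    (ConcreteCategory.isIso_iff_bijective _).1
      (inferInstanceAs (IsIso ((L.page i).XIsoOfEq (τinv_τ b)).hom))
  have := NatIso.isIso_of_isIso_app η
  have := NatIso.isIso_of_isIso_app ε
  exact CategoryTheory.Equivalence.mk (LWB.trans R k) (LWB.transInv R k) (asIso η) (asIso ε)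

/-! ### Adding a page -/

variable (R) in
/-- Removing the page which has been added gives the identity. -/
def extendTruncIso : extend R ⋙ trunc R ≅ 𝟭 (LWB R 1) := Iso.refl _

/-- The counit of the adjunction between adding and removing the page `0`. -/
def extendTruncCounit (L : LWB R 0) : (extend R).obj ((trunc R).obj L) ⟶ L where
  f i := match i with
    -- Forced by compatibility with witness maps: the added one is an identity, and the counit is an
    -- identity on page `1`. The zero differential is respected since `w` takes values in cycles.
    | 0 => { f := L.w 0, comm' := fun b c _ => (L.w_d 0 b c).trans zero_comp.symm }
    | i + 1 => 𝟙 (L.page (i + 1))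
  comm_w i _ := match i with
    | 0 => rfl
    | _ + 1 => (Category.id_comp _).trans (Category.comp_id _).symm
  comm_s i b c h := match i with
    | 0 => (L.w_s 0 b c h).trans zero_comp.symm
    | _ + 1 => (Category.id_comp _).trans (Category.comp_id _).symm

variable (R) in
/-- Adding a page `0` is left adjoint to forgetting the page `0`. -/
def extendTruncAdj : extend R ⊣ trunc R where
  unit := (extendTruncIso R).inv
  counit :=
    { app := extendTruncCounit
      naturality L L' f := by
        ext i : 1
        rcases i with _ | i
        · ext b : 1
          exact f.comm_w 0 b
        · exact (Category.comp_id _).trans (Category.id_comp _).symm }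
  left_triangle_components K := by
    ext i : 1
    rcases i with _ | i
    · ext b : 1
      exact Category.comp_id _
    · exact Category.comp_id _
  right_triangle_components L := by
    ext i : 1
    exact Category.comp_id _

variable (R) in
/-- The adjunction `ℱ_{≥ 1} 𝒯 ⊣ 𝒯⁻¹ 𝒰_{≥ 1}`. -/
def extendTransAdj : extendTrans R ⊣ transTrunc R :=
  (transEquivalence R 0).toAdjunction.comp (extendTruncAdj R)

variable (R) in
/-- The unit of the adjunction `ℱ_{≥ 1} 𝒯 ⊣ 𝒯⁻¹ 𝒰_{≥ 1}` is an isomorphism. -/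
def extendTransTruncIso : extendTrans R ⋙ transTrunc R ≅ 𝟭 (LWB R 0) :=
  Functor.isoWhiskerLeft (trans R 0) (Functor.isoWhiskerRight (extendTruncIso R) (transInv R 0)) ≪≫
    (transEquivalence R 0).unitIso.symm

end LWB

end SpecSeq

namespace SpecSeq
variable {R : Type u} [CommRing R]

namespace LWB

/-! ### The adjunction between `(𝒲_{≥ 1})_!` and `ℱ_{≥ 1}` -/

lemma comp_comp_eq_zero {C : Type u₁} [Category.{v₁} C] [HasZeroMorphisms C] {X Y Z W : C}
    (f : X ⟶ Y) {g : Y ⟶ Z} {h : Z ⟶ W} (w : g ≫ h = 0) : (f ≫ g) ≫ h = 0 := by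
  rw [Category.assoc, w, comp_zero]

section Left

variable (L : LWB R 0)

/-- The inclusion `a ↦ [(a, 0, 0)]` of the first summand of the generators. -/
def leftA (j : ℕ) (b c : ℤ × ℤ) (h : b + ((j : ℤ), (j : ℤ)) = c) :
    (L.page 0).X b ⟶ L.leftX j c :=
  ((L.page 0).XIsoOfEq (eq_sub_of_add_eq h)).hom ≫ biprod.inl ≫ biprod.inl ≫ cokernel.π _

/-- The inclusion `a ↦ [(0, a, 0)]` of the second summand of the generators. -/
def leftB (j : ℕ) (b c : ℤ × ℤ) (h : b = c + (1, 0)) : (L.page 0).X b ⟶ L.leftX j c :=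
  ((L.page 0).XIsoOfEq h).hom ≫ biprod.inr ≫ biprod.inl ≫ cokernel.π _

/-- The inclusion `x ↦ [(0, 0, x)]` of the third summand of the generators. -/
def leftC (j : ℕ) (b : ℤ × ℤ) : (L.page (j + 1)).X b ⟶ L.leftX j b :=
  biprod.inr ≫ cokernel.π _

variable {L} in
-- The three inclusions are jointly epimorphic because the page is a quotient of a direct sum. The
-- bidegree `b` is a variable, so that the transports between equal bidegrees stay hidden in `leftA`
-- and `leftB`.
lemma leftX_hom_ext {j : ℕ} {c : ℤ × ℤ} {M : ModuleCat.{u} R} {f g : L.leftX j c ⟶ M}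
    (hA : ∀ b h, L.leftA j b c h ≫ f = L.leftA j b c h ≫ g)
    (hB : ∀ b h, L.leftB j b c h ≫ f = L.leftB j b c h ≫ g)
    (hC : L.leftC j c ≫ f = L.leftC j c ≫ g) : f = g := by
  rw [← cancel_epi (cokernel.π _)]
  apply biprod.hom_ext'
  · apply biprod.hom_ext'
    · simpa [leftA] using hA _ (sub_add_cancel c ((j : ℤ), (j : ℤ)))
    · simpa [leftB] using hB _ rfl
  · simpa [leftC] using hC

lemma w_leftA (j : ℕ) (b c : ℤ × ℤ) (h : b + ((j : ℤ), (j : ℤ)) = c) :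
    L.w 0 b ≫ L.leftA j b c h = L.sPow j b c h ≫ L.leftC j c := by
  obtain rfl := eq_sub_of_add_eq h
  have := biprod.inl ≫= cokernel.condition (L.leftRel j c)
  rw [comp_zero] at this
  have e : biprod.inl ≫ L.leftRel j c =
      L.w 0 _ ≫ biprod.inl ≫ biprod.inl - L.sPow j _ c h ≫ biprod.inr := by
    apply biprod.hom_ext <;> simp [leftRel]
  rw [reassoc_of% e, Preadditive.sub_comp, sub_eq_zero] at this
  simpa [leftA, leftC] using this

lemma w_leftB (j : ℕ) (b b' c : ℤ × ℤ) (h : b = c + (1, 0)) (h' : b + ((j : ℤ), (j : ℤ)) = b') :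
    L.w 0 b ≫ L.leftB j b c h = L.sPow j b b' h' ≫ (L.page (j + 1)).d b' c ≫ L.leftC j c := by
  subst h h'
  have := biprod.inr ≫= cokernel.condition (L.leftRel j c)
  rw [comp_zero] at this
  have e : biprod.inr ≫ L.leftRel j c =
      L.w 0 _ ≫ biprod.inr ≫ biprod.inl -
        (L.sPow j _ _ rfl ≫ (L.page (j + 1)).d _ c) ≫ biprod.inr := by
    apply biprod.hom_ext <;> simp [leftRel]
  rw [reassoc_of% e, Preadditive.sub_comp, sub_eq_zero] at this
  simpa [leftB, leftC] using this

variable {L} in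
/-- A map out of a page of `(𝒲_{≥ 1})_! L`. -/
def leftDesc {j : ℕ} {c : ℤ × ℤ} {M : ModuleCat.{u} R}
    (α : (L.page 0).X (c - ((j : ℤ), (j : ℤ))) ⟶ M) (β : (L.page 0).X (c + (1, 0)) ⟶ M)
    (γ : (L.page (j + 1)).X c ⟶ M)
    (hα : L.w 0 _ ≫ α = L.sPow j _ c (sub_add_cancel _ _) ≫ γ)
    (hβ : L.w 0 _ ≫ β = L.sPow j _ _ rfl ≫ (L.page (j + 1)).d _ c ≫ γ) : L.leftX j c ⟶ M :=
  cokernel.desc _ (biprod.desc (biprod.desc α β) γ) (by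
    apply biprod.hom_ext' <;> simp [leftRel, hα, hβ])

@[simp]
lemma leftC_d (j : ℕ) (b c : ℤ × ℤ) :
    L.leftC j b ≫ mkD (j + 1) (L.leftD j) b c = (L.page (j + 1)).d b c ≫ L.leftC j c := by
  by_cases h : b + δ (j + 1) = c
  · rw [mkD_pos _ h]
    simp [leftC, leftGenD]
  · rw [mkD_neg _ h, (L.page (j + 1)).shape _ _ h, comp_zero, zero_comp]

@[simp]
lemma leftA_d (j : ℕ) (b c e : ℤ × ℤ) (h : b + ((j : ℤ), (j : ℤ)) = c) (h' : b = e + (1, 0)) :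
    L.leftA j b c h ≫ mkD (j + 1) (L.leftD j) c e = L.leftB j b e h' := by
  rw [mkD_pos _ (show c + δ (j + 1) = e by
    subst h; rw [h']; ext <;> simp [δ]; ring)]
  simp [leftA, leftB, leftGenD]

lemma leftB_d (j : ℕ) (b c e : ℤ × ℤ) (h : b = c + (1, 0)) :
    L.leftB j b c h ≫ mkD (j + 1) (L.leftD j) c e = 0 := by
  by_cases h : c + δ (j + 1) = e
  · rw [mkD_pos _ h]
    simp [leftB, leftGenD]
  · rw [mkD_neg _ h, comp_zero]

lemma leftA_w (j : ℕ) (b c : ℤ × ℤ) (h : b + (((j + 1 : ℕ) : ℤ), ((j + 1 : ℕ) : ℤ)) = c) :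
    L.leftA (j + 1) b c h ≫ L.leftW j c = 0 := by
  simp [leftA, leftGenW]

lemma leftB_w (j : ℕ) (b c : ℤ × ℤ) (h : b = c + (1, 0)) :
    L.leftB (j + 1) b c h ≫ L.leftW j c = L.leftB j b c h := by
  simp [leftB, leftGenW]

lemma leftC_w (j : ℕ) (b : ℤ × ℤ) :
    L.leftC (j + 1) b ≫ L.leftW j b = L.w (j + 1) b ≫ L.leftC j b := by
  simp [leftC, leftGenW]

lemma leftA_s (j : ℕ) (b c e : ℤ × ℤ) (h : b + ((j : ℤ), (j : ℤ)) = c) (h' : c + (1, 1) = e)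
    (h'' : b + (((j + 1 : ℕ) : ℤ), ((j + 1 : ℕ) : ℤ)) = e) :
    L.leftA j b c h ≫ L.leftS j c e h' = L.leftA (j + 1) b e h'' := by
  simp [leftA, leftGenS]

lemma leftB_s (j : ℕ) (b c e : ℤ × ℤ) (h : b = c + (1, 0)) (h' : c + (1, 1) = e) :
    L.leftB j b c h ≫ L.leftS j c e h' = 0 := by
  simp [leftB, leftGenS]

lemma leftC_s (j : ℕ) (b c : ℤ × ℤ) (h : b + (1, 1) = c) :
    L.leftC j b ≫ L.leftS j b c h = L.s (j + 1) b c h ≫ L.leftC (j + 1) c := by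
  simp [leftC, leftGenS]

variable {L} in
lemma leftA_map {L' : LWB R 0} (f : L ⟶ L') (j : ℕ) (b c : ℤ × ℤ)
    (h : b + ((j : ℤ), (j : ℤ)) = c) :
    L.leftA j b c h ≫ leftMap f j c = (f.f 0).f b ≫ L'.leftA j b c h := by
  simp [leftA, leftGenMap, reassoc_of% (@XIsoOfEq_naturality)]

variable {L} in
lemma leftB_map {L' : LWB R 0} (f : L ⟶ L') (j : ℕ) (b c : ℤ × ℤ) (h : b = c + (1, 0)) :
    L.leftB j b c h ≫ leftMap f j c = (f.f 0).f b ≫ L'.leftB j b c h := by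
  simp [leftB, leftGenMap, reassoc_of% (@XIsoOfEq_naturality)]

variable {L} in
lemma leftC_map {L' : LWB R 0} (f : L ⟶ L') (j : ℕ) (b : ℤ × ℤ) :
    L.leftC j b ≫ leftMap f j b = (f.f (j + 1)).f b ≫ L'.leftC j b := by
  simp [leftC, leftGenMap]

lemma leftA_desc {j : ℕ} {c : ℤ × ℤ} {M : ModuleCat.{u} R}
    (α : (L.page 0).X (c - ((j : ℤ), (j : ℤ))) ⟶ M) (β : (L.page 0).X (c + (1, 0)) ⟶ M)
    (γ : (L.page (j + 1)).X c ⟶ M) (hα) (hβ) (b) (h) :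
    L.leftA j b c h ≫ leftDesc α β γ hα hβ =
      ((L.page 0).XIsoOfEq (eq_sub_of_add_eq h)).hom ≫ α := by
  simp [leftA, leftDesc]

lemma leftB_desc {j : ℕ} {c : ℤ × ℤ} {M : ModuleCat.{u} R}
    (α : (L.page 0).X (c - ((j : ℤ), (j : ℤ))) ⟶ M) (β : (L.page 0).X (c + (1, 0)) ⟶ M)
    (γ : (L.page (j + 1)).X c ⟶ M) (hα) (hβ) (b) (h) :
    L.leftB j b c h ≫ leftDesc α β γ hα hβ = ((L.page 0).XIsoOfEq h).hom ≫ β := by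
  simp [leftB, leftDesc]

lemma leftC_desc {j : ℕ} {c : ℤ × ℤ} {M : ModuleCat.{u} R}
    (α : (L.page 0).X (c - ((j : ℤ), (j : ℤ))) ⟶ M) (β : (L.page 0).X (c + (1, 0)) ⟶ M)
    (γ : (L.page (j + 1)).X c ⟶ M) (hα) (hβ) :
    L.leftC j c ≫ leftDesc α β γ hα hβ = γ := by
  simp [leftC, leftDesc]

lemma sPow_zero (b : ℤ × ℤ) (h : b + (((0 : ℕ) : ℤ), ((0 : ℕ) : ℤ)) = b) :
    L.sPow 0 b b h = 𝟙 _ := by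
  simp [sPow]

/-- Write `d` as `s` followed by `d` and `w`. The first relation turns `w` followed by `leftA` into
`leftC`; the second one turns `d` followed by `leftC` into `w` followed by `leftB`, and `w` kills
the image of `s`. Thus `leftA 0` respects the zero differential of the added page. -/
lemma d_leftA_zero (b c : ℤ × ℤ) (h : c + (((0 : ℕ) : ℤ), ((0 : ℕ) : ℤ)) = c) :
    (L.page 0).d b c ≫ L.leftA 0 c c h = 0 := by
  by_cases hc : b + δ 0 = c
  · have e : b + (1, 1) = c + (1, 0) := by
      subst hc
      ext <;> simp [δ]
    rw [← L.s_d_w 0 b _ c e, Category.assoc, Category.assoc, w_leftA, sPow_zero,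
      Category.id_comp]
    have := L.w_leftB 0 (c + (1, 0)) _ c rfl (show _ = c + (1, 0) by ext <;> simp)
    rw [sPow_zero, Category.id_comp] at this
    rw [← this, reassoc_of% (L.s_w), zero_comp]
  · rw [(L.page 0).shape _ _ hc, zero_comp]

/-- The unit of the adjunction between `(𝒲_{≥ 1})_!` and `ℱ_{≥ 1}`. -/
def leftUnit : L ⟶ (extend R).obj ((left R).obj L) where
  f i := match i with
    | 0 =>
      { f b := L.leftA 0 b b (by simp)
        comm' b c _ := (L.d_leftA_zero b c (by simp)).trans comp_zero.symm |>.symm }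
    | i + 1 => { f := L.leftC i, comm' b c _ := L.leftC_d i b c }
  comm_w i b := match i with
    | 0 => (Category.comp_id _).trans
        (((L.w_leftA 0 b b (by simp)).trans (by rw [sPow_zero]; exact Category.id_comp _)).symm)
    | i + 1 => L.leftC_w i b
  comm_s i b c h := match i with
    | 0 => comp_zero.trans (by
        have := L.s 0 b c h ≫= L.w_leftA 0 c c (by simp)
        rw [reassoc_of% (L.s_w), zero_comp, sPow_zero, Category.id_comp] at this
        exact this)
    | i + 1 => L.leftC_s i b c h

variable (K : LWB R 1)

/-- The iterated degeneracy maps of a linear witness book without page `0`. -/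
def sIter (j : ℕ) (b c : ℤ × ℤ) (h : b + ((j : ℤ), (j : ℤ)) = c) :
    (K.page 0).X b ⟶ (K.page j).X c :=
  ((extend R).obj K).sPow j b c h

lemma sIter_zero (b : ℤ × ℤ) (h : b + (((0 : ℕ) : ℤ), ((0 : ℕ) : ℤ)) = b) :
    K.sIter 0 b b h = 𝟙 _ :=
  sPow_zero _ _ _

lemma sIter_s (j : ℕ) (b c e : ℤ × ℤ) (h : b + ((j : ℤ), (j : ℤ)) = c) (h' : c + (1, 1) = e)
    (h'' : b + (((j + 1 : ℕ) : ℤ), ((j + 1 : ℕ) : ℤ)) = e) :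
    K.sIter j b c h ≫ K.s j c e h' = K.sIter (j + 1) b e h'' :=
  sPow_s _ _ _ _ _ _ _ _

lemma sIter_w (j : ℕ) (b c : ℤ × ℤ) (h : b + (((j + 1 : ℕ) : ℤ), ((j + 1 : ℕ) : ℤ)) = c) :
    K.sIter (j + 1) b c h ≫ K.w j c = 0 :=
  sPow_w _ _ _ _ _

variable {K} in
lemma sIter_naturality {K' : LWB R 1} (f : K ⟶ K') (j : ℕ) (b c : ℤ × ℤ)
    (h : b + ((j : ℤ), (j : ℤ)) = c) :
    K.sIter j b c h ≫ (f.f j).f c = (f.f 0).f b ≫ K'.sIter j b c h :=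
  sPow_naturality ((extend R).map f) j b c h

lemma sIter_d_w (j : ℕ) (b c c' e : ℤ × ℤ) (h : b + ((j : ℤ), (j : ℤ)) = c)
    (h' : b + (((j + 1 : ℕ) : ℤ), ((j + 1 : ℕ) : ℤ)) = c') :
    (K.sIter (j + 1) b c' h' ≫ (K.page (j + 1)).d c' e) ≫ K.w j e =
      K.sIter j b c h ≫ (K.page j).d c e := by
  rw [← K.sIter_s j b c c' h (by subst h h'; ext <;> simp <;> ring) h', Category.assoc,
    Category.assoc, K.s_d_w]

variable {K} in
lemma sIter_d_naturality {K' : LWB R 1} (f : K ⟶ K') (j : ℕ) (b c e : ℤ × ℤ)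
    (h : b + ((j : ℤ), (j : ℤ)) = c) :
    (K.sIter j b c h ≫ (K.page j).d c e) ≫ (f.f j).f e =
      (f.f 0).f b ≫ K'.sIter j b c h ≫ (K'.page j).d c e := by
  rw [Category.assoc, ← (f.f j).comm, ← Category.assoc, sIter_naturality, Category.assoc]

lemma XIsoOfEq_sIter (j : ℕ) (b b' c : ℤ × ℤ) (hb : b = b') (h : b' + ((j : ℤ), (j : ℤ)) = c) :
    ((K.page 0).XIsoOfEq hb).hom ≫ K.sIter j b' c h = K.sIter j b c (by rw [hb, h]) :=
  cast_sPow _ _ _ _ _ _ _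

/-- The counit of the adjunction between `(𝒲_{≥ 1})_!` and `ℱ_{≥ 1}` in one bidegree. -/
def leftCounitX (j : ℕ) (c : ℤ × ℤ) : ((extend R).obj K).leftX j c ⟶ (K.page j).X c :=
  leftDesc (K.sIter j _ c (sub_add_cancel _ _)) (K.sIter j _ _ rfl ≫ (K.page j).d _ c) (𝟙 _)
    ((Category.id_comp _).trans (Category.comp_id _).symm)
    ((Category.id_comp _).trans (congrArg (_ ≫ ·) (Category.comp_id _).symm))

lemma leftA_counit (j : ℕ) (b c : ℤ × ℤ) (h : b + ((j : ℤ), (j : ℤ)) = c) :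
    ((extend R).obj K).leftA j b c h ≫ K.leftCounitX j c = K.sIter j b c h :=
  (leftA_desc _ _ _ _ _ _ _ _).trans
    (K.XIsoOfEq_sIter j _ _ _ (eq_sub_of_add_eq h) (sub_add_cancel _ _))

lemma leftB_counit (j : ℕ) (b b' c : ℤ × ℤ) (h : b = c + (1, 0))
    (h' : b + ((j : ℤ), (j : ℤ)) = b') :
    ((extend R).obj K).leftB j b c h ≫ K.leftCounitX j c = K.sIter j b b' h' ≫ (K.page j).d b' c := by
  refine (leftB_desc _ _ _ _ _ _ _ _).trans ?_
  subst h h'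
  simp [extend, extendPage, zeroDiff]

lemma leftC_counit (j : ℕ) (c : ℤ × ℤ) :
    ((extend R).obj K).leftC j c ≫ K.leftCounitX j c = 𝟙 _ :=
  leftC_desc _ _ _ _ _ _

lemma leftCounitX_d (j : ℕ) (c e : ℤ × ℤ) :
    K.leftCounitX j c ≫ (K.page j).d c e =
      mkD (j + 1) (((extend R).obj K).leftD j) c e ≫ K.leftCounitX j e := by
  by_cases hc : c + δ (j + 1) = e
  · refine leftX_hom_ext (fun b h => ?_) (fun b h => ?_) ?_
    · have h' : b = e + (1, 0) := by
        subst h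
        rw [← hc]
        ext <;> simp [δ] <;> ring
      rw [reassoc_of% (leftA_d _ j b c e h h'), reassoc_of% (leftA_counit K j b c h),
        leftB_counit K j b c e h' h]
      rfl
    · rw [reassoc_of% (leftB_d _ j b c e h), reassoc_of% (leftB_counit K j b _ c h rfl)]
      exact (comp_comp_eq_zero (K.sIter j b _ rfl) ((K.page j).d_comp_d _ c e)).trans zero_comp.symm
    · rw [reassoc_of% (leftC_counit K j c), reassoc_of% (leftC_d _ j c e), leftC_counit]
      exact (Category.comp_id _).symm
  · rw [mkD_neg _ hc, (K.page j).shape _ _ hc, comp_zero, zero_comp]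

lemma leftCounitX_w (j : ℕ) (c : ℤ × ℤ) :
    K.leftCounitX (j + 1) c ≫ K.w j c = ((extend R).obj K).leftW j c ≫ K.leftCounitX j c := by
  refine leftX_hom_ext (fun b h => ?_) (fun b h => ?_) ?_
  · rw [reassoc_of% (leftA_counit K (j + 1) b c h), reassoc_of% (leftA_w _ j b c h)]
    exact (K.sIter_w j b c h).trans zero_comp.symm
  · rw [reassoc_of% (leftB_counit K (j + 1) b _ c h rfl), reassoc_of% (leftB_w _ j b c h),
      leftB_counit K j b _ c h rfl]
    exact K.sIter_d_w j b _ _ c rfl rfl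
  · rw [reassoc_of% (leftC_counit K (j + 1) c), reassoc_of% (leftC_w _ j c), leftC_counit]
    exact (Category.comp_id _).symm

lemma leftCounitX_s (j : ℕ) (c e : ℤ × ℤ) (h : c + (1, 1) = e) :
    K.leftCounitX j c ≫ K.s j c e h =
      ((extend R).obj K).leftS j c e h ≫ K.leftCounitX (j + 1) e := by
  refine leftX_hom_ext (fun b hb => ?_) (fun b hb => ?_) ?_
  · have hb' : b + (((j + 1 : ℕ) : ℤ), ((j + 1 : ℕ) : ℤ)) = e := by
      subst hb h
      ext <;> simp <;> ring
    rw [reassoc_of% (leftA_counit K j b c hb), reassoc_of% (leftA_s _ j b c e hb h hb'),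
      leftA_counit K (j + 1) b e hb']
    exact K.sIter_s _ _ _ _ _ _ hb'
  · rw [reassoc_of% (leftB_counit K j b _ c hb rfl), reassoc_of% (leftB_s _ j b c e hb h)]
    exact (comp_comp_eq_zero (K.sIter j b _ rfl) (K.d_s j _ c e h)).trans zero_comp.symm
  · rw [reassoc_of% (leftC_counit K j c), reassoc_of% (leftC_s _ j c e h), leftC_counit]
    exact (Category.comp_id _).symm

variable {K} in
lemma leftCounitX_naturality {K' : LWB R 1} (f : K ⟶ K') (j : ℕ) (c : ℤ × ℤ) :
    leftMap ((extend R).map f) j c ≫ K'.leftCounitX j c = K.leftCounitX j c ≫ (f.f j).f c := by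
  refine leftX_hom_ext (fun b h => ?_) (fun b h => ?_) ?_
  · rw [reassoc_of% (leftA_map ((extend R).map f) j b c h), leftA_counit,
      reassoc_of% (leftA_counit K j b c h)]
    exact (sIter_naturality f j b c h).symm
  · rw [reassoc_of% (leftB_map ((extend R).map f) j b c h), leftB_counit K' j b _ c h rfl,
      reassoc_of% (leftB_counit K j b _ c h rfl)]
    exact (sIter_d_naturality f j b _ c rfl).symm
  · rw [reassoc_of% (leftC_map ((extend R).map f) j c), leftC_counit,
      reassoc_of% (leftC_counit K j c)]
    exact Category.comp_id _

/-- The counit of the adjunction between `(𝒲_{≥ 1})_!` and `ℱ_{≥ 1}`. -/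
def leftCounit : (left R).obj ((extend R).obj K) ⟶ K where
  f j := { f := K.leftCounitX j, comm' c e _ := K.leftCounitX_d j c e }
  comm_w := K.leftCounitX_w
  comm_s := K.leftCounitX_s

/-- The generators `(a, 0, 0)` on all pages are iterated degeneracies of those on the first page,
which is the triangle identity on the first summand. -/
lemma leftA_zero_sIter (j : ℕ) (b c : ℤ × ℤ) (h : b + ((j : ℤ), (j : ℤ)) = c) :
    L.leftA 0 b b (by simp) ≫ ((left R).obj L).sIter j b c h = L.leftA j b c h := by
  induction j generalizing c with
  | zero =>
    obtain rfl : b = c := by rw [← h]; ext <;> simp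
    rw [sIter_zero]
    exact Category.comp_id _
  | succ j ih =>
    have h' : b + ((j : ℤ), (j : ℤ)) + (1, 1) = c := by
      subst h
      ext <;> simp <;> ring
    rw [← sIter_s _ j b _ c rfl h' h]
    refine (Category.assoc _ _ _).symm.trans ?_
    refine (congrArg (· ≫ ((left R).obj L).s j _ c h') (ih _ rfl)).trans ?_
    exact L.leftA_s j b _ c rfl h' h

variable (R) in
/-- The functor `(𝒲_{≥ 1})_!` is left adjoint to `ℱ_{≥ 1}`. -/
def leftExtendAdj : left R ⊣ extend R where
  unit :=
    { app := leftUnit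
      naturality L L' f := by
        ext i : 1
        rcases i with _ | i
        · ext b : 1
          exact (leftA_map f 0 b b (by simp)).symm
        · ext b : 1
          exact (leftC_map f i b).symm }
  counit :=
    { app := leftCounit
      naturality K K' f := by
        ext i : 1
        ext b : 1
        exact leftCounitX_naturality f i b }
  left_triangle_components L := by
    ext j : 1
    ext c : 1
    change leftMap L.leftUnit j c ≫ ((left R).obj L).leftCounitX j c = 𝟙 (L.leftX j c)
    refine leftX_hom_ext (fun b h => ?_) (fun b h => ?_) ?_
    · rw [reassoc_of% (leftA_map L.leftUnit j b c h)]
      refine Eq.trans ?_ (Category.comp_id _).symm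
      refine (congrArg (_ ≫ ·) (leftA_counit _ j b c h)).trans ?_
      exact L.leftA_zero_sIter j b c h
    -- A generator `(0, a, 0)` is the differential of the generator `(a, 0, 0)` (`leftA_d`), so this
    -- case follows from the previous one.
    · rw [reassoc_of% (leftB_map L.leftUnit j b c h)]
      refine Eq.trans ?_ (Category.comp_id _).symm
      refine (congrArg (_ ≫ ·) (leftB_counit _ j b _ c h rfl)).trans ?_
      refine (Category.assoc _ _ _).symm.trans ?_
      refine (congrArg (· ≫ _) (L.leftA_zero_sIter j b _ rfl)).trans ?_
      exact L.leftA_d j b _ c rfl h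
    · rw [reassoc_of% (leftC_map L.leftUnit j c)]
      refine Eq.trans ?_ (Category.comp_id _).symm
      refine (congrArg (_ ≫ ·) (leftC_counit _ j c)).trans ?_
      exact Category.comp_id _
  right_triangle_components K := by
    ext i : 1
    rcases i with _ | i
    · ext b : 1
      exact (leftA_counit K 0 b b (by simp)).trans (sIter_zero _ _ _)
    · ext b : 1
      exact leftC_counit K i b

variable (R) in
/-- The adjunction `𝒯⁻¹ (𝒲_{≥ 1})_! ⊣ ℱ_{≥ 1} 𝒯`. -/
def leftTransAdj : left R ⋙ transInv R 0 ⊣ extendTrans R :=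
  (leftExtendAdj R).comp (transEquivalence R 0).symm.toAdjunction

end Left

end LWB
end SpecSeq

namespace SpecSeq
variable {R : Type u} [CommRing R]

namespace LWB

/-! ### The left adjoints of the page functors -/

section Free

variable (L : LWB R 0)

/-- The iterated degeneracy map `s^{j+1}` from the page `0` to the page `j + 1`. -/
def sPowZero : ∀ (j : ℕ) (b c : ℤ × ℤ), b + ((j : ℤ) + 1, (j : ℤ) + 1) = c →
    ((L.page 0).X b ⟶ (L.page (j + 1)).X c)
  | 0, b, c, h => L.s 0 b c (by rw [← h]; simp)
  | j + 1, b, c, h => sPowZero j b (b + ((j : ℤ) + 1, (j : ℤ) + 1)) rfl ≫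
      L.s (j + 1) _ c (by subst h; ext <;> simp <;> ring)

lemma sPowZero_s (j : ℕ) (b c e : ℤ × ℤ) (h : b + ((j : ℤ) + 1, (j : ℤ) + 1) = c)
    (h' : c + (1, 1) = e) (h'' : b + (((j + 1 : ℕ) : ℤ) + 1, ((j + 1 : ℕ) : ℤ) + 1) = e) :
    L.sPowZero j b c h ≫ L.s (j + 1) c e h' = L.sPowZero (j + 1) b e h'' := by
  subst h
  rfl

lemma sPowZero_w (j : ℕ) (b c : ℤ × ℤ) (h : b + ((j : ℤ) + 1, (j : ℤ) + 1) = c) :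
    L.sPowZero j b c h ≫ L.w j c = 0 := by
  cases j with
  | zero => exact L.s_w _ _ _ _
  | succ j => rw [sPowZero, Category.assoc, L.s_w, comp_zero]

lemma d_sPowZero (j : ℕ) (a b c : ℤ × ℤ) (h : b + ((j : ℤ) + 1, (j : ℤ) + 1) = c) :
    (L.page 0).d a b ≫ L.sPowZero j b c h = 0 := by
  induction j generalizing c with
  | zero => exact L.d_s _ _ _ _ _
  | succ j ih => rw [sPowZero, ← Category.assoc, ih, zero_comp]

lemma sPowZero_d_w (j : ℕ) (b c c' e : ℤ × ℤ) (h : b + ((j : ℤ) + 1, (j : ℤ) + 1) = c)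
    (h' : b + (((j + 1 : ℕ) : ℤ) + 1, ((j + 1 : ℕ) : ℤ) + 1) = c') :
    L.sPowZero (j + 1) b c' h' ≫ (L.page (j + 1 + 1)).d c' e ≫ L.w (j + 1) e =
      L.sPowZero j b c h ≫ (L.page (j + 1)).d c e := by
  rw [← L.sPowZero_s j b c c' h (by subst h h'; ext <;> simp <;> ring) h', Category.assoc,
    L.s_d_w]

variable {L} in
lemma sPowZero_naturality {L' : LWB R 0} (f : L ⟶ L') (j : ℕ) (b c : ℤ × ℤ)
    (h : b + ((j : ℤ) + 1, (j : ℤ) + 1) = c) :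
    L.sPowZero j b c h ≫ (f.f (j + 1)).f c = (f.f 0).f b ≫ L'.sPowZero j b c h := by
  induction j generalizing c with
  | zero => exact (f.comm_s 0 b c _).symm
  | succ j ih => rw [sPowZero, sPowZero, Category.assoc, ← f.comm_s, ← Category.assoc, ih,
      Category.assoc]

/-- The map induced by `s^{j+1}` on the quotient by the boundaries. -/
def opS (j : ℕ) (b c : ℤ × ℤ) (h : b + ((j : ℤ) + 1, (j : ℤ) + 1) = c) :
    (L.page 0).opcycles b ⟶ (L.page (j + 1)).X c :=
  (L.page 0).descOpcycles (L.sPowZero j b c h) _ rfl (L.d_sPowZero j _ b c h)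

lemma p_opS (j : ℕ) (b c : ℤ × ℤ) (h : b + ((j : ℤ) + 1, (j : ℤ) + 1) = c) :
    (L.page 0).pOpcycles b ≫ L.opS j b c h = L.sPowZero j b c h :=
  (L.page 0).p_descOpcycles _ _ _ _

lemma opCast_opS (j : ℕ) (b b' c : ℤ × ℤ) (h : b' + ((j : ℤ) + 1, (j : ℤ) + 1) = c)
    (hb : b = b') : opCast _ hb ≫ L.opS j b' c h = L.opS j b c (hb ▸ h) := by
  subst hb
  simp [opCast]

/-- The map `(x, y) ↦ s^{j+1} x + d s^{j+1} y` defining the counit of the adjunction between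
`ℱ_[0]` and `𝒰_[0]`. -/
def freeCounitX (j : ℕ) (c : ℤ × ℤ) : freeX (L.page 0) j c ⟶ (L.page (j + 1)).X c :=
  biprod.desc (L.opS j _ c (sub_add_cancel _ _)) (L.opS j _ _ rfl ≫ (L.page (j + 1)).d _ c)

lemma freeCounitX_d (j : ℕ) (c e : ℤ × ℤ) :
    L.freeCounitX j c ≫ (L.page (j + 1)).d c e =
      mkD (j + 1) (freeD (L.page 0) j) c e ≫ L.freeCounitX j e := by
  by_cases hc : c + δ (j + 1) = e
  · rw [mkD_pos _ hc]
    have h : e + (0, -1) + ((j : ℤ) + 1, (j : ℤ) + 1) = c := by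
      subst hc
      ext <;> simp [δ] <;> ring
    apply biprod.hom_ext'
    · subst h
      simp [freeCounitX, freeD, reassoc_of% (@opCast_opS)]
    · simp [freeCounitX, freeD]
  · rw [mkD_neg _ hc, (L.page (j + 1)).shape _ _ hc, comp_zero, zero_comp]

lemma freeCounitX_w_zero (c : ℤ × ℤ) :
    L.freeCounitX 0 c ≫ L.w 0 c = freeWZero (L.page 0) c := by
  apply biprod.hom_ext'
  · rw [← cancel_epi ((L.page 0).pOpcycles _)]
    simp [freeCounitX, freeWZero, reassoc_of% (@p_opS), sPowZero_w]
  · rw [← cancel_epi ((L.page 0).pOpcycles _)]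
    simp [freeCounitX, freeWZero, reassoc_of% (@p_opS)]
    exact L.s_d_w _ _ _ _ _

lemma freeCounitX_w (j : ℕ) (c : ℤ × ℤ) :
    L.freeCounitX (j + 1) c ≫ L.w (j + 1) c = freeW (L.page 0) j c ≫ L.freeCounitX j c := by
  apply biprod.hom_ext'
  · rw [← cancel_epi ((L.page 0).pOpcycles _)]
    simp [freeCounitX, freeW, reassoc_of% (@p_opS), sPowZero_w]
  · rw [← cancel_epi ((L.page 0).pOpcycles _)]
    simp [freeCounitX, freeW, reassoc_of% (@p_opS)]
    exact L.sPowZero_d_w j _ _ _ _ _ _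

lemma freeCounitX_s (j : ℕ) (c e : ℤ × ℤ) (h : c + (1, 1) = e) :
    L.freeCounitX j c ≫ L.s (j + 1) c e h =
      freeS (L.page 0) j c e h ≫ L.freeCounitX (j + 1) e := by
  apply biprod.hom_ext'
  · rw [← cancel_epi ((L.page 0).pOpcycles _)]
    simp [freeCounitX, freeS, reassoc_of% (@p_opS), opCast_opS, p_opS]
    exact L.sPowZero_s _ _ _ _ _ _ _
  · simp [freeCounitX, freeS, L.d_s]

variable {L} in
lemma freeCounitX_naturality {L' : LWB R 0} (f : L ⟶ L') (j : ℕ) (c : ℤ × ℤ) :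
    freeXMap (f.f 0) j c ≫ L'.freeCounitX j c = L.freeCounitX j c ≫ (f.f (j + 1)).f c := by
  apply biprod.hom_ext'
  · rw [← cancel_epi ((L.page 0).pOpcycles _)]
    simp [freeCounitX, reassoc_of% (@p_opS), p_opS, sPowZero_naturality]
  · rw [← cancel_epi ((L.page 0).pOpcycles _)]
    simp [freeCounitX, reassoc_of% (@p_opS)]
    rw [← (f.f (j + 1)).comm, reassoc_of% (sPowZero_naturality f)]

/-- The counit of the adjunction between `ℱ_[0]` and `𝒰_[0]`. -/
def freeCounit : (freeZero R).obj (L.page 0) ⟶ L where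
  f i := match i with
    | 0 => 𝟙 (L.page 0)
    | i + 1 => { f := L.freeCounitX i, comm' b c _ := L.freeCounitX_d i b c }
  comm_w i b := match i with
    | 0 => (L.freeCounitX_w_zero b).trans (Category.comp_id _).symm
    | i + 1 => L.freeCounitX_w i b
  comm_s i b c h := match i with
    | 0 => (Category.id_comp _).trans (by
        change _ = freeSZero (L.page 0) b c h ≫ L.freeCounitX 0 c
        simp [freeSZero, freeCounitX, opCast_opS, p_opS]
        rfl)
    | i + 1 => L.freeCounitX_s i b c h

lemma opCast_inl_freeS (A : RBC R 0) (j : ℕ) (b c e : ℤ × ℤ) (h : c + (1, 1) = e)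
    (hb : b = c - ((j : ℤ) + 1, (j : ℤ) + 1))
    (hb' : b = e - (((j + 1 : ℕ) : ℤ) + 1, ((j + 1 : ℕ) : ℤ) + 1)) :
    (opCast A hb ≫ biprod.inl) ≫ freeS A j c e h = opCast A hb' ≫ biprod.inl := by
  simp [freeS, reassoc_of% (@opCast_opCast)]

lemma opCast_inl_freeD (A : RBC R 0) (j : ℕ) (b c e : ℤ × ℤ) (h : c + δ (j + 1) = e)
    (hb : b = c - ((j : ℤ) + 1, (j : ℤ) + 1)) (hb' : b = e + (0, -1)) :
    (opCast A hb ≫ biprod.inl) ≫ freeD A j c e h = opCast A hb' ≫ biprod.inr := by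
  simp [freeD, reassoc_of% (@opCast_opCast)]

lemma sPowZero_freeZero (A : RBC R 0) (j : ℕ) (b c : ℤ × ℤ)
    (h : b + ((j : ℤ) + 1, (j : ℤ) + 1) = c) :
    ((freeZero R).obj A).sPowZero j b c h =
      A.pOpcycles b ≫ opCast A (eq_sub_of_add_eq h) ≫ biprod.inl := by
  induction j generalizing c with
  | zero => rfl
  | succ j ih =>
    refine (congrArg (· ≫ freeS A j _ c (by subst h; ext <;> simp <;> ring)) (ih _ rfl)).trans ?_
    exact (Category.assoc _ _ _).trans
      (congrArg (A.pOpcycles b ≫ ·) (opCast_inl_freeS A j b _ c _ _ _))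

lemma opS_freeZero (A : RBC R 0) (j : ℕ) (b c : ℤ × ℤ)
    (h : b + ((j : ℤ) + 1, (j : ℤ) + 1) = c) :
    ((freeZero R).obj A).opS j b c h = opCast A (eq_sub_of_add_eq h) ≫ biprod.inl := by
  refine (cancel_epi (A.pOpcycles b)).1 ?_
  exact (p_opS _ _ _ _ _).trans (sPowZero_freeZero A j b c h)

/-- In a free book, the first summand is the image of the iterated degeneracy map and the
differential carries it identically onto the second summand. This is the essential triangle identity
for `ℱ_[0] ⊣ 𝒰_[0]`. -/
lemma freeCounitX_freeZero (A : RBC R 0) (j : ℕ) (c : ℤ × ℤ) :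
    ((freeZero R).obj A).freeCounitX j c = 𝟙 (freeX A j c) := by
  refine biprod.hom_ext' _ _ ?_ ?_
  · refine (biprod.inl_desc _ _).trans ((opS_freeZero A j _ c _).trans ?_)
    exact (Category.id_comp _).trans (Category.comp_id _).symm
  · refine (biprod.inr_desc _ _).trans ?_
    refine (congrArg (· ≫ mkD (j + 1) (freeD A j) _ c) (opS_freeZero A j _ _ rfl)).trans ?_
    rw [mkD_pos _ (by ext <;> simp [δ] <;> ring)]
    refine (opCast_inl_freeD A j _ _ c _ _ rfl).trans ?_
    exact (Category.id_comp _).trans (Category.comp_id _).symm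

variable (R) in
/-- The functor `ℱ_[0]` is left adjoint to `𝒰_[0]`. -/
def freeZeroAdj : freeZero R ⊣ pageFunctor R 0 where
  unit := { app A := 𝟙 A }
  counit :=
    { app := freeCounit
      naturality L L' f := by
        ext i : 1
        rcases i with _ | i
        · exact (Category.comp_id _).trans (Category.id_comp _).symm
        · ext c : 1
          exact freeCounitX_naturality f i c }
  left_triangle_components A := by
    ext i : 1
    rcases i with _ | i
    · exact Category.comp_id _
    · ext c : 1
      refine (congrArg (· ≫ _) (?_ : freeXMap (𝟙 A) i c = 𝟙 (freeX A i c))).trans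
        ((Category.id_comp _).trans (freeCounitX_freeZero A i c))
      apply biprod.hom_ext <;> simp
  right_triangle_components L := Category.comp_id _

variable (R) in
/-- The page `r` of `𝒯⁻¹ 𝒰_{≥ 1}` is the inverse translate of the page `r + 1`. -/
def transTruncPageIso (r : ℕ) :
    (transTrunc R ⋙ pageFunctor R r) ⋙ SpecSeq.trans R r ≅ pageFunctor R (r + 1) :=
  Functor.isoWhiskerLeft (pageFunctor R (r + 1)) (transCounitIso R r)

variable (R) in
/-- The functor `ℱ_[r]` is left adjoint to `𝒰_[r]`. -/
def freeAdj : ∀ r : ℕ, free R r ⊣ pageFunctor R r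
  | 0 => freeZeroAdj R
  -- By definition `ℱ_[r+1]` is `𝒯⁻¹` followed by `ℱ_[r]` and `ℱ_{≥ 1} 𝒯`. The composite of the
  -- right adjoints is only isomorphic to `𝒰_[r+1]`, since `𝒯 𝒯⁻¹` involves a transport of
  -- bidegrees.
  | r + 1 => ((SpecSeq.transEquivalence R r).symm.toAdjunction.comp
      ((freeAdj r).comp (extendTransAdj R))).ofNatIsoRight (transTruncPageIso R r)

variable (R) in
/-- The page `r` of `ℱ_[r] A` is `A`. -/
def freePageIso : ∀ r : ℕ, free R r ⋙ pageFunctor R r ≅ 𝟭 (RBC R r)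
  | 0 => Iso.refl _
  | r + 1 => Functor.isoWhiskerLeft (SpecSeq.transInv R r)
      (Functor.isoWhiskerRight (freePageIso r) (SpecSeq.trans R r)) ≪≫ transCounitIso R r

end Free

end LWB
end SpecSeq

namespace SpecSeq
variable {R : Type u} [CommRing R]

namespace LWB

/-! ### Elements of linear witness books -/

section Elements

variable {k : ℕ} (L : LWB R k)

lemma s_w_apply (i : ℕ) (b c : ℤ × ℤ) (h : b + (1, 1) = c) (x : (L.page i).X b) :
    L.w i c (L.s i b c h x) = 0 :=
  congrArg (fun φ => φ.hom x) (L.s_w i b c h)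

lemma s_d_w_apply (i : ℕ) (b c e : ℤ × ℤ) (h : b + (1, 1) = c) (x : (L.page i).X b) :
    L.w i e ((L.page (i + 1)).d c e (L.s i b c h x)) = (L.page i).d b e x :=
  congrArg (fun φ => φ.hom x) (L.s_d_w i b c e h)

lemma comm_w_apply {L L' : LWB R k} (f : L ⟶ L') (i : ℕ) (b : ℤ × ℤ) (x : (L.page (i + 1)).X b) :
    L'.w i b ((f.f (i + 1)).f b x) = (f.f i).f b (L.w i b x) :=
  congrArg (fun φ => φ.hom x) (f.comm_w i b)

lemma comm_s_apply {L L' : LWB R k} (f : L ⟶ L') (i : ℕ) (b c : ℤ × ℤ) (h : b + (1, 1) = c)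
    (x : (L.page i).X b) :
    L'.s i b c h ((f.f i).f b x) = (f.f (i + 1)).f c (L.s i b c h x) :=
  congrArg (fun φ => φ.hom x) (f.comm_s i b c h)

end Elements

section

variable (L : LWB R 0)

lemma w_d_apply (i : ℕ) (b c : ℤ × ℤ) (x : (L.page (i + 1)).X b) :
    (L.page i).d b c (L.w i b x) = 0 :=
  congrArg (fun φ => φ.hom x) (L.w_d i b c)

lemma s_mem_degen (r : ℕ) {a b : ℤ × ℤ} (h : a + (1, 1) = b) (y : (L.page r).X a) :
    L.s r a b h y ∈ L.degen (r + 1) b :=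
  Submodule.mem_sup_left (Submodule.mem_iSup_of_mem a (Submodule.mem_iSup_of_mem h ⟨y, rfl⟩))

lemma d_s_mem_degen (r : ℕ) {a c : ℤ × ℤ} (b : ℤ × ℤ) (h : a + (1, 1) = c) (y : (L.page r).X a) :
    (L.page (r + 1)).d c b (L.s r a c h y) ∈ L.degen (r + 1) b :=
  L.degen_le_comap_d (r + 1) c b (L.s_mem_degen r h y)

/-- The elements of `S_{r+1}` are those of the form `s y + d (s z)`. -/
lemma mem_degen_iff {r : ℕ} {a b a' c : ℤ × ℤ} (h : a + (1, 1) = b) (h' : a' + (1, 1) = c)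
    (hc : c + δ (r + 1) = b) (x : (L.page (r + 1)).X b) :
    x ∈ L.degen (r + 1) b ↔ ∃ (y : (L.page r).X a) (z : (L.page r).X a'),
      L.s r a b h y + (L.page (r + 1)).d c b (L.s r a' c h' z) = x := by
  constructor
  · intro hx
    obtain ⟨y, hy, z, hz, rfl⟩ := Submodule.mem_sup.1 hx
    have hy' : y ∈ LinearMap.range (L.s r a b h).hom := by
      -- The suprema defining `degen` range over all bidegrees, but at most one choice contributes:
      -- the source of `s` is determined by its target, and other sources of `d` give the zero map.
      refine (iSup₂_le fun e he => ?_ : _ ≤ LinearMap.range (L.s r a b h).hom) hy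
      obtain rfl : e = a := add_right_cancel (he.trans h.symm)
      exact le_rfl
    have hz' : z ∈ LinearMap.range (L.s r a' c h' ≫ (L.page (r + 1)).d c b).hom := by
      refine (iSup₂_le fun e e' => iSup_le fun he => ?_ : _ ≤ LinearMap.range
        (L.s r a' c h' ≫ (L.page (r + 1)).d c b).hom) hz
      by_cases hb : e' + δ (r + 1) = b
      · obtain rfl : e' = c := add_right_cancel (hb.trans hc.symm)
        obtain rfl : e = a' := add_right_cancel (he.trans h'.symm)
        exact le_rfl
      · rw [(L.page (r + 1)).shape _ _ hb, comp_zero]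
        rintro _ ⟨x, rfl⟩
        exact zero_mem _
    obtain ⟨y, rfl⟩ := hy'
    obtain ⟨z, rfl⟩ := hz'
    exact ⟨y, z, rfl⟩
  · rintro ⟨y, z, rfl⟩
    exact add_mem (L.s_mem_degen r h y) (L.d_s_mem_degen r b h' z)

lemma quotπ_surjective (r : ℕ) (b : ℤ × ℤ) : Function.Surjective ((L.quotπ r).f b) :=
  Submodule.mkQ_surjective _

lemma quotπ_eq_zero_iff (r : ℕ) (b : ℤ × ℤ) (x : (L.page r).X b) :
    (L.quotπ r).f b x = 0 ↔ x ∈ L.degen r b :=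
  Submodule.Quotient.mk_eq_zero _

lemma degen_eq_bot {r : ℕ} (h : ∀ b c h, L.s r b c h = 0) (b : ℤ × ℤ) : L.degen (r + 1) b = ⊥ := by
  refine le_bot_iff.1 (sup_le (iSup₂_le fun e he => ?_) (iSup₂_le fun e e' => iSup_le fun he => ?_))
  · rw [h]
    rintro _ ⟨x, rfl⟩
    rfl
  · rw [h, zero_comp]
    rintro _ ⟨x, rfl⟩
    rfl

end

end LWB

/-! ### The pages of the free linear witness books -/

section FreePages

lemma IsAcyclic.trans {r : ℕ} {A : RBC R r} (hA : IsAcyclic A) :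
    IsAcyclic ((SpecSeq.trans R r).obj A) := by
  intro b c h x hx
  have h₁ : τ b + δ r = τ c := by
    subst h
    simp only [τ, δ, Prod.ext_iff, Prod.fst_add, Prod.snd_add, Nat.cast_add, Nat.cast_one]
    omega
  refine hA (τ b) (τ c) h₁ x ?_
  have h₂ : τ (c + δ (r + 1)) = τ c + δ r := by
    simp only [τ, δ, Prod.ext_iff, Prod.fst_add, Prod.snd_add, Nat.cast_add, Nat.cast_one]
    omega
  rw [← h₂]
  exact hx

/-- The page is a cone with differential `(x, y) ↦ (0, x)`: a cycle has `x = 0` by `h₁`, and `(x, y)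
↦ (y, 0)` is a contraction on cycles by `h₂`. -/
lemma isAcyclic_freeZero (A : RBC R 0) (j : ℕ) :
    IsAcyclic (((freeZero R).obj A).page (j + 1)) := by
  intro b c h x hx
  have e₁ : b + δ (j + 1) = c := h
  have e₂ : c + (0, -1) = b - ((j : ℤ) + 1, (j : ℤ) + 1) := by
    subst h
    ext <;> simp [δ] <;> ring
  have e₃ : c + δ (j + 1) + (0, -1) = c - ((j : ℤ) + 1, (j : ℤ) + 1) := by
    ext <;> simp [δ] <;> ring
  have opCast_rfl {b : ℤ × ℤ} (h : b = b) : opCast A h = 𝟙 _ := rfl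
  have h₁ : freeD A j c _ rfl ≫ biprod.snd ≫ opCast A e₃ = biprod.fst := by
    simp [freeD, opCast_opCast, opCast_rfl]
  have h₂ : (biprod.snd ≫ opCast A e₂ ≫ biprod.inl) ≫ freeD A j b c e₁ =
      𝟙 (freeX A j c) - biprod.fst ≫ biprod.inl := by
    refine eq_sub_of_add_eq ((add_comm _ _).trans (Eq.trans ?_ biprod.total))
    simp [freeD, reassoc_of% (@opCast_opCast), opCast_rfl]
  have hx' : (mkD (j + 1) (freeD A j) c (c + δ (j + 1))).hom x = 0 := hx
  rw [mkD_pos _ rfl] at hx'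
  have hx'' : (biprod.fst : freeX A j c ⟶ _).hom x = 0 := by
    rw [← h₁]
    exact (congrArg (biprod.snd ≫ opCast A e₃).hom hx').trans (map_zero _)
  refine ⟨(biprod.snd ≫ opCast A e₂ ≫ biprod.inl : freeX A j c ⟶ freeX A j b).hom x, ?_⟩
  change (mkD (j + 1) (freeD A j) b c).hom _ = x
  rw [mkD_pos _ e₁]
  have h₃ (y : freeX A j c) (hy : (biprod.fst : freeX A j c ⟶ _).hom y = 0) :
      (𝟙 (freeX A j c) - biprod.fst ≫ biprod.inl).hom y = y := by
    simp [hy]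
  exact (congrArg (fun φ => φ.hom x) h₂).trans (h₃ x hx'')

/-- The pages after the page `i` of `ℱ_[i] A` are acyclic. -/
lemma isAcyclic_free {i j : ℕ} (A : RBC R i) (h : i ≤ j) :
    IsAcyclic (((free R i).obj A).page (j + 1)) := by
  induction i generalizing j with
  | zero => exact isAcyclic_freeZero A j
  | succ i ih =>
    obtain ⟨j, rfl⟩ : ∃ j', j = j' + 1 := ⟨j - 1, by omega⟩
    exact (ih ((transInv R i).obj A) (j := j) (by omega)).trans

/-- The degeneracy maps of `ℱ_[i] A` below the page `i` vanish. -/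
lemma free_s_eq_zero {i j : ℕ} (A : RBC R i) (hj : j < i) (b c : ℤ × ℤ) (h : b + (1, 1) = c) :
    ((free R i).obj A).s j b c h = 0 := by
  induction i generalizing j b c with
  | zero => omega
  | succ i ih =>
    rcases j with _ | j
    · rfl
    · exact ih ((transInv R i).obj A) (j := j) (by omega) (τ b) (τ c) (τ_diag h)

/-- The elements `(x, 0)` are values of `s` (`key`): from page `0` because `A ⟶ A / B(A)` is onto,
and from later pages because `s` is onto the first summand. The elements `(0, y)` are the
differentials of these, so everything lies in `s L + d s L`. -/
lemma mem_degen_freeZero (A : RBC R 0) (j : ℕ) (b : ℤ × ℤ) (x : freeX A j b) :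
    x ∈ ((freeZero R).obj A).degen (j + 1) b := by
  have key (j : ℕ) (b : ℤ × ℤ) (x : A.opcycles (b - ((j : ℤ) + 1, (j : ℤ) + 1))) :
      ∃ y : (((freeZero R).obj A).page j).X (b - (1, 1)),
        ((freeZero R).obj A).s j _ b (sub_add_cancel _ _) y =
          (biprod.inl : _ ⟶ freeX A j b).hom x := by
    rcases j with _ | j
    · have e : b - (((0 : ℕ) : ℤ) + 1, ((0 : ℕ) : ℤ) + 1) = b - (1, 1) := by simp
      obtain ⟨y, hy⟩ := (ModuleCat.epi_iff_surjective (A.pOpcycles (b - (1, 1)))).1 inferInstance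
        ((opCast A e).hom x)
      refine ⟨y, ?_⟩
      have h : opCast A e ≫ opCast A e.symm ≫ biprod.inl = (biprod.inl : _ ⟶ freeX A 0 b) := by
        rw [reassoc_of% (@opCast_opCast)]
        exact Category.id_comp _
      refine Eq.trans ?_ (congrArg (fun φ => φ.hom x) h)
      exact congrArg (opCast A e.symm ≫ (biprod.inl : _ ⟶ freeX A 0 b)).hom hy
    · have e : b - (((j + 1 : ℕ) : ℤ) + 1, ((j + 1 : ℕ) : ℤ) + 1) =
          b - (1, 1) - ((j : ℤ) + 1, (j : ℤ) + 1) := by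
        ext <;> simp <;> ring
      refine ⟨(opCast A e ≫ biprod.inl : _ ⟶ freeX A j (b - (1, 1))).hom x, ?_⟩
      have h : (opCast A e ≫ biprod.inl) ≫ freeS A j (b - (1, 1)) b (sub_add_cancel _ _) =
          biprod.inl := by
        simp only [freeS, Category.assoc, biprod.inl_fst_assoc, reassoc_of% (@opCast_opCast)]
        exact Category.id_comp _
      exact congrArg (fun φ => φ.hom x) h
  have ht := congrArg (fun φ => φ.hom x) (biprod.total (X := A.opcycles (b - ((j : ℤ) + 1, (j : ℤ) + 1))) (Y := A.opcycles (b + (0, -1))))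
  refine (congrArg (· ∈ ((freeZero R).obj A).degen (j + 1) b) ht).mp (add_mem ?_ ?_)
  · obtain ⟨y, hy⟩ := key j b ((biprod.fst : freeX A j b ⟶ _).hom x)
    have := ((freeZero R).obj A).s_mem_degen j (sub_add_cancel b (1, 1)) y
    rw [hy] at this
    exact this
  · have hc : b - δ (j + 1) + δ (j + 1) = b := sub_add_cancel _ _
    have e : b + (0, -1) = b - δ (j + 1) - ((j : ℤ) + 1, (j : ℤ) + 1) := by
      ext <;> simp [δ] <;> ring
    obtain ⟨y, hy⟩ := key j (b - δ (j + 1))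
      ((biprod.snd ≫ opCast A e : freeX A j b ⟶ _).hom x)
    have := ((freeZero R).obj A).d_s_mem_degen j b (sub_add_cancel (b - δ (j + 1)) (1, 1)) y
    rw [hy] at this
    have h : (biprod.snd ≫ opCast A e) ≫ biprod.inl ≫ mkD (j + 1) (freeD A j) _ b =
        (biprod.snd : freeX A j b ⟶ _) ≫ biprod.inr := by
      rw [mkD_pos _ hc]
      simp only [freeD, Category.assoc, biprod.inl_fst_assoc, reassoc_of% (@opCast_opCast)]
      exact congrArg (biprod.snd ≫ ·) (Category.id_comp _)
    exact (congrArg (· ∈ ((freeZero R).obj A).degen (j + 1) b)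
      (congrArg (fun φ => φ.hom x) h)).mp this

/-- From page `2` on, the structure maps into the pages of `ℱ_{≥ 1} 𝒯 L` are translates of those of
`L`. The form `s y + d (s z)` of degenerate elements translates directly, unlike the suprema over
bidegrees. -/
lemma mem_degen_extendTrans {L : LWB R 0} {j : ℕ} (h : ∀ b x, x ∈ L.degen (j + 1) b) (b : ℤ × ℤ)
    (x : (((LWB.extendTrans R).obj L).page (j + 1 + 1)).X b) :
    x ∈ ((LWB.extendTrans R).obj L).degen (j + 1 + 1) b := by
  have h₁ : b - δ (j + 1 + 1) + δ (j + 1 + 1) = b := sub_add_cancel _ _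
  have h₂ : τ (b - δ (j + 1 + 1)) + δ (j + 1) = τ b := by
    simp only [τ, δ, Prod.ext_iff, Prod.fst_add, Prod.snd_add, Prod.fst_sub, Prod.snd_sub,
      Nat.cast_add, Nat.cast_one]
    omega
  refine (LWB.mem_degen_iff _ (sub_add_cancel b (1, 1))
    (sub_add_cancel (b - δ (j + 1 + 1)) (1, 1)) h₁ x).2 ?_
  exact (L.mem_degen_iff (τ_diag (sub_add_cancel b (1, 1)))
    (τ_diag (sub_add_cancel (b - δ (j + 1 + 1)) (1, 1))) h₂ x).1 (h (τ b) x)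

/-- All the elements of the pages after the page `i` of `ℱ_[i] A` are degenerate. -/
lemma mem_degen_free {i j : ℕ} (A : RBC R i) (hj : i ≤ j) (b : ℤ × ℤ)
    (x : (((free R i).obj A).page (j + 1)).X b) : x ∈ ((free R i).obj A).degen (j + 1) b := by
  induction i generalizing j b with
  | zero => exact mem_degen_freeZero A j b x
  | succ i ih =>
    obtain ⟨j, rfl⟩ : ∃ j', j = j' + 1 := ⟨j - 1, by omega⟩
    exact mem_degen_extendTrans (fun b x => ih ((transInv R i).obj A) (j := j) (by omega) b x) b x

end FreePages

end SpecSeq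

namespace SpecSeq
variable {R : Type u} [CommRing R]

/-! ### The pages of `N(X)` -/

namespace ESpSe

variable (X : ESpSe R)

lemma nerveD_val {r : ℕ} {b c : ℤ × ℤ} (h : b + δ r = c) (x : X.nerveX r b) :
    (((N R).obj X).page r).d b c x = X.nerveD r b c h x :=
  congrArg (fun φ : ModuleCat.of R (X.nerveX r b) ⟶ ModuleCat.of R (X.nerveX r c) => φ.hom x)
    (mkD_pos (X := fun b => ModuleCat.of R (X.nerveX r b))
      (fun b c h => ModuleCat.ofHom (X.nerveD r b c h)) h)

/-- The projection `(x; y) ↦ x_r` from `N(X)_r` to `X_r`. -/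
def top (r : ℕ) : ((N R).obj X).page r ⟶ X.page r where
  f b := ModuleCat.ofHom (LinearMap.proj r ∘ₗ LinearMap.fst R _ _ ∘ₗ (X.nerveX r b).subtype)
  comm' b c h := by
    obtain rfl : b + δ r = c := h
    refine ModuleCat.hom_ext (LinearMap.ext fun x => ?_)
    obtain ⟨x, h₁, h₂, h₃⟩ := x
    refine h₃.trans ?_
    refine Eq.trans ?_ (congrArg (fun z : X.nerveX r (b + δ r) => z.1.1 r)
      (X.nerveD_val rfl ⟨x, h₁, h₂, h₃⟩)).symm
    change _ = X.castSeq rfl x.2 r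
    rw [castSeq_rfl]
    rfl

variable {X} in
/-- A compatible sequence can be extended by one element. -/
lemma update_mem_compatible {r : ℕ} {b : ℤ × ℤ} {x : ∀ i : ℕ, (X.page i).X b}
    (hx : x ∈ X.compatible r b) (a : (X.page (r + 1)).X b) (z : (X.page r).cycles b)
    (hz : (X.page r).iCycles b z = x r) (hz' : (X.page r).homologyπ b z = X.char r b a) :
    Function.update x (r + 1) a ∈ X.compatible (r + 1) b := by
  refine ⟨fun i hi => ?_, fun i hi => ?_⟩
  · rcases Nat.lt_succ_iff_lt_or_eq.1 hi with hi' | rfl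
    · obtain ⟨t, ht, ht'⟩ := hx.1 i hi'
      refine ⟨t, ?_, ?_⟩
      · rw [ht, Function.update_of_ne (by omega)]
      · rw [ht', Function.update_of_ne (by omega)]
    · refine ⟨z, ?_, ?_⟩
      · rw [hz, Function.update_of_ne (by omega)]
      · rw [hz', Function.update_self]
  · rw [Function.update_of_ne (by omega), hx.2 i (by omega)]

/-- The sequence is built downwards: a cycle representing the image of the last entry under the
characteristic map serves as the previous entry, and so on. -/
lemma exists_compatible (r : ℕ) {b : ℤ × ℤ} (a : (X.page r).X b) :
    ∃ x ∈ X.compatible r b, x r = a := by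
  induction r with
  | zero =>
    refine ⟨Function.update 0 0 a, ⟨fun i hi => by omega, fun i hi => ?_⟩, Function.update_self _ _ _⟩
    rw [Function.update_of_ne (by omega)]
    rfl
  | succ r ih =>
    obtain ⟨z, hz⟩ := homologyπ_surjective (X.page r) b (X.char r b a)
    obtain ⟨x, hx, hx'⟩ := ih ((X.page r).iCycles b z)
    exact ⟨_, update_mem_compatible hx a z hx'.symm hz, Function.update_self _ _ _⟩

lemma exists_nerve (r : ℕ) {b : ℤ × ℤ} {x : ∀ i : ℕ, (X.page i).X b} (hx : x ∈ X.compatible r b) :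
    ∃ y : X.nerveX r b, y.1.1 = x := by
  obtain ⟨y, hy, hy'⟩ := X.exists_compatible r ((X.page r).d b (b + δ r) (x r))
  exact ⟨⟨(x, y), hx, hy, hy'.symm⟩, rfl⟩

lemma surjective_top (r : ℕ) : surjective R r (X.top r) := by
  intro b a
  obtain ⟨x, hx, rfl⟩ := X.exists_compatible r a
  obtain ⟨y, hy⟩ := X.exists_nerve r hx
  exact ⟨y, congrFun hy r⟩

/-- A cycle `(x; y)` has `y = 0`. If it lies in the kernel then `x_r = 0 = d 0`, so `(0; x)` is an
element of the kernel, and its differential is `(x; 0)`. -/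
lemma quasiIsos_top (r : ℕ) : quasiIsos R r (X.top r) := by
  refine quasiIsos_of_surjective _ (X.surjective_top r) ?_
  rintro b c rfl ⟨⟨x, y⟩, hx, hy, hxy⟩ h₀ h₁
  have hx₀ : x r = 0 := h₀
  have hy₀ : y = 0 := by
    have := congrArg (fun z : X.nerveX r (b + δ r + δ r) => z.1.1) (X.nerveD_val rfl ⟨(x, y), hx, hy, hxy⟩)
    have h₂ : X.castSeq rfl y = 0 := this.symm.trans (congrArg (fun z : X.nerveX r (b + δ r + δ r) => z.1.1) h₁)
    rwa [castSeq_rfl] at h₂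
  subst hy₀
  refine ⟨⟨(0, x), zero_mem _, hx, (map_zero _).trans hx₀.symm⟩, rfl, ?_⟩
  refine (X.nerveD_val rfl _).trans (Subtype.ext (Prod.ext ?_ rfl))
  change X.castSeq rfl x = x
  rw [castSeq_rfl]
  rfl

/-- A compatible sequence ending with zero can be shortened, and then ends with a boundary. -/
lemma compatible_of_succ_eq_zero {r : ℕ} {b c : ℤ × ℤ} (h : b + δ r = c)
    {x : ∀ i : ℕ, (X.page i).X c}
    (hx : x ∈ X.compatible (r + 1) c) (h₀ : x (r + 1) = 0) :
    x ∈ X.compatible r c ∧ ∃ a : (X.page r).X b, (X.page r).d b c a = x r := by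
  refine ⟨⟨fun i hi => hx.1 i (by omega), fun i hi => ?_⟩, ?_⟩
  · rcases Nat.lt_iff_add_one_le.1 hi |>.eq_or_lt with rfl | hi'
    · exact h₀
    · exact hx.2 i hi'
  · obtain ⟨z, hz, hz'⟩ := hx.1 r (by omega)
    rw [h₀, map_zero, homologyπ_eq_zero_iff _ h] at hz'
    rwa [hz] at hz'

/-- For an element `(0; y)` the last entry `y_{r+1} = d 0` is zero, so `y_r` is a boundary `d e`.
Extending `e` downwards to a compatible sequence `u` gives `(u; y_0, …, y_r)`, which `s` sends to
`(0; y)`. -/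
lemma exists_nerveS_eq {r : ℕ} {a b : ℤ × ℤ} (h : a + (1, 1) = b) (x : X.nerveX (r + 1) b)
    (hx : ∀ i, x.1.1 i = 0) : ∃ y : X.nerveX r a, X.nerveS r a b h y = x := by
  obtain ⟨⟨x, y⟩, hx₁, hy, hxy⟩ := x
  obtain rfl : x = 0 := funext hx
  have hy₀ : y (r + 1) = 0 := by
    refine hxy.symm.trans ?_
    exact map_zero _
  have hab : b + δ (r + 1) = a + δ r := ((δ_succ h).1 rfl).symm ▸ rfl
  obtain ⟨hy₁, e, he⟩ := X.compatible_of_succ_eq_zero (b := a) hab.symm hy hy₀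
  obtain ⟨u, hu, rfl⟩ := X.exists_compatible r e
  refine ⟨⟨(u, X.castSeq hab y), hu, castSeq_mem _ hy₁, ?_⟩, ?_⟩
  · rw [← (X.page r).d_comp_XIsoOfEq_hom hab a]
    exact congrArg ((X.page r).XIsoOfEq hab).hom.hom he
  · refine Subtype.ext (Prod.ext rfl ?_)
    exact X.castSeq_castSeq _ _ y

/-- If `x_r = 0`, then `ζ = (0; x)` is an element with `d ζ = (x; 0)`. Both `ζ` and `(x; y) - d ζ`
have zero first sequence, so they are values of `s`. On page `0` the projection is injective because
`y_0 = d x_0`. Consequently the quotient `Q N X` is `X`. -/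
lemma top_eq_zero_iff (r : ℕ) (b : ℤ × ℤ) (x : (((N R).obj X).page r).X b) :
    (X.top r).f b x = 0 ↔ x ∈ ((N R).obj X).degen r b := by
  have h₁ : (X.top r).f b x = 0 ↔ x.1.1 r = 0 := Iff.rfl
  rcases r with _ | r
  · refine Iff.trans ?_ (Submodule.mem_bot R).symm
    rw [h₁]
    refine ⟨fun h => nerve_ext X (fun i => ?_) (fun i => ?_), fun h => by rw [h]; rfl⟩
    · rcases i with _ | i
      · exact h
      · exact x.2.1.2 _ (by omega)
    · rcases i with _ | i
      · refine x.2.2.2.symm.trans ?_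
        rw [h]
        exact map_zero _
      · exact x.2.2.1.2 _ (by omega)
  · have hb : b - δ (r + 1) + δ (r + 1) = b := sub_add_cancel _ _
    rw [LWB.mem_degen_iff _ (sub_add_cancel b (1, 1)) (sub_add_cancel (b - δ (r + 1)) (1, 1)) hb]
    constructor
    · intro h
      let x' : X.nerveX (r + 1) b := x
      let ζ : X.nerveX (r + 1) (b - δ (r + 1)) := ⟨(0, X.castSeq hb.symm x.1.1), zero_mem _,
        castSeq_mem _ x.2.1, (map_zero _).trans
          ((congrArg ((X.page (r + 1)).XIsoOfEq hb.symm).hom.hom (h₁.1 h)).trans (map_zero _)).symm⟩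
      obtain ⟨z, hz⟩ := X.exists_nerveS_eq (sub_add_cancel (b - δ (r + 1)) (1, 1)) ζ fun _ => rfl
      have hx : (X.nerveD (r + 1) _ b hb ζ).1.1 = x.1.1 := X.castSeq_castSeq hb.symm hb x.1.1
      obtain ⟨y, hy⟩ := X.exists_nerveS_eq (sub_add_cancel b (1, 1))
        (x' - X.nerveD (r + 1) _ b hb ζ) (fun i => by
          refine Eq.trans ?_ (sub_self (x.1.1 i))
          exact congrArg (fun t => x.1.1 i - t i) hx)
      refine ⟨y, z, ?_⟩
      have e : (((N R).obj X).page (r + 1)).d _ b (((N R).obj X).s r _ _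
          (sub_add_cancel (b - δ (r + 1)) (1, 1)) z) = X.nerveD (r + 1) _ b hb ζ := by
        rw [← hz]
        exact X.nerveD_val hb _
      rw [e]
      refine (congrArg (· + X.nerveD (r + 1) _ b hb ζ) hy).trans ?_
      exact sub_add_cancel x' _
    · rintro ⟨y, z, rfl⟩
      rw [map_add, comm_apply]
      have e₁ : (X.top (r + 1)).f b (((N R).obj X).s r _ b (sub_add_cancel b (1, 1)) y) = 0 := rfl
      have e₂ : (X.top (r + 1)).f _ (((N R).obj X).s r _ _
        (sub_add_cancel (b - δ (r + 1)) (1, 1)) z) = 0 := rfl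
      rw [e₁, e₂, map_zero]
      exact add_zero (0 : (X.page (r + 1)).X b)

variable {X}

lemma top_naturality {Y : ESpSe R} (f : X ⟶ Y) (r : ℕ) :
    ((N R).map f).f r ≫ Y.top r = X.top r ≫ f.f r := by
  ext b x
  rfl

/-- The functor `N` creates weak equivalences. -/
lemma quasiIsos_N_map_iff {Y : ESpSe R} (f : X ⟶ Y) (r : ℕ) :
    quasiIsos R r (((N R).map f).f r) ↔ quasiIsos R r (f.f r) := by
  rw [← (quasiIsos R r).postcomp_iff (W' := quasiIsos R r) _ _ (Y.quasiIsos_top r), top_naturality,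
    (quasiIsos R r).precomp_iff (W' := quasiIsos R r) _ _ (X.quasiIsos_top r)]

/-- Compatible sequences with given last element can be lifted along morphisms which are surjective
on pages. -/
lemma exists_compatible_lift {Y : ESpSe R} (f : X ⟶ Y) (r : ℕ)
    (hf : ∀ i < r, surjective R i (f.f i)) {b : ℤ × ℤ} {y : ∀ i : ℕ, (Y.page i).X b}
    (hy : y ∈ Y.compatible r b) (a : (X.page r).X b) (ha : (f.f r).f b a = y r) :
    ∃ x ∈ X.compatible r b, mapSeq f b x = y ∧ x r = a := by
  induction r generalizing y with
  | zero =>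
    refine ⟨Function.update 0 0 a, ⟨fun i hi => by omega, fun i hi => ?_⟩, funext fun i => ?_,
      Function.update_self _ _ _⟩
    · rw [Function.update_of_ne (by omega)]
      rfl
    · rcases i with _ | i
      · have e : Function.update (0 : ∀ i : ℕ, (X.page i).X b) 0 a 0 = a := Function.update_self _ _ _
        exact (congrArg ((f.f 0).f b).hom e).trans ha
      · rw [hy.2 _ (by omega)]
        have e : Function.update (0 : ∀ i : ℕ, (X.page i).X b) 0 a (i + 1) = 0 :=
          Function.update_of_ne (by omega) _ _
        exact (congrArg ((f.f (i + 1)).f b).hom e).trans (map_zero _)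
  | succ r ih =>
    obtain ⟨t, ht, ht'⟩ := hy.1 r (by omega)
    -- The image of `z` and the prescribed cycle `t` over `y r` represent the same class, hence
    -- differ by a boundary `d v`. Lifting `v` along the surjection `f_r` corrects `z` to a cycle of
    -- the same class lying exactly over `y r`.
    obtain ⟨z, hz⟩ := homologyπ_surjective (X.page r) b (X.char r b a)
    have hb : b - δ r + δ r = b := sub_add_cancel _ _
    have h₁ : (Y.page r).homologyπ b (HomologicalComplex.cyclesMap (f.f r) b z - t) = 0 := by
      rw [map_sub, ht', ← ha, ← homologyMap_homologyπ_apply, hz, sub_eq_zero]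
      exact (congrArg (fun φ => φ.hom a) (f.comm r b)).symm
    rw [homologyπ_eq_zero_iff _ hb] at h₁
    obtain ⟨v, hv⟩ := h₁
    obtain ⟨v, rfl⟩ := hf r (by omega) _ v
    let z' : (X.page r).cycles b := z - (X.page r).toCycles _ b v
    have hz' : (X.page r).homologyπ b z' = X.char r b a := by
      rw [map_sub, hz, sub_eq_self]
      exact congrArg (fun φ => φ.hom v) ((X.page r).toCycles_comp_homologyπ (b - δ r) b)
    have h₂ : (X.page r).iCycles b ((X.page r).toCycles (b - δ r) b v) = (X.page r).d _ b v :=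
      congrArg (fun φ => φ.hom v) ((X.page r).toCycles_i (b - δ r) b)
    have h₃ : (f.f r).f b ((X.page r).iCycles b z') = y r := by
      rw [map_sub, map_sub, h₂, comm_apply, hv, map_sub, iCycles_cyclesMap_apply, ← ht]
      abel
    -- Sequences are extended by zero, so the last entry must be cleared before the induction
    -- hypothesis applies.
    have hy' : Function.update y (r + 1) 0 ∈ Y.compatible r b := by
      refine ⟨fun i hi => ?_, fun i hi => ?_⟩
      · obtain ⟨t, ht, ht'⟩ := hy.1 i (by omega)
        refine ⟨t, ?_, ?_⟩
        · rw [ht, Function.update_of_ne (by omega)]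
        · rw [ht', Function.update_of_ne (by omega)]
      · rcases (Nat.lt_iff_add_one_le.1 hi).eq_or_lt with rfl | hi'
        · exact Function.update_self _ _ _
        · rw [Function.update_of_ne (by omega), hy.2 _ hi']
    obtain ⟨x, hx, hxy, hxr⟩ := ih (fun i hi => hf i (by omega)) hy' _
      (h₃.trans (Function.update_of_ne (by omega) _ _).symm)
    refine ⟨_, update_mem_compatible hx a z' hxr.symm hz', funext fun i => ?_,
      Function.update_self _ _ _⟩
    by_cases hi : i = r + 1
    · subst hi
      have e : Function.update x (r + 1) a (r + 1) = a := Function.update_self _ _ _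
      exact (congrArg ((f.f (r + 1)).f b).hom e).trans ha
    · have e : Function.update x (r + 1) a i = x i := Function.update_of_ne hi _ _
      refine (congrArg ((f.f i).f b).hom e).trans ?_
      exact (congrFun hxy i).trans (Function.update_of_ne hi _ _)

/-- The functor `N` creates fibrations. -/
lemma surjective_N_map_iff {Y : ESpSe R} (f : X ⟶ Y) (r : ℕ) :
    (∀ i ≤ r, surjective R i (((N R).map f).f i)) ↔ ∀ i ≤ r, surjective R i (f.f i) := by
  constructor
  · intro h i hi b y
    obtain ⟨y, rfl⟩ := Y.surjective_top i b y
    obtain ⟨x, rfl⟩ := h i hi b y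
    exact ⟨(X.top i).f b x, rfl⟩
  · rintro h i hi b ⟨⟨y, y'⟩, hy, hy', hyy⟩
    obtain ⟨a, ha⟩ := h i hi b (y i)
    obtain ⟨x, hx, rfl, rfl⟩ := exists_compatible_lift f i (fun j hj => h j (by omega)) hy a ha
    -- The last entry of the second sequence is forced to be `d x_i`; this is why the lifting lemma
    -- prescribes the last entry and needs surjectivity only on the earlier pages.
    obtain ⟨x', hx', rfl, hxx⟩ := exists_compatible_lift f i (fun j hj => h j (by omega)) hy'
      ((X.page i).d b _ (x i)) ((comm_apply _ _ _ _).trans hyy)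
    exact ⟨⟨(x, x'), hx, hx', hxx.symm⟩, rfl⟩

end ESpSe
end SpecSeq

namespace SpecSeq
variable {R : Type u} [CommRing R]

/-! ### The functor `Q` is left adjoint to the functor `N` -/

namespace ESpSe

variable (X : ESpSe R)

lemma castSeq_rfl_apply {b : ℤ × ℤ} (h : b = b) (x : ∀ i : ℕ, (X.page i).X b) :
    X.castSeq h x = x := by
  rw [castSeq_rfl]
  rfl

lemma truncSeq_of_le {r i : ℕ} (h : i ≤ r) (b : ℤ × ℤ) (x : ∀ i : ℕ, (X.page i).X b) :
    X.truncSeq r b x i = x i := by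
  simp [truncSeq, h]

lemma truncSeq_of_lt {r i : ℕ} (h : r < i) (b : ℤ × ℤ) (x : ∀ i : ℕ, (X.page i).X b) :
    X.truncSeq r b x i = 0 := by
  simp [truncSeq, not_le.2 h]

end ESpSe

namespace LWB

variable (L : LWB R 0)

/-- The sequence with one nonzero entry. -/
def quotSingle (i : ℕ) (b : ℤ × ℤ) : (L.quotPage i).X b →ₗ[R] ∀ i : ℕ, (L.quotPage i).X b :=
  LinearMap.single R (fun i : ℕ => (L.quotPage i).X b) i

lemma quotSingle_self (i : ℕ) (b : ℤ × ℤ) (x : (L.quotPage i).X b) : L.quotSingle i b x i = x :=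
  Pi.single_eq_same (M := fun i : ℕ => (L.quotPage i).X b) i x

lemma quotSingle_of_ne {i j : ℕ} (h : j ≠ i) (b : ℤ × ℤ) (x : (L.quotPage i).X b) :
    L.quotSingle i b x j = 0 :=
  Pi.single_eq_of_ne (M := fun i : ℕ => (L.quotPage i).X b) h x

/-- The sequence `([w^r a], …, [w a], [a], 0, …)` of an element `a` of the page `r`. -/
def seq : ∀ (r : ℕ) (b : ℤ × ℤ), (L.page r).X b →ₗ[R] ∀ i : ℕ, (L.quotPage i).X b
  | 0, b => L.quotSingle 0 b ∘ₗ ((L.quotπ 0).f b).hom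
  | r + 1, b => seq r b ∘ₗ (L.w r b).hom + L.quotSingle (r + 1) b ∘ₗ ((L.quotπ (r + 1)).f b).hom

lemma seq_succ_apply (r i : ℕ) (b : ℤ × ℤ) (a : (L.page (r + 1)).X b) :
    L.seq (r + 1) b a i =
      L.seq r b (L.w r b a) i + L.quotSingle (r + 1) b ((L.quotπ (r + 1)).f b a) i :=
  rfl

lemma seq_of_lt {r i : ℕ} (h : r < i) (b : ℤ × ℤ) (a : (L.page r).X b) : L.seq r b a i = 0 := by
  induction r with
  | zero => exact L.quotSingle_of_ne (by omega) b _
  | succ r ih =>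
    rw [seq_succ_apply, ih (by omega), quotSingle_of_ne _ (by omega), add_zero]

lemma seq_self (r : ℕ) (b : ℤ × ℤ) (a : (L.page r).X b) : L.seq r b a r = (L.quotπ r).f b a := by
  cases r with
  | zero => exact L.quotSingle_self 0 b ((L.quotπ 0).f b a)
  | succ r => rw [seq_succ_apply, seq_of_lt _ (Nat.lt_succ_self r), quotSingle_self, zero_add]

lemma seq_succ (r i : ℕ) (h : i ≤ r) (b : ℤ × ℤ) (a : (L.page (r + 1)).X b) :
    L.seq (r + 1) b a i = L.seq r b (L.w r b a) i := by
  rw [seq_succ_apply, quotSingle_of_ne _ (by omega), add_zero]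

/-- The characteristic map of `Q L` sends `[a]` to the class of the cycle `[w a]`, which is exactly
the previous entry. -/
lemma seq_mem (r : ℕ) (b : ℤ × ℤ) (a : (L.page r).X b) :
    L.seq r b a ∈ ((Q R).obj L).compatible r b := by
  induction r with
  | zero => exact ⟨fun i hi => by omega, fun i hi => L.seq_of_lt hi b a⟩
  | succ r ih =>
    have e : L.seq (r + 1) b a =
        Function.update (L.seq r b (L.w r b a)) (r + 1) ((L.quotπ (r + 1)).f b a) := by
      funext i
      rcases lt_trichotomy i (r + 1) with hi | rfl | hi
      · rw [Function.update_of_ne hi.ne]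
        exact L.seq_succ r i (by omega) b a
      · rw [Function.update_self]
        exact L.seq_self _ _ _
      · rw [Function.update_of_ne hi.ne', L.seq_of_lt hi, L.seq_of_lt (by omega)]
    rw [e]
    refine ESpSe.update_mem_compatible (ih (L.w r b a)) _
      ((L.quotPage r).liftCycles (L.w r b ≫ (L.quotπ r).f b) _ rfl (L.w_quotπ_d r b _) a) ?_ ?_
    · refine Eq.trans ?_ (L.seq_self r b (L.w r b a)).symm
      exact congrArg (fun φ => φ.hom a) ((L.quotPage r).liftCycles_i _ _ rfl (L.w_quotπ_d r b _))
    · rfl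

variable {L} in
lemma seq_map {L' : LWB R 0} (f : L ⟶ L') (r : ℕ) (b : ℤ × ℤ) (a : (L.page r).X b) :
    L'.seq r b ((f.f r).f b a) = ESpSe.mapSeq ((Q R).map f) b (L.seq r b a) := by
  induction r with
  | zero =>
    funext i
    rcases i with _ | i
    · refine (L'.seq_self _ _ _).trans ?_
      exact (congrArg (((quotMap f 0).f b).hom) (L.seq_self 0 b a)).symm
    · rw [L'.seq_of_lt (by omega)]
      refine Eq.trans ?_ (congrArg (((quotMap f (i + 1)).f b).hom) (L.seq_of_lt (by omega) b a)).symm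
      exact (map_zero _).symm
  | succ r ih =>
    funext i
    rcases lt_trichotomy i (r + 1) with hi | rfl | hi
    · rw [L'.seq_succ r i (by omega), comm_w_apply, ih]
      exact (congrArg (((quotMap f i).f b).hom) (L.seq_succ r i (by omega) b a)).symm
    · refine (L'.seq_self _ _ _).trans ?_
      exact (congrArg (((quotMap f (r + 1)).f b).hom) (L.seq_self (r + 1) b a)).symm
    · rw [L'.seq_of_lt (by omega)]
      refine Eq.trans ?_ (congrArg (((quotMap f i).f b).hom) (L.seq_of_lt (by omega) b a)).symm
      exact (map_zero _).symm

/-- The map `a ↦ (seq a; seq (d a))` in one bidegree. -/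
def nerveUnitX (r : ℕ) (b : ℤ × ℤ) : (L.page r).X b →ₗ[R] ((Q R).obj L).nerveX r b :=
  LinearMap.codRestrict _ (LinearMap.prod (L.seq r b)
    (L.seq r (b + δ r) ∘ₗ ((L.page r).d b (b + δ r)).hom)) fun a =>
      ⟨L.seq_mem r b a, L.seq_mem r _ _, by
        refine (congrArg ((L.quotPage r).d b (b + δ r)).hom (L.seq_self r b a)).trans ?_
        exact (comm_apply (L.quotπ r) b (b + δ r) a).symm.trans (L.seq_self r _ _).symm⟩

/-- The unit of the adjunction between `Q` and `N`. -/
def nerveUnit : L ⟶ (N R).obj ((Q R).obj L) where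
  f r :=
    { f b := ModuleCat.ofHom (L.nerveUnitX r b)
      comm' b c h := by
        obtain rfl : b + δ r = c := h
        refine ModuleCat.hom_ext (LinearMap.ext fun a => ?_)
        refine (ESpSe.nerveD_val _ rfl (L.nerveUnitX r b a)).trans (Subtype.ext (Prod.ext ?_ ?_))
        · exact ((Q R).obj L).castSeq_rfl_apply rfl (L.seq r _ ((L.page r).d b (b + δ r) a))
        · change 0 = L.seq r _ ((L.page r).d _ _ ((L.page r).d _ _ a))
          rw [d_apply_zero, map_zero] }
  comm_w r b := by
    refine ModuleCat.hom_ext (LinearMap.ext fun a => Subtype.ext (Prod.ext (funext fun i => ?_) ?_))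
    · change ((Q R).obj L).truncSeq r b (L.seq (r + 1) b a) i = L.seq r b (L.w r b a) i
      rcases le_or_gt i r with hi | hi
      · rw [← L.seq_succ r i hi]
        exact ESpSe.truncSeq_of_le _ hi _ _
      · rw [L.seq_of_lt hi]
        exact ESpSe.truncSeq_of_lt _ hi _ _
    · change 0 = L.seq r _ ((L.page r).d _ _ (L.w r b a))
      rw [w_d_apply, map_zero]
  comm_s r b c h := by
    refine ModuleCat.hom_ext (LinearMap.ext fun a => Subtype.ext (Prod.ext (funext fun i => ?_) ?_))
    · change 0 = L.seq (r + 1) c (L.s r b c h a) i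
      rcases lt_trichotomy i (r + 1) with hi | rfl | hi
      · rw [L.seq_succ r i (by omega), s_w_apply, map_zero]
        rfl
      · rw [L.seq_self]
        exact ((L.quotπ_eq_zero_iff _ _ _).2 (L.s_mem_degen r h a)).symm
      · rw [L.seq_of_lt hi]
    · have e : b + δ r = c + δ (r + 1) := (δ_succ h).1 rfl ▸ rfl
      change ((Q R).obj L).castSeq e (L.seq r (b + δ r) ((L.page r).d b (b + δ r) a)) =
        L.seq (r + 1) (c + δ (r + 1)) ((L.page (r + 1)).d c _ (L.s r b c h a))
      -- Making the target bidegree a variable lets the transport disappear.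
      generalize c + δ (r + 1) = c' at e
      subst e
      refine (ESpSe.castSeq_rfl_apply _ rfl _).trans ?_
      funext i
      rcases lt_trichotomy i (r + 1) with hi | rfl | hi
      · rw [L.seq_succ r i (by omega), s_d_w_apply]
      · rw [L.seq_self, L.seq_of_lt (by omega)]
        exact ((L.quotπ_eq_zero_iff _ _ _).2 (L.d_s_mem_degen r _ h a)).symm
      · rw [L.seq_of_lt hi, L.seq_of_lt (by omega)]

end LWB

namespace ESpSe

variable (X : ESpSe R)

lemma degen_le_ker_top (r : ℕ) (b : ℤ × ℤ) :
    ((N R).obj X).degen r b ≤ LinearMap.ker ((X.top r).f b).hom :=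
  fun x hx => (X.top_eq_zero_iff r b x).2 hx

/-- The counit of the adjunction between `Q` and `N`, on one page. -/
def nerveCounitPage (r : ℕ) : ((N R).obj X).quotPage r ⟶ X.page r where
  f b := ModuleCat.ofHom ((((N R).obj X).degen r b).liftQ ((X.top r).f b).hom
    (X.degen_le_ker_top r b))
  comm' b c _ := by
    refine ModuleCat.hom_ext (LinearMap.ext fun x => ?_)
    obtain ⟨x, rfl⟩ := ((N R).obj X).quotπ_surjective r b x
    exact (comm_apply (X.top r) b c x).symm

/-- The counit of the adjunction between `Q` and `N`. -/
def nerveCounit : (Q R).obj ((N R).obj X) ⟶ X where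
  f := X.nerveCounitPage
  comm r b := by
    refine ModuleCat.hom_ext (LinearMap.ext fun x => ?_)
    obtain ⟨x, rfl⟩ := ((N R).obj X).quotπ_surjective (r + 1) b x
    obtain ⟨z, hz, hz'⟩ := x.2.1.1 r (by omega)
    refine hz'.symm.trans ?_
    refine Eq.trans ?_ (homologyMap_homologyπ_apply (X.nerveCounitPage r) _).symm
    congr 1
    refine iCycles_injective (X.page r) b ?_
    refine Eq.trans hz (Eq.trans ?_ (iCycles_cyclesMap_apply (X.nerveCounitPage r) _).symm)
    refine Eq.trans ?_ (congrArg ((X.nerveCounitPage r).f b).hom (congrArg (fun φ => φ.hom x)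
      ((((N R).obj X).quotPage r).liftCycles_i _ _ rfl (((N R).obj X).w_quotπ_d r b _)))).symm
    exact (X.truncSeq_of_le le_rfl b x.1.1).symm

/-- The `i`-th entry of `seq` is the class of the iterated witness image of `x` on page `i`; that
image is a truncation of `x`, and the counit extracts its last entry, namely `x_i`. -/
lemma mapSeq_nerveCounit (r : ℕ) (b : ℤ × ℤ) (x : X.nerveX r b) :
    mapSeq X.nerveCounit b (((N R).obj X).seq r b x) = x.1.1 := by
  induction r with
  | zero =>
    funext i
    rcases i with _ | i
    · exact congrArg ((X.nerveCounitPage 0).f b).hom (((N R).obj X).seq_self 0 b x)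
    · rw [x.2.1.2 _ (by omega)]
      exact (congrArg ((X.nerveCounitPage (i + 1)).f b).hom
        (((N R).obj X).seq_of_lt (by omega) b x)).trans (map_zero _)
  | succ r ih =>
    funext i
    rcases lt_trichotomy i (r + 1) with hi | rfl | hi
    · refine (congrArg ((X.nerveCounitPage i).f b).hom
        (((N R).obj X).seq_succ r i (by omega) b x)).trans ?_
      refine (congrFun (ih (X.nerveW r b x)) i).trans ?_
      exact X.truncSeq_of_le (by omega) b x.1.1
    · exact congrArg ((X.nerveCounitPage (r + 1)).f b).hom (((N R).obj X).seq_self (r + 1) b x)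
    · rw [x.2.1.2 _ hi]
      exact (congrArg ((X.nerveCounitPage i).f b).hom
        (((N R).obj X).seq_of_lt hi b x)).trans (map_zero _)

end ESpSe

variable (R) in
/-- The functor `Q` is left adjoint to the functor `N`. -/
def nerveAdj : Q R ⊣ N R where
  unit :=
    { app := LWB.nerveUnit
      naturality L L' f := by
        ext r : 1
        ext b : 1
        refine ModuleCat.hom_ext (LinearMap.ext fun a => Subtype.ext (Prod.ext ?_ ?_))
        · exact LWB.seq_map f r b a
        · refine Eq.trans ?_ (LWB.seq_map f r (b + δ r) ((L.page r).d b (b + δ r) a))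
          exact congrArg (L'.seq r (b + δ r)) (comm_apply (f.f r) b _ a).symm }
  counit :=
    { app := ESpSe.nerveCounit
      naturality X Y f := by
        ext r : 1
        ext b : 1
        refine ModuleCat.hom_ext (LinearMap.ext fun x => ?_)
        obtain ⟨x, rfl⟩ := ((N R).obj X).quotπ_surjective r b x
        rfl }
  left_triangle_components L := by
    ext r : 1
    ext b : 1
    refine ModuleCat.hom_ext (LinearMap.ext fun x => ?_)
    obtain ⟨x, rfl⟩ := L.quotπ_surjective r b x
    exact L.seq_self r b x
  right_triangle_components X := by
    ext r : 1
    ext b : 1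
    refine ModuleCat.hom_ext (LinearMap.ext fun x => Subtype.ext (Prod.ext ?_ ?_))
    · exact X.mapSeq_nerveCounit r b x
    · refine (X.mapSeq_nerveCounit r (b + δ r) _).trans ?_
      refine (congrArg (fun z : X.nerveX r (b + δ r) => z.1.1) (X.nerveD_val rfl x)).trans ?_
      exact X.castSeq_rfl_apply rfl x.1.2

/-- The projection `top` is surjective and its kernel is precisely what `Q` divides out. -/
instance isIso_nerveCounit (X : ESpSe R) : IsIso X.nerveCounit :=
  ESpSe.isIso_of_bijective _ fun r b => by
    constructor
    · refine (injective_iff_map_eq_zero ((X.nerveCounitPage r).f b).hom).2 fun x hx => ?_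
      obtain ⟨x, rfl⟩ := ((N R).obj X).quotπ_surjective r b x
      exact (((N R).obj X).quotπ_eq_zero_iff r b x).2 ((X.top_eq_zero_iff r b x).1 hx)
    · intro y
      obtain ⟨x, rfl⟩ := X.surjective_top r b y
      exact ⟨(((N R).obj X).quotπ r).f b x, rfl⟩

instance : IsIso (nerveAdj R).counit := by
  have (X : ESpSe R) : IsIso ((nerveAdj R).counit.app X) := isIso_nerveCounit X
  exact NatIso.isIso_of_isIso_app _

variable (R) in
/-- The functor `N` is fully faithful. -/
def fullyFaithfulN : (N R).FullyFaithful := (nerveAdj R).fullyFaithfulROfIsIsoCounit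

instance : (N R).Full := (fullyFaithfulN R).full

instance : (N R).Faithful := (fullyFaithfulN R).faithful

/-- Limits, colimits and the additive structure of extended spectral sequences are all inherited
from linear witness books through this reflective embedding. -/
instance : Reflective (N R) where
  L := Q R
  adj := nerveAdj R

instance : HasLimits (ESpSe R) := hasLimits_of_reflective (N R)

instance : HasColimits (ESpSe R) := hasColimits_of_reflective (N R)

instance : Preadditive (ESpSe R) := .ofFullyFaithful (fullyFaithfulN R)

/-! ### The image of `N` -/

/-- The linear witness books isomorphic to some `N(X)`: the degeneracy maps vanish on cycles. -/
def LWB.IsNerve {k : ℕ} (L : LWB R k) : Prop :=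
  ∀ (r : ℕ) (b c : ℤ × ℤ) (h : b + (1, 1) = c) (x : (L.page r).X b),
    (∀ e, (L.page r).d b e x = 0) → L.s r b c h x = 0

lemma isNerve_N (X : ESpSe R) : ((N R).obj X).IsNerve := by
  intro r b c h x hx
  have hx₁ : X.castSeq rfl x.1.2 = 0 :=
    congrArg (fun z : X.nerveX r (b + δ r) => z.1.1) ((X.nerveD_val rfl x).symm.trans (hx _))
  have hx₂ : x.1.2 = 0 := (X.castSeq_rfl_apply rfl x.1.2).symm.trans hx₁
  refine Subtype.ext (Prod.ext rfl ?_)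
  exact (congrArg (X.castSeq _) hx₂).trans (map_zero _)

namespace LWB

/-- The element is degenerate, `a = s y + d (s z)`, because its last entry vanishes. By induction `w
a = d z` and `w (d a) = d y` vanish too, so `y` and `z` are cycles, on which the degeneracy maps are
zero. -/
lemma nerveUnit_injective {L : LWB R 0} (hL : L.IsNerve) (r : ℕ) (b : ℤ × ℤ) (a : (L.page r).X b)
    (ha : L.seq r b a = 0) (ha' : L.seq r _ ((L.page r).d b (b + δ r) a) = 0) : a = 0 := by
  induction r generalizing b with
  | zero =>
    have := (L.seq_self 0 b a).symm.trans (congrFun ha 0)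
    exact (L.quotπ_eq_zero_iff 0 b a).1 this
  | succ r ih =>
    have h₁ := (L.quotπ_eq_zero_iff _ b a).1 ((L.seq_self (r + 1) b a).symm.trans (congrFun ha _))
    have hw (e) (a : (L.page (r + 1)).X e) (ha : L.seq (r + 1) e a = 0) : L.w r e a = 0 := by
      refine ih e _ (funext fun i => ?_) ?_
      · rcases le_or_gt i r with hi | hi
        · rw [← L.seq_succ r i hi, ha]
        · exact L.seq_of_lt hi _ _
      · rw [w_d_apply, map_zero]
    have hw₁ := hw b a ha
    have hw₂ := hw _ _ ha'
    obtain ⟨y, z, rfl⟩ := (L.mem_degen_iff (sub_add_cancel b (1, 1))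
      (sub_add_cancel (b - δ (r + 1)) (1, 1)) (sub_add_cancel b _) _).1 h₁
    rw [map_add, s_w_apply, s_d_w_apply, zero_add] at hw₁
    rw [map_add, map_add, s_d_w_apply, d_apply_zero, map_zero] at hw₂
    replace hw₂ := (add_zero ((L.page r).d _ _ y)).symm.trans hw₂
    have d_all {b e : ℤ × ℤ} {y : (L.page r).X b} (he : b + δ r = e)
        (hy : (L.page r).d b e y = 0) (e') : (L.page r).d b e' y = 0 := by
      by_cases h : b + δ r = e'
      · rwa [← h, he]
      · rw [(L.page r).shape _ _ h]
        rfl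
    rw [hL r _ _ _ z (d_all ((δ_succ (sub_add_cancel (b - δ (r + 1)) (1, 1))).2
        (sub_add_cancel b _)) hw₁),
      hL r _ _ _ y (d_all ((δ_succ (sub_add_cancel b (1, 1))).2 rfl) hw₂), map_zero]
    exact add_zero (0 : (L.page (r + 1)).X b)

/-- After lifting the last entry, the error lies in the kernel of `top`, hence is of the form `s y +
d (s z)` with `y`, `z` on the previous page, where the unit is surjective by induction. No condition
on `L` enters. -/
lemma nerveUnit_surjective (L : LWB R 0) (r : ℕ) (b : ℤ × ℤ) :
    Function.Surjective ((L.nerveUnit.f r).f b) := by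
  induction r generalizing b with
  | zero =>
    intro x
    obtain ⟨a, ha⟩ := L.quotπ_surjective 0 b (x.1.1 0)
    refine ⟨a, ?_⟩
    have h : (((Q R).obj L).top 0).f b ((L.nerveUnit.f 0).f b a - x) = 0 := by
      rw [map_sub, sub_eq_zero]
      exact (L.seq_self 0 b a).trans ha
    exact sub_eq_zero.1 ((((Q R).obj L).top_eq_zero_iff 0 b _).1 h)
  | succ r ih =>
    intro x
    obtain ⟨a, ha⟩ := L.quotπ_surjective (r + 1) b (x.1.1 (r + 1))
    have h : (((Q R).obj L).top (r + 1)).f b (x - (L.nerveUnit.f (r + 1)).f b a) = 0 := by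
      rw [map_sub, sub_eq_zero]
      exact ha.symm.trans (L.seq_self (r + 1) b a).symm
    obtain ⟨y, z, hyz⟩ := (mem_degen_iff _ (sub_add_cancel b (1, 1))
      (sub_add_cancel (b - δ (r + 1)) (1, 1)) (sub_add_cancel b _) _).1
        ((((Q R).obj L).top_eq_zero_iff (r + 1) b _).1 h)
    obtain ⟨y, rfl⟩ := ih _ y
    obtain ⟨z, rfl⟩ := ih _ z
    refine ⟨L.s r _ b (sub_add_cancel b (1, 1)) y + (L.page (r + 1)).d _ b
      (L.s r _ _ (sub_add_cancel (b - δ (r + 1)) (1, 1)) z) + a, ?_⟩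
    rw [map_add, map_add, comm_apply, ← comm_s_apply, ← comm_s_apply, hyz, sub_add_cancel]

/-- The unit is invertible on the image of `N`. -/
lemma isIso_nerveUnit {L : LWB R 0} (hL : L.IsNerve) : IsIso L.nerveUnit :=
  isIso_of_bijective _ fun r b => by
    refine ⟨(injective_iff_map_eq_zero ((L.nerveUnit.f r).f b).hom).2 fun a ha => ?_,
      L.nerveUnit_surjective r b⟩
    have ha' : L.nerveUnitX r b a = 0 := ha
    exact nerveUnit_injective hL r b a (congrArg (fun z => z.1.1) ha')
      (congrArg (fun z => z.1.2) ha')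

lemma IsNerve.transTrunc {L : LWB R 0} (hL : L.IsNerve) : ((transTrunc R).obj L).IsNerve := by
  intro r b c h x hx
  refine hL (r + 1) (τinv b) (τinv c) (τinv_diag h) x fun e => ?_
  rw [← τinv_τ e]
  exact hx (τ e)

lemma IsNerve.extendTrans {L : LWB R 0} (hL : L.IsNerve) : ((extendTrans R).obj L).IsNerve := by
  intro r b c h x hx
  rcases r with _ | r
  · rfl
  · refine hL r (τ b) (τ c) (τ_diag h) x fun e => ?_
    rw [← τ_τinv e]
    exact hx (τinv e)

end LWB

end SpecSeq

namespace SpecSeq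
variable {R : Type u} [CommRing R]

/-! ### Filtered colimits -/

/-- A cycle of the colimit is represented by a cycle at some stage of the filtered diagram, and
there the degeneracy maps already kill it. -/
lemma isNerve_of_isColimit {J : Type u} [SmallCategory J] [IsFiltered J] {K : J ⥤ LWB R 0}
    {c : Cocone K} (hc : IsColimit c) (hK : ∀ j, (K.obj j).IsNerve) : c.pt.IsNerve := by
  intro r b e h x hx
  have hcr := isColimitOfPreserves (LWB.pageFunctor R r) hc
  obtain ⟨j, y, rfl⟩ := exists_rep_of_isColimit hcr b x
  obtain ⟨k, f, hk⟩ := exists_map_eq_of_isColimit hcr (b + δ r) (((K.obj j).page r).d b _ y)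
    ((comm_apply ((c.ι.app j).f r) b _ y).trans (hx _))
  have hs := hK k r b e h (((K.map f).f r).f b y) fun e' => by
    by_cases he : b + δ r = e'
    · subst he
      exact (comm_apply ((K.map f).f r) b _ y).symm.trans hk
    · rw [((K.obj k).page r).shape _ _ he]
      rfl
  have hy : ((c.ι.app j).f r).f b y = ((c.ι.app k).f r).f b (((K.map f).f r).f b y) :=
    (congrArg (fun φ => ((φ : K.obj j ⟶ c.pt).f r).f b y) (c.w f)).symm
  refine (congrArg (c.pt.s r b e h) hy).trans ?_
  rw [LWB.comm_s_apply, hs, map_zero]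

/-- The colimit of the nerves is again a nerve, so the unit identifies it with `N` of its
reflection. Fullness of `N` lifts the colimit cocone to a cocone on `K`, which is a colimit because
`N` reflects colimits. -/
instance preservesFilteredColimits_N (J : Type u) [SmallCategory J] [IsFiltered J] :
    PreservesColimitsOfShape J (N R) where
  preservesColimit {K} := by
    let c := colimit.cocone (K ⋙ N R)
    have : IsIso c.pt.nerveUnit := LWB.isIso_nerveUnit
      (isNerve_of_isColimit (colimit.isColimit (K ⋙ N R)) fun j => isNerve_N (K.obj j))
    let c₀ : Cocone K :=
      { pt := (Q R).obj c.pt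
        ι :=
          { app j := (N R).preimage (c.ι.app j ≫ c.pt.nerveUnit)
            naturality j j' f := (N R).map_injective (by
              have := c.w f
              simp only [CategoryTheory.Functor.map_comp, CategoryTheory.Functor.map_preimage,
                Functor.const_obj_map]
              rw [← this, Category.assoc]
              rfl) } }
    have h : IsColimit ((N R).mapCocone c₀) :=
      IsColimit.ofIsoColimit (colimit.isColimit (K ⋙ N R))
        (Cocone.ext (asIso c.pt.nerveUnit) fun j => ((N R).map_preimage _).symm)
    exact preservesColimit_of_preserves_colimit_cocone (isColimitOfReflects (N R) h) h

attribute [local instance] Cardinal.fact_isRegular_aleph0 Cardinal.orderBotAleph0OrdToType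

instance (r : ℕ) : (LWB.pageFunctor R r).IsCardinalAccessible Cardinal.aleph0.{u} where
  preservesColimitOfShape _ _ _ := inferInstance

instance (r : ℕ) : (N R ⋙ LWB.pageFunctor R r).IsCardinalAccessible Cardinal.aleph0.{u} where
  preservesColimitOfShape J _ _ := by
    have := isFiltered_of_aleph0 J
    infer_instance

/-! ### The adjunctions between shift and décalage -/

/-- The functor `N` commutes with the functors preserving its image. -/
def nerveIso (G : LWB R 0 ⥤ LWB R 0) (hG : ∀ X : ESpSe R, (G.obj ((N R).obj X)).IsNerve) :
    N R ⋙ G ≅ (N R ⋙ G ⋙ Q R) ⋙ N R :=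
  have (X : ESpSe R) : IsIso ((Functor.whiskerLeft (N R ⋙ G) (nerveAdj R).unit).app X) :=
    LWB.isIso_nerveUnit (hG X)
  have := NatIso.isIso_of_isIso_app (Functor.whiskerLeft (N R ⋙ G) (nerveAdj R).unit)
  asIso (Functor.whiskerLeft (N R ⋙ G) (nerveAdj R).unit)

variable (R) in
/-- Décalage and `N`. -/
def nerveDecIso : N R ⋙ LWB.transTrunc R ≅ Dec R ⋙ N R :=
  nerveIso _ fun X => (isNerve_N X).transTrunc

variable (R) in
/-- The shift functor and `N`. -/
def nerveShiftIso : N R ⋙ LWB.extendTrans R ≅ Shift R ⋙ N R :=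
  nerveIso _ fun X => (isNerve_N X).extendTrans

variable (R) in
/-- The shift functor is left adjoint to décalage. -/
def shiftDecAdj : Shift R ⊣ Dec R :=
  -- The adjunction from linear witness books to extended spectral sequences is restricted along
  -- `N`: its left adjoint restricts to `Shift` by definition, and its right adjoint factors through
  -- `N` as `Dec`.
  ((LWB.extendTransAdj R).comp (nerveAdj R)).restrictFullyFaithful (fullyFaithfulN R)
    (.id (ESpSe R)) (Iso.refl _) (nerveDecIso R)

variable (R) in
/-- The shift functor is right adjoint to the functor `LDec`. -/
def decShiftAdj : LDec R ⊣ Shift R :=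
  ((LWB.leftTransAdj R).comp (nerveAdj R)).restrictFullyFaithful (fullyFaithfulN R)
    (.id (ESpSe R)) (Iso.refl _) (nerveShiftIso R)

variable (R) in
/-- Décalage is a left inverse of the shift functor. -/
def shiftDecIso : Shift R ⋙ Dec R ≅ 𝟭 (ESpSe R) :=
  Functor.fullyFaithfulCancelRight (N R)
    (Functor.isoWhiskerLeft (Shift R) (nerveDecIso R).symm ≪≫
      Functor.isoWhiskerRight (nerveShiftIso R).symm (LWB.transTrunc R) ≪≫
      Functor.isoWhiskerLeft (N R) (LWB.extendTransTruncIso R))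

/-! ### The model structures -/

lemma isAcyclic_free_page {i r : ℕ} (h : i ≤ r) {A : RBC R i} (hA : IsAcyclic A) :
    IsAcyclic (((free R i).obj A).page r) := by
  rcases h.eq_or_lt with rfl | h
  · let e : ((free R i).obj A).page i ≅ A := (LWB.freePageIso R i).app A
    exact hA.of_quasiIsos e.hom (quasiIsos_of_isIso e.hom)
  · obtain ⟨r, rfl⟩ : ∃ j, r = j + 1 := ⟨r - 1, by omega⟩
    exact isAcyclic_free A (by omega)

/-- The degeneracy map into page `r` starts on page `r - 1`, where it vanishes; for `r = 0` there is
none. -/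
lemma degen_free (r : ℕ) (A : RBC R r) (b : ℤ × ℤ) : ((free R r).obj A).degen r b = ⊥ := by
  rcases r with _ | r
  · rfl
  · exact LWB.degen_eq_bot _ (free_s_eq_zero A (Nat.lt_succ_self r)) b

lemma LWB.quasiIsos_quotπ (L : LWB R 0) (r : ℕ) (h : ∀ b, L.degen r b = ⊥) :
    quasiIsos R r (L.quotπ r) := by
  have (b : ℤ × ℤ) : IsIso ((L.quotπ r).f b) := by
    rw [ConcreteCategory.isIso_iff_bijective]
    refine ⟨(injective_iff_map_eq_zero ((L.quotπ r).f b).hom).2 fun x hx => ?_,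
      L.quotπ_surjective r b⟩
    have := (L.quotπ_eq_zero_iff r b x).1 hx
    rwa [h] at this
  have : IsIso (L.quotπ r) := HomologicalComplex.Hom.isIso_of_components _
  exact quasiIsos_of_isIso _

/-- On page `i` there is nothing to divide out, so the page is still `A`; on later pages every
element is degenerate, so the quotient is zero. -/
lemma isAcyclic_Q_free_page {i r : ℕ} (h : i ≤ r) {A : RBC R i} (hA : IsAcyclic A) :
    IsAcyclic (((Q R).obj ((free R i).obj A)).page r) := by
  rcases h.eq_or_lt with rfl | h
  · exact (isAcyclic_free_page le_rfl hA).of_quasiIsos' _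
      (((free R i).obj A).quasiIsos_quotπ i (degen_free i A))
  · obtain ⟨r, rfl⟩ : ∃ j, r = j + 1 := ⟨r - 1, by omega⟩
    intro b c _ x _
    obtain ⟨x, rfl⟩ := ((free R i).obj A).quotπ_surjective (r + 1) c x
    refine ⟨0, (map_zero _).trans ?_⟩
    exact ((((free R i).obj A).quotπ_eq_zero_iff _ c x).2 (mem_degen_free A (by omega) c x)).symm

instance (r : ℕ) : HasLimits (RBC R r) := ⟨fun _ _ => inferInstance⟩

instance (r : ℕ) : HasColimits (RBC R r) := ⟨fun _ _ => inferInstance⟩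

lemma exists_isModelStructure_RBC (r : ℕ) :
    ∃ M : ModelCategory (RBC R r), IsModelStructure M (surjective R r) (quasiIsos R r) :=
  exists_isModelStructure_of_adjunctions (ι := Unit) (rr := fun _ => r) (V := fun _ => 𝟭 _)
    (Φ := fun _ => 𝟭 _) (fun _ => Adjunction.id) () (fun _ A => isAcyclic_cover A) _ _
    (fun _ _ _ => ⟨fun h _ => h, fun h => h ()⟩) (fun _ _ _ => Iff.rfl)

/-- The general theorem with one right adjoint for each of the pages `0, …, r`, the last one
detecting weak equivalences. -/
lemma exists_isModelStructure_LWB (r : ℕ) :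
    ∃ M : ModelCategory (LWB R 0), IsModelStructure M (LWB.fib R r) (LWB.weq R r) := by
  have : (LWB.pageFunctor R (Fin.last r : Fin (r + 1))).IsCardinalAccessible
    Cardinal.aleph0.{u} := inferInstance
  exact exists_isModelStructure_of_adjunctions (ι := Fin (r + 1)) (rr := fun i => i)
    (V := fun i => LWB.pageFunctor R i) (Φ := fun i => free R i) (fun i => LWB.freeAdj R i)
    (Fin.last r) (fun i A => isAcyclic_free_page (Fin.is_le i) (isAcyclic_cover A)) _ _
    (fun _ _ _ => ⟨fun h i => h i (Fin.is_le i), fun h i hi => h ⟨i, by omega⟩⟩)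
    (fun _ _ _ => Iff.rfl)

/-- The pages of an extended spectral sequence are replaced by those of its nerve, which are the
values of right adjoints; this changes neither the fibrations nor the weak equivalences. -/
lemma exists_isModelStructure_ESpSe (r : ℕ) :
    ∃ M : ModelCategory (ESpSe R), IsModelStructure M (ESpSe.fib R r) (ESpSe.weq R r) := by
  have : (N R ⋙ LWB.pageFunctor R (Fin.last r : Fin (r + 1))).IsCardinalAccessible
    Cardinal.aleph0.{u} := inferInstance
  exact exists_isModelStructure_of_adjunctions (ι := Fin (r + 1)) (rr := fun i => i)
    (V := fun i => N R ⋙ LWB.pageFunctor R i) (Φ := fun i => free R i ⋙ Q R)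
    (fun i => (LWB.freeAdj R i).comp (nerveAdj R)) (Fin.last r)
    -- Acyclicity is required for the page of the nerve of `Q (ℱ_[i] A)`; the quasi-isomorphism
    -- `top` transfers it from the page of `Q (ℱ_[i] A)` itself.
    (fun i A => (isAcyclic_Q_free_page (Fin.is_le i) (isAcyclic_cover A)).of_quasiIsos _
      (ESpSe.quasiIsos_top _ r)) _ _
    (fun _ _ f => (ESpSe.surjective_N_map_iff f r).symm.trans
      ⟨fun h i => h i (Fin.is_le i), fun h i hi => h ⟨i, by omega⟩⟩)
    (fun _ _ f => (ESpSe.quasiIsos_N_map_iff f r).symm)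

end SpecSeq

namespace SpecSeq
variable {R : Type u} [CommRing R]

/-! ### Functors creating weak equivalences -/

section Creates

variable {C : Type u₁} [Category.{v₁} C] {D : Type u₂} [Category.{v₂} D]

/-- A functor creating the second class of morphisms and preserving the first class. -/
structure Creates (F' W' : MorphismProperty D) (F W : MorphismProperty C) (G : D ⥤ C) : Prop where
  map_fib : ∀ ⦃X Y : D⦄ (f : X ⟶ Y), F' f → F (G.map f)
  map_weq_iff : ∀ ⦃X Y : D⦄ (f : X ⟶ Y), W (G.map f) ↔ W' f

lemma Creates.isCreating {F' W' : MorphismProperty D} {F W : MorphismProperty C} {G : D ⥤ C}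
    (h : Creates F' W' F W G) {MC : ModelCategory C} {MD : ModelCategory D}
    (hC : IsModelStructure MC F W) (hD : IsModelStructure MD F' W') : IsCreating G where
  fibrations_le := by
    rw [hC.fibrations_eq, hD.fibrations_eq]
    exact fun _ _ f hf => h.map_fib f hf
  weakEquivalences_eq := by
    rw [hC.weakEquivalences_eq, hD.weakEquivalences_eq]
    ext X Y f
    exact h.map_weq_iff f

/-- If `N ⋙ G` and `T ⋙ N` are isomorphic and `G` creates the classes of morphisms, then so does
`T`, provided that `N` creates the classes on the source and the target of `T`. -/
lemma Creates.of_iso {F' W' F W : MorphismProperty D} {F₁' W₁' F₁ W₁ : MorphismProperty C}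
    [F₁.RespectsIso] [W₁.RespectsIso] {N : D ⥤ C} {G : C ⥤ C} {T : D ⥤ D} (e : N ⋙ G ≅ T ⋙ N)
    (hN' : Creates F' W' F₁' W₁' N) (hN : Creates F W F₁ W₁ N)
    (hN_fib : ∀ ⦃X Y : D⦄ (f : X ⟶ Y), F₁ (N.map f) → F f) (hG : Creates F₁' W₁' F₁ W₁ G) :
    Creates F' W' F W T where
  map_fib X Y f hf := by
    refine hN_fib _ ?_
    refine (F₁.arrow_mk_iso_iff (((Functor.mapArrowFunctor _ _).mapIso e).app (Arrow.mk f))).1 ?_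
    exact hG.map_fib _ (hN'.map_fib _ hf)
  map_weq_iff X Y f := by
    rw [← hN.map_weq_iff, ← hN'.map_weq_iff, ← hG.map_weq_iff]
    exact (W₁.arrow_mk_iso_iff (((Functor.mapArrowFunctor _ _).mapIso e).app (Arrow.mk f))).symm

end Creates

/-- In a composite adjunction the factors of the two sides occur in opposite orders, so one of the
two iterates has to be unrolled from the other end. -/
lemma iter_succ {C : Type u₁} [Category.{v₁} C] (F : C ⥤ C) (n : ℕ) :
    iter F (n + 1) = F ⋙ iter F n := by
  induction n with
  | zero => rfl
  | succ n ih => exact congrArg (· ⋙ F) ih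

lemma quasiIsos_trans {r : ℕ} {A B : RBC R r} {f : A ⟶ B} (hf : quasiIsos R r f) :
    quasiIsos R (r + 1) ((trans R r).map f) := by
  have h₁ {b c : ℤ × ℤ} (h : b + δ (r + 1) = c) : τ b + δ r = τ c := by
    subst h
    simp only [τ, δ, Prod.ext_iff, Prod.fst_add, Prod.snd_add, Nat.cast_add, Nat.cast_one]
    omega
  rw [quasiIsos_iff] at hf ⊢
  have h₂ (c : ℤ × ℤ) : τ (c + δ (r + 1)) = τ c + δ r := (h₁ rfl).symm
  -- The target of the differential after translation is `τ (c + δ (r + 1))`, which equals `τ c + δ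
  -- r` but not definitionally.
  have h₃ (K : RBC R r) (c : ℤ × ℤ) (x : K.X (τ c)) :
      ((trans R r).obj K).d c (c + δ (r + 1)) x = 0 ↔ K.d (τ c) (τ c + δ r) x = 0 := by
    rw [← h₂]
    rfl
  refine ⟨fun b c h x y hx => hf.1 (τ b) (τ c) (h₁ h) x y ((h₃ A c x).1 hx), fun b c h y hy => ?_⟩
  obtain ⟨x, z, hx, hz⟩ := hf.2 (τ b) (τ c) (h₁ h) y ((h₃ B c y).1 hy)
  exact ⟨x, z, (h₃ A c x).2 hx, hz⟩

lemma quasiIsos_transInv {r : ℕ} {A B : RBC R (r + 1)} {f : A ⟶ B} (hf : quasiIsos R (r + 1) f) :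
    quasiIsos R r ((transInv R r).map f) := by
  have h₁ {b c : ℤ × ℤ} (h : b + δ r = c) : τinv b + δ (r + 1) = τinv c := by
    subst h
    simp only [τinv, δ, Prod.ext_iff, Prod.fst_add, Prod.snd_add, Nat.cast_add, Nat.cast_one]
    omega
  rw [quasiIsos_iff] at hf ⊢
  have h₂ (c : ℤ × ℤ) : τinv (c + δ r) = τinv c + δ (r + 1) := (h₁ rfl).symm
  have h₃ (K : RBC R (r + 1)) (c : ℤ × ℤ) (x : K.X (τinv c)) :
      ((transInv R r).obj K).d c (c + δ r) x = 0 ↔ K.d (τinv c) (τinv c + δ (r + 1)) x = 0 := by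
    rw [← h₂]
    rfl
  refine ⟨fun b c h x y hx => hf.1 (τinv b) (τinv c) (h₁ h) x y ((h₃ A c x).1 hx),
    fun b c h y hy => ?_⟩
  obtain ⟨x, z, hx, hz⟩ := hf.2 (τinv b) (τinv c) (h₁ h) y ((h₃ B c y).1 hy)
  exact ⟨x, z, (h₃ A c x).2 hx, hz⟩

instance (r : ℕ) : (quasiIsos R r).RespectsIso :=
  MorphismProperty.respectsIso_of_isStableUnderComposition fun _ _ f (_ : IsIso f) =>
    quasiIsos_of_isIso f

lemma quasiIsos_trans_iff {r : ℕ} {A B : RBC R r} (f : A ⟶ B) :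
    quasiIsos R (r + 1) ((trans R r).map f) ↔ quasiIsos R r f :=
  ⟨fun h => ((quasiIsos R r).arrow_mk_iso_iff
    (((Functor.mapArrowFunctor _ _).mapIso (transUnitIso R r)).app (Arrow.mk f))).2
      (quasiIsos_transInv h), quasiIsos_trans⟩

lemma quasiIsos_transInv_iff {r : ℕ} {A B : RBC R (r + 1)} (f : A ⟶ B) :
    quasiIsos R r ((transInv R r).map f) ↔ quasiIsos R (r + 1) f :=
  ⟨fun h => ((quasiIsos R (r + 1)).arrow_mk_iso_iff
    (((Functor.mapArrowFunctor _ _).mapIso (transCounitIso R r)).app (Arrow.mk f))).1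
      (quasiIsos_trans h), quasiIsos_transInv⟩

lemma creates_transInv (r : ℕ) :
    Creates (surjective R (r + 1)) (quasiIsos R (r + 1)) (surjective R r) (quasiIsos R r)
      (transInv R r) where
  map_fib _ _ _ hf b := hf (τinv b)
  map_weq_iff _ _ f := quasiIsos_transInv_iff f

lemma creates_pageFunctor (r : ℕ) :
    Creates (LWB.fib R r) (LWB.weq R r) (surjective R r) (quasiIsos R r)
      (LWB.pageFunctor R r) where
  map_fib _ _ _ hf := hf r le_rfl
  map_weq_iff _ _ _ := Iff.rfl

lemma creates_transTrunc (r : ℕ) :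
    Creates (LWB.fib R (r + 1)) (LWB.weq R (r + 1)) (LWB.fib R r) (LWB.weq R r)
      (LWB.transTrunc R) where
  map_fib _ _ _ hf i hi b := hf (i + 1) (by omega) (τinv b)
  map_weq_iff _ _ f := quasiIsos_transInv_iff (f.f (r + 1))

lemma creates_extendTrans (r : ℕ) :
    Creates (LWB.fib R r) (LWB.weq R r) (LWB.fib R (r + 1)) (LWB.weq R (r + 1))
      (LWB.extendTrans R) where
  map_fib _ _ _ hf i hi b := by
    rcases i with _ | i
    · exact hf 0 (by omega) (τ b)
    · exact hf i (by omega) (τ b)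
  map_weq_iff _ _ f := quasiIsos_trans_iff (f.f r)

lemma creates_N (r : ℕ) :
    Creates (ESpSe.fib R r) (ESpSe.weq R r) (LWB.fib R r) (LWB.weq R r) (N R) where
  map_fib _ _ f hf := (ESpSe.surjective_N_map_iff f r).2 hf
  map_weq_iff _ _ f := ESpSe.quasiIsos_N_map_iff f r

/-- Read off from the model structure, whose fibrations are stable under isomorphism. -/
instance (r : ℕ) : (LWB.fib R r).RespectsIso := by
  obtain ⟨M, hM⟩ := exists_isModelStructure_LWB (R := R) r
  rw [← hM.fibrations_eq]
  infer_instance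

instance (r : ℕ) : (LWB.weq R r).RespectsIso :=
  inferInstanceAs ((quasiIsos R r).inverseImage (LWB.pageFunctor R r)).RespectsIso

lemma creates_Dec (r : ℕ) :
    Creates (ESpSe.fib R (r + 1)) (ESpSe.weq R (r + 1)) (ESpSe.fib R r) (ESpSe.weq R r)
      (Dec R) :=
  .of_iso (nerveDecIso R) (creates_N (r + 1)) (creates_N r)
    (fun _ _ f hf => (ESpSe.surjective_N_map_iff f r).1 hf) (creates_transTrunc r)

lemma creates_Shift (r : ℕ) :
    Creates (ESpSe.fib R r) (ESpSe.weq R r) (ESpSe.fib R (r + 1)) (ESpSe.weq R (r + 1))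
      (Shift R) :=
  .of_iso (nerveShiftIso R) (creates_N r) (creates_N (r + 1))
    (fun _ _ f hf => (ESpSe.surjective_N_map_iff f (r + 1)).1 hf) (creates_extendTrans r)

/-- The unit of the adjunction between `Q` and `N` is a quasi-isomorphism on the page `r` at the
free objects `ℱ_[r] A`. -/
lemma quasiIsos_nerveUnit_free (r : ℕ) (A : RBC R r) :
    quasiIsos R r (((free R r).obj A).nerveUnit.f r) := by
  refine (quasiIsos R r).of_postcomp (W' := quasiIsos R r) _
    (((Q R).obj ((free R r).obj A)).top r) (ESpSe.quasiIsos_top _ r) ?_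
  have e : ((free R r).obj A).nerveUnit.f r ≫ ((Q R).obj ((free R r).obj A)).top r =
      ((free R r).obj A).quotπ r := by
    ext b x
    exact ((free R r).obj A).seq_self r b x
  rw [e]
  exact LWB.quasiIsos_quotπ _ r (degen_free r A)

end SpecSeq

end

/-! ### Assembly of the Quillen equivalences. -/

theorem corollaryC (R : Type u) [CommRing R] :
    ∃ (MC : ∀ r : ℕ, ModelCategory (SpecSeq.RBC R r))
      (ML : ∀ _ : ℕ, ModelCategory (SpecSeq.LWB R 0))
      (ME : ∀ _ : ℕ, ModelCategory (SpecSeq.ESpSe R)),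
      -- the model categories of the diagram
      (∀ r : ℕ, SpecSeq.IsModelStructure (MC r) (SpecSeq.surjective R r) (SpecSeq.quasiIsos R r)) ∧
      (∀ r : ℕ, SpecSeq.IsModelStructure (ML r) (SpecSeq.LWB.fib R r) (SpecSeq.LWB.weq R r)) ∧
      (∀ r : ℕ, SpecSeq.IsModelStructure (ME r) (SpecSeq.ESpSe.fib R r) (SpecSeq.ESpSe.weq R r)) ∧
      ∀ r : ℕ,
        -- the top line, between extended spectral sequences
        SpecSeq.QuillenEquivalencePair (ME 0) (ME r)
          (SpecSeq.iter (SpecSeq.Shift R) r) (SpecSeq.iter (SpecSeq.Dec R) r) ∧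
        SpecSeq.QuillenEquivalencePair (ME r) (ME 0)
          (SpecSeq.iter (SpecSeq.LDec R) r) (SpecSeq.iter (SpecSeq.Shift R) r) ∧
        SpecSeq.QuillenEquivalencePair (ME r) (ME (r + 1)) (SpecSeq.Shift R) (SpecSeq.Dec R) ∧
        SpecSeq.QuillenEquivalencePair (ME (r + 1)) (ME r) (SpecSeq.LDec R) (SpecSeq.Shift R) ∧
        -- the vertical adjunctions
        SpecSeq.QuillenEquivalencePair (ML r) (ME r) (SpecSeq.Q R) (SpecSeq.N R) ∧
        SpecSeq.QuillenEquivalencePair (MC r) (ML r)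
          (SpecSeq.free R r) (SpecSeq.LWB.pageFunctor R r) ∧
        -- the middle line, between linear witness books
        SpecSeq.QuillenEquivalencePair (ML 0) (ML r)
          (SpecSeq.iter (SpecSeq.LWB.extendTrans R) r)
          (SpecSeq.iter (SpecSeq.LWB.transTrunc R) r) ∧
        SpecSeq.QuillenEquivalencePair (ML r) (ML (r + 1))
          (SpecSeq.LWB.extendTrans R) (SpecSeq.LWB.transTrunc R) ∧
        -- the bottom line, between bigraded complexes
        SpecSeq.QuillenEquivalencePair (MC 0) (MC r)
          (SpecSeq.transPow R r) (SpecSeq.transInvPow R r) ∧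
        (SpecSeq.transPow R r).IsEquivalence ∧
        SpecSeq.QuillenEquivalencePair (MC r) (MC (r + 1))
          (SpecSeq.trans R r) (SpecSeq.transInv R r) ∧
        (SpecSeq.trans R r).IsEquivalence ∧
        -- the composite with the projective model structure on `0`-bigraded complexes
        SpecSeq.QuillenEquivalencePair (MC 0) (ME r)
          (SpecSeq.transPow R r ⋙ SpecSeq.free R r ⋙ SpecSeq.Q R)
          (SpecSeq.N R ⋙ SpecSeq.LWB.pageFunctor R r ⋙ SpecSeq.transInvPow R r) := by
  choose MC hC using SpecSeq.exists_isModelStructure_RBC (R := R)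
  choose ML hL using SpecSeq.exists_isModelStructure_LWB (R := R)
  choose ME hE using SpecSeq.exists_isModelStructure_ESpSe (R := R)
  have shift (r : ℕ) : SpecSeq.QuillenEquivalencePair (ME r) (ME (r + 1)) (SpecSeq.Shift R)
      (SpecSeq.Dec R) :=
    .of_iso (SpecSeq.shiftDecAdj R) (SpecSeq.shiftDecIso R)
      ((SpecSeq.creates_Dec r).isCreating (hE r) (hE (r + 1)))
  have dec (r : ℕ) : SpecSeq.QuillenEquivalencePair (ME (r + 1)) (ME r) (SpecSeq.LDec R)
      (SpecSeq.Shift R) :=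
    .of_triple (SpecSeq.decShiftAdj R) (SpecSeq.shiftDecAdj R) (SpecSeq.shiftDecIso R)
      ((SpecSeq.creates_Shift r).isCreating (hE (r + 1)) (hE r))
      ((SpecSeq.creates_Dec r).isCreating (hE r) (hE (r + 1)))
  have page (r : ℕ) : SpecSeq.QuillenEquivalencePair (MC r) (ML r)
      (SpecSeq.free R r) (SpecSeq.LWB.pageFunctor R r) :=
    .of_iso (SpecSeq.LWB.freeAdj R r) (SpecSeq.LWB.freePageIso R r)
      ((SpecSeq.creates_pageFunctor r).isCreating (hC r) (hL r))
  have nerve (r : ℕ) : SpecSeq.QuillenEquivalencePair (ML r) (ME r) (SpecSeq.Q R)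
      (SpecSeq.N R) :=
    -- The counit `ℱ_[r] L_r ⟶ L` is a weak equivalence, so the unit of `Q ⊣ N` has to be checked
    -- only on the books `ℱ_[r] A`. There it agrees on page `r`, up to the quasi-isomorphism `top`,
    -- with the projection to the quotient by zero.
    .of_comp (SpecSeq.LWB.freeAdj R r) (SpecSeq.LWB.freePageIso R r)
      ((SpecSeq.creates_pageFunctor r).isCreating (hC r) (hL r)) (SpecSeq.nerveAdj R)
      ((SpecSeq.creates_N r).isCreating (hL r) (hE r)) fun A => by
        rw [(hL r).weakEquivalences_eq]
        exact SpecSeq.quasiIsos_nerveUnit_free r A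
  have extend (r : ℕ) : SpecSeq.QuillenEquivalencePair (ML r) (ML (r + 1))
      (SpecSeq.LWB.extendTrans R) (SpecSeq.LWB.transTrunc R) :=
    .of_iso (SpecSeq.LWB.extendTransAdj R) (SpecSeq.LWB.extendTransTruncIso R)
      ((SpecSeq.creates_transTrunc r).isCreating (hL r) (hL (r + 1)))
  have trans (r : ℕ) : SpecSeq.QuillenEquivalencePair (MC r) (MC (r + 1))
      (SpecSeq.trans R r) (SpecSeq.transInv R r) :=
    .of_iso (SpecSeq.transEquivalence R r).toAdjunction (SpecSeq.transUnitIso R r).symm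
      ((SpecSeq.creates_transInv r).isCreating (hC r) (hC (r + 1)))
  have shiftPow (r : ℕ) : SpecSeq.QuillenEquivalencePair (ME 0) (ME r)
      (SpecSeq.iter (SpecSeq.Shift R) r) (SpecSeq.iter (SpecSeq.Dec R) r) := by
    induction r with
    | zero => exact .refl (ME 0)
    | succ r ih =>
      -- The left adjoint `Shift` acquires its new factor at the end, so the right adjoint `Dec`
      -- must acquire it at the beginning; for `LDec` and `Shift` below it is the left adjoint that
      -- is unrolled.
      rw [SpecSeq.iter_succ (SpecSeq.Dec R)]
      exact ih.comp (shift r)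
  have decPow (r : ℕ) : SpecSeq.QuillenEquivalencePair (ME r) (ME 0)
      (SpecSeq.iter (SpecSeq.LDec R) r) (SpecSeq.iter (SpecSeq.Shift R) r) := by
    induction r with
    | zero => exact .refl (ME 0)
    | succ r ih =>
      rw [SpecSeq.iter_succ (SpecSeq.LDec R)]
      exact (dec r).comp ih
  have extendPow (r : ℕ) : SpecSeq.QuillenEquivalencePair (ML 0) (ML r)
      (SpecSeq.iter (SpecSeq.LWB.extendTrans R) r)
      (SpecSeq.iter (SpecSeq.LWB.transTrunc R) r) := by
    induction r with
    | zero => exact .refl (ML 0)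
    | succ r ih =>
      rw [SpecSeq.iter_succ (SpecSeq.LWB.transTrunc R)]
      exact ih.comp (extend r)
  have transPow (r : ℕ) : SpecSeq.QuillenEquivalencePair (MC 0) (MC r)
      (SpecSeq.transPow R r) (SpecSeq.transInvPow R r) := by
    induction r with
    | zero => exact .refl (MC 0)
    | succ r ih => exact ih.comp (trans r)
  exact ⟨MC, ML, ME, hC, hL, hE, fun r => ⟨shiftPow r, decPow r, shift r, dec r, nerve r, page r,
    extendPow r, extend r, transPow r, inferInstance, trans r, inferInstance,
    (transPow r).comp ((page r).comp (nerve r))⟩⟩
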